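/- **Structure Lemma II for $\mathsf{THR}\circ\mathsf{THR}$ circuits.** A $\mathsf{THR}$ gate computes $[\,w\cdot x\ge t\,]$ for a real weight vector $w$ and a real threshold $t$; a $\mathsf{MAJ}$ gate is a threshold gate all of whose weights are $1$ (with any threshold). The bottom gates of a $\mathsf{MAJ}\circ\mathsf{MAJ}$ circuit read variables or negated variables, and wires may be repeated. A $\mathsf{DISJOR}$ gate is an $\mathsf{OR}$ gate with the promise that on every input at most one of its inputs is true. The size of a $\mathsf{THR}\circ\mathsf{THR}$ circuit is the number of its gates plus the number of input variables it uses; the size of a $\mathsf{MAJ}\circ\mathsf{MAJ}$ circuit is the number of its gates plus the number of its wires. Let $s:\mathbb N\to\mathbb N$ satisfy $s(n)=2^{o(n)}$, let $n\ge 1$, write $s=s(n)$, and let $\varepsilon\in\left(\frac{\log_2 s}{n},1\right)$ be real. Then every $\mathsf{THR}\circ\mathsf{THR}$ circuit $C$ of size at most $s$ on $n$ inputs is equivalent to a $\mathsf{DISJOR}\circ\mathsf{MAJ}\circ\mathsf{MAJ}$ circuit such that * the top $\mathsf{DISJOR}$ gate has fan-in at most $2^{O(\varepsilon n)}\cdot\mathrm{poly}(s)$;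 * each $\mathsf{MAJ}\circ\mathsf{MAJ}$ subcircuit has size at most $s^{O(1/\varepsilon)}\cdot\mathrm{poly}(s)$. The constants hidden in $O(\cdot)$ and $\mathrm{poly}(\cdot)$ are absolute. Moreover, there is one randomized algorithm that computes such circuits. It is given $C$, with integer weights and thresholds of bit length at most $\mathrm{poly}(s)$, and the number $\lceil 1/\varepsilon\rceil$. It always halts within $2^{O(\varepsilon n)}\cdot s^{O(1/\varepsilon)}\cdot\mathrm{poly}(s)$ steps, and with probability at least $2/3$ over its coin tosses it outputs a $\mathsf{DISJOR}\circ\mathsf{MAJ}\circ\mathsf{MAJ}$ circuit that is equivalent to $C$ and satisfies the two bounds above. Here the hidden constants depend only on the polynomial that bounds the bit length of the weights. Time is measured on a randomized random access machine with integer cells and unit-cost addition, subtraction, halving, indirect addressing and coin tossing (polynomially equivalent to randomized Turing machines). -/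

import Mathlib

/-! ### Threshold circuits of depth two -/

/-- The integer or real value of a bit. -/
def bitVal {R : Type*} [Zero R] [One R] (b : Bool) : R := if b then 1 else 0

/-- A threshold gate `THR_{w,t}` with `m` inputs, with weights and threshold in `R`. -/
structure ThrGate (R : Type*) (m : ℕ) where
  weight : Fin m → R
  threshold : R

/-- `THR_{w,t}(x) = [w · x ≥ t]`. -/
def ThrGate.eval {R : Type*} [Ring R] [LinearOrder R] {m : ℕ} (g : ThrGate R m)
    (x : Fin m → Bool) : Bool :=
  decide (g.threshold ≤ ∑ i, g.weight i * bitVal (x i))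

/-- A `THR ∘ THR` circuit on `n` input variables: `width` threshold gates reading the variables,
and a threshold gate reading their outputs. -/
structure ThrThr (R : Type*) (n : ℕ) where
  width : ℕ
  bottom : Fin width → ThrGate R n
  top : ThrGate R width

/-- The Boolean function computed by a `THR ∘ THR` circuit. -/
def ThrThr.eval {R : Type*} [Ring R] [LinearOrder R] {n : ℕ} (c : ThrThr R n)
    (x : Fin n → Bool) : Bool :=
  c.top.eval fun j => (c.bottom j).eval x

/-- The size of a `THR ∘ THR` circuit: its number of nodes, that is, the output gate, the bottom
gates, and the input variables that are wired (with nonzero weight) to some bottom gate.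
This never exceeds the number of gates plus the number of wires. -/
noncomputable def ThrThr.size {R : Type*} [Zero R] {n : ℕ} (c : ThrThr R n) : ℕ :=
  1 + c.width + {i : Fin n | ∃ j, (c.bottom j).weight i ≠ 0}.ncard

/-- All weights and thresholds of an integer circuit have absolute value at most `2 ^ b`. -/
def ThrThr.WeightsLE {n : ℕ} (c : ThrThr ℤ n) (b : ℕ) : Prop :=
  (|c.top.threshold| ≤ 2 ^ b ∧ ∀ j, |c.top.weight j| ≤ 2 ^ b) ∧
    ∀ j, |(c.bottom j).threshold| ≤ 2 ^ b ∧ ∀ i, |(c.bottom j).weight i| ≤ 2 ^ b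

/-! ### Majority circuits of depth two, and disjoint ORs of them -/

/-- A literal on `n` variables: a variable, or its negation. -/
structure Literal (n : ℕ) where
  var : Fin n
  negated : Bool

/-- The value of a literal. -/
def Literal.eval {n : ℕ} (l : Literal n) (x : Fin n → Bool) : Bool := xor l.negated (x l.var)

/-- A `MAJ` gate (a threshold gate all of whose weights are `1`) reading literals.
A literal may be read several times; each occurrence is a wire. -/
structure MajGate (n : ℕ) where
  inputs : List (Literal n)
  threshold : ℤ

/-- A `MAJ` gate compares the number of its true inputs with its threshold. -/
def MajGate.eval {n : ℕ} (g : MajGate n) (x : Fin n → Bool) : Bool :=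
  decide (g.threshold ≤ (g.inputs.countP fun l => l.eval x : ℕ))

/-- A `MAJ ∘ MAJ` circuit: a `MAJ` gate whose inputs are `MAJ` gates reading literals.
A bottom gate that is wired several times to the top gate is listed (and counted) that often. -/
structure MajMaj (n : ℕ) where
  gates : List (MajGate n)
  threshold : ℤ

/-- The Boolean function computed by a `MAJ ∘ MAJ` circuit. -/
def MajMaj.eval {n : ℕ} (m : MajMaj n) (x : Fin n → Bool) : Bool :=
  decide (m.threshold ≤ (m.gates.countP fun g => g.eval x : ℕ))

/-- The size of a `MAJ ∘ MAJ` circuit: the number of its gates plus the number of its wires.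
The top gate counts one; each bottom gate counts one for itself, one for its wire to the top gate,
and one for each wire that enters it. -/
def MajMaj.size {n : ℕ} (m : MajMaj n) : ℕ :=
  1 + (m.gates.map fun g => g.inputs.length + 2).sum

/-- A `DISJOR ∘ MAJ ∘ MAJ` circuit: an `OR` of `MAJ ∘ MAJ` circuits, with the promise that on
every input at most one of them is true. -/
structure DisjOrMajMaj (n : ℕ) where
  subs : List (MajMaj n)
  disjoint : ∀ x : Fin n → Bool, (subs.countP fun m => m.eval x) ≤ 1

/-- The Boolean function computed by a `DISJOR ∘ MAJ ∘ MAJ` circuit. -/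
def DisjOrMajMaj.eval {n : ℕ} (d : DisjOrMajMaj n) (x : Fin n → Bool) : Bool :=
  d.subs.any fun m => m.eval x

/-- `d` is equivalent to the Boolean function `f`, its `DISJOR` gate has fan-in at most `A`, and
each of its `MAJ ∘ MAJ` subcircuits has size at most `B`. -/
def DisjOrMajMaj.Realizes {n : ℕ} (d : DisjOrMajMaj n) (f : (Fin n → Bool) → Bool)
    (A B : ℝ) : Prop :=
  (∀ x, d.eval x = f x) ∧ (d.subs.length : ℝ) ≤ A ∧ ∀ m ∈ d.subs, (m.size : ℝ) ≤ B

/-! ### Descriptions of circuits as lists of integers -/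

/-- The weights of an integer threshold gate, preceded by the threshold. -/
def ThrGate.encode {m : ℕ} (g : ThrGate ℤ m) : List ℤ := g.threshold :: List.ofFn g.weight

/-- The number of variables, the number of bottom gates, the top gate, the bottom gates. -/
def ThrThr.encode {n : ℕ} (c : ThrThr ℤ n) : List ℤ :=
  (n : ℤ) :: (c.width : ℤ) :: (c.top.encode ++ (List.ofFn fun j => (c.bottom j).encode).flatten)

/-- The `i`-th variable (counted from `0`) is `i + 1`, its negation is `-(i + 1)`. -/
def Literal.encode {n : ℕ} (l : Literal n) : ℤ :=
  if l.negated then -((l.var : ℕ) + 1 : ℤ) else ((l.var : ℕ) + 1 : ℤ)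

/-- The threshold, the fan-in, the inputs. -/
def MajGate.encode {n : ℕ} (g : MajGate n) : List ℤ :=
  g.threshold :: (g.inputs.length : ℤ) :: g.inputs.map Literal.encode

/-- The threshold, the fan-in, the gates. -/
def MajMaj.encode {n : ℕ} (m : MajMaj n) : List ℤ :=
  m.threshold :: (m.gates.length : ℤ) :: (m.gates.map MajGate.encode).flatten

/-- The fan-in, the subcircuits. -/
def DisjOrMajMaj.encode {n : ℕ} (d : DisjOrMajMaj n) : List ℤ :=
  (d.subs.length : ℤ) :: (d.subs.map MajMaj.encode).flatten

/-! ### Randomized random access machines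

The machine has a memory of cells `0, 1, 2, …` holding integers, a read-only input array, fair
coins, and a write-only output list. The arithmetic operations are addition, subtraction and
halving (no multiplication), so that `t` steps lengthen the numbers by at most `t` bits and unit
cost agrees with Turing machine time up to a polynomial. -/

/-- Programs of the machine. Arguments `d`, `a`, `b` are fixed addresses of memory cells. -/
inductive Ram : Type
  | const (d : ℕ) (v : ℤ) : Ram
  | add (d a b : ℕ) : Ram
  | sub (d a b : ℕ) : Ram
  | half (d a : ℕ) : Ram
  | load (d a : ℕ) : Ram
  | store (a b : ℕ) : Ram
  | read (d a : ℕ) : Ram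
  | flip (d : ℕ) : Ram
  | emit (a : ℕ) : Ram
  | seq (p q : Ram) : Ram
  | ifPos (a : ℕ) (p q : Ram) : Ram
  | whilePos (a : ℕ) (p : Ram) : Ram

/-- A configuration: the memory, the number of coins tossed so far, the output so far. -/
structure RamState where
  mem : ℕ → ℤ
  coins : ℕ
  out : List ℤ

/-- The initial configuration. -/
def RamState.init : RamState := ⟨fun _ => 0, 0, []⟩

/-- Assign the value `v` to the memory cell `d`. -/
def RamState.assign (σ : RamState) (d : ℕ) (v : ℤ) : RamState :=
  { σ with mem := Function.update σ.mem d v }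

/-- `Ram.Run inp ω p σ t τ`: on the input array `inp` and with coin tosses `ω 0, ω 1, …`, the
program `p` started in configuration `σ` halts after exactly `t` steps in configuration `τ`. -/
inductive Ram.Run (inp : List ℤ) (ω : ℕ → Bool) : Ram → RamState → ℕ → RamState → Prop
  | const (d : ℕ) (v : ℤ) (σ : RamState) : Run inp ω (.const d v) σ 1 (σ.assign d v)
  | add (d a b : ℕ) (σ : RamState) :
      Run inp ω (.add d a b) σ 1 (σ.assign d (σ.mem a + σ.mem b))
  | sub (d a b : ℕ) (σ : RamState) :
      Run inp ω (.sub d a b) σ 1 (σ.assign d (σ.mem a - σ.mem b))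
  | half (d a : ℕ) (σ : RamState) : Run inp ω (.half d a) σ 1 (σ.assign d (σ.mem a / 2))
  | load (d a : ℕ) (σ : RamState) :
      Run inp ω (.load d a) σ 1 (σ.assign d (σ.mem (σ.mem a).toNat))
  | store (a b : ℕ) (σ : RamState) :
      Run inp ω (.store a b) σ 1 (σ.assign (σ.mem a).toNat (σ.mem b))
  | read (d a : ℕ) (σ : RamState) :
      Run inp ω (.read d a) σ 1 (σ.assign d (inp.getD (σ.mem a).toNat 0))
  | flip (d : ℕ) (σ : RamState) :
      Run inp ω (.flip d) σ 1
        { σ.assign d (bitVal (ω σ.coins)) with coins := σ.coins + 1 }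
  | emit (a : ℕ) (σ : RamState) :
      Run inp ω (.emit a) σ 1 { σ with out := σ.out ++ [σ.mem a] }
  | seq {p q : Ram} {σ τ υ : RamState} {t u : ℕ} :
      Run inp ω p σ t τ → Run inp ω q τ u υ → Run inp ω (.seq p q) σ (t + u) υ
  | ifTrue {a : ℕ} {p q : Ram} {σ τ : RamState} {t : ℕ} :
      0 < σ.mem a → Run inp ω p σ t τ → Run inp ω (.ifPos a p q) σ (1 + t) τ
  | ifFalse {a : ℕ} {p q : Ram} {σ τ : RamState} {t : ℕ} :
      σ.mem a ≤ 0 → Run inp ω q σ t τ → Run inp ω (.ifPos a p q) σ (1 + t) τ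
  | whileTrue {a : ℕ} {p : Ram} {σ τ υ : RamState} {t u : ℕ} :
      0 < σ.mem a → Run inp ω p σ t τ → Run inp ω (.whilePos a p) τ u υ →
        Run inp ω (.whilePos a p) σ (1 + t + u) υ
  | whileFalse {a : ℕ} {p : Ram} {σ : RamState} :
      σ.mem a ≤ 0 → Run inp ω (.whilePos a p) σ 1 σ

/-- With the coin tosses `ω`, the program halts on `inp` within `T` steps with output `out`. -/
def Ram.Outputs (p : Ram) (inp : List ℤ) (ω : ℕ → Bool) (T : ℕ) (out : List ℤ) : Prop :=
  ∃ t ≤ T, ∃ σ : RamState, Ram.Run inp ω p RamState.init t σ ∧ σ.out = out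

/-- The program halts on `inp` within `T` steps, whatever the outcome of its coin tosses. -/
def Ram.HaltsWithin (p : Ram) (inp : List ℤ) (T : ℕ) : Prop :=
  ∀ ω : ℕ → Bool, ∃ out, p.Outputs inp ω T out

/-- Continue a finite sequence of coin tosses by `false`. -/
def extendCoins {T : ℕ} (r : Fin T → Bool) (i : ℕ) : Bool :=
  if h : i < T then r ⟨i, h⟩ else false

/-- The probability, over fair coin tosses, that the program halts on `inp` within `T` steps with
an output that satisfies `Q`. Within `T` steps only the first `T` coins matter. -/
noncomputable def Ram.prob (p : Ram) (inp : List ℤ) (T : ℕ) (Q : List ℤ → Prop) : ℝ :=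
  (Nat.card {r : Fin T → Bool // ∃ out, Q out ∧ p.Outputs inp (extendCoins r) T out} : ℝ) / 2 ^ T

/-! ### The bounds -/

/-- `2^{C ε n} · C s^C`. -/
noncomputable def fanInBound (C n s : ℕ) (ε : ℝ) : ℝ :=
  (2 : ℝ) ^ ((C : ℝ) * ε * n) * (C * (s : ℝ) ^ C)

/-- `s^{C/ε} · C s^C`. -/
noncomputable def subSizeBound (C s : ℕ) (ε : ℝ) : ℝ :=
  (s : ℝ) ^ ((C : ℝ) / ε) * (C * (s : ℝ) ^ C)

/-- `2^{C ε n} · s^{C/ε} · C s^C`. -/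
noncomputable def timeBound (C n s : ℕ) (ε : ℝ) : ℝ :=
  (2 : ℝ) ^ ((C : ℝ) * ε * n) * (s : ℝ) ^ ((C : ℝ) / ε) * (C * (s : ℝ) ^ C)

/-! Write `e = ⌈1/ε⌉`. The construction is a chain of identities between sums of 0/1 indicators,
each replacing a gate by a sum of simpler tests. A disjoint OR is a sum of indicators that never
exceeds 1, so the final identity `Net.countP_subs` gives equivalence and disjointness at once.

From thresholds to exact tests: multiply weights by `m + 1`, where `m` exceeds every fan-in, and let
`A i` be the form minus the threshold after every coefficient is shifted right by `i` bits and
rounded down. Then `A i` and `2 * A (i + 1)` differ by at most `m`, so the sequence passes from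
above `m` to at most `m` at most once, and there `A i ≤ 3 * m`. The gate is therefore a sum, over
the shift and polynomially many codes of the value and its rounding error, of tests "linear form =
constant" (`thr_eq_sum`).

The top gate: an exact test with huge coefficients is replaced by congruences modulo `k` random
primes. After reduction to remainders, a congruence is a disjoint union of at most `w` equations,
one for each quotient (`sum_rem_eq`); a string `γ` of `k` digits in base `w` guesses all quotients
(`Net.sum_quad`). A nonzero value below `2 ^ B` has at most `B` prime divisors. A prime drawn from
`2 ^ b` candidates is thus bad with probability at most `2 ^ (-sg * e)`, and about `wired / (sg *
e)` primes survive a union bound over all inputs, shifts and codes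
(`Net.three_mul_card_not_good_le`). As `w ≤ 2 ^ sg`, there are only `2 ^ (n / e) * poly(s)` strings
`γ`, while the primes are `s ^ O(e)`: this is the tradeoff governed by `ε`.

A subcircuit: `k` equations hold together iff the sum of the squared differences vanishes. This is a
quadratic form in the bottom gates, hence in the exact tests that they split into. A product of two
exact tests is approximated by averaging, over the first `R` primes `q`, the indicator that `q`
divides both linear forms; `R` is so large that the total error stays below 1/2, and one threshold
separates 0 from the positive integers (`Net.eval_sub`). Divisibility of both forms by `q` is a sum
of single equations with small coefficients (`Net.sum_combined`), and an equation with an integer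
multiplicity is a family of pairs of majority gates (`sum_copies`).

The algorithm: `CZ`, `CN`, `CB` and `EM` express computability within a power of a budget, and are
closed under arithmetic, case distinctions, loops and output. The formula of each parameter thereby
becomes its own proof of computability. The budget is `s ^ e * 2 ^ (n / e + 1)`, with exponents
depending only on the weight parameter. Coins are first gathered into one number in cell 0; all
later phases are deterministic.

Real weights are replaced by integers through iterated simultaneous approximation
(`exists_int_weights`). A positive success probability then yields existence. -/

/-! ### Polynomial bounds -/

/-- `N` is bounded by a power of `X`, with an exponent that depends only on the parameter. -/
def PolyLe {ι : Type} (X par N : ι → ℕ) : Prop := ∃ C : ℕ → ℕ, ∀ i, N i ≤ X i ^ C (par i)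

namespace PolyLe

variable {ι : Type} {X par M N : ι → ℕ}

theorem mono (h : PolyLe X par M) (hNM : ∀ i, N i ≤ M i) : PolyLe X par N :=
  let ⟨C, hC⟩ := h
  ⟨C, fun i => (hNM i).trans (hC i)⟩

theorem self : PolyLe X par X := ⟨fun _ => 1, fun i => by simp⟩

theorem comp {κ : Type} (h : PolyLe X par N) (π : κ → ι) :
    PolyLe (fun j => X (π j)) (fun j => par (π j)) (fun j => N (π j)) :=
  let ⟨C, hC⟩ := h
  ⟨C, fun j => hC (π j)⟩

/-- Since `c ≤ 2 ^ c ≤ X ^ c`, any function of the parameter can be absorbed into the exponent. -/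
theorem ofPar (hX : ∀ i, 2 ≤ X i) (c : ℕ → ℕ) : PolyLe X par (fun i => c (par i)) :=
  ⟨c, fun i => (Nat.lt_two_pow_self).le.trans (Nat.pow_le_pow_left (hX i) _)⟩

theorem const (hX : ∀ i, 2 ≤ X i) (c : ℕ) : PolyLe X par (fun _ => c) := ofPar hX fun _ => c

theorem mul (hM : PolyLe X par M) (hN : PolyLe X par N) :
    PolyLe X par (fun i => M i * N i) :=
  let ⟨C, hC⟩ := hM
  let ⟨D, hD⟩ := hN
  ⟨fun k => C k + D k, fun i => by
    rw [pow_add]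
    exact Nat.mul_le_mul (hC i) (hD i)⟩

theorem add (hX : ∀ i, 2 ≤ X i) (hM : PolyLe X par M) (hN : PolyLe X par N) :
    PolyLe X par (fun i => M i + N i) := by
  obtain ⟨C, hC⟩ := hM
  obtain ⟨D, hD⟩ := hN
  refine ⟨fun k => C k + D k + 1, fun i => ?_⟩
  have h1 : 1 ≤ X i := (hX i).trans' (by norm_num)
  calc M i + N i ≤ X i ^ (C (par i) + D (par i)) + X i ^ (C (par i) + D (par i)) :=
        Nat.add_le_add ((hC i).trans (Nat.pow_le_pow_right h1 (by omega)))
          ((hD i).trans (Nat.pow_le_pow_right h1 (by omega)))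
    _ = X i ^ (C (par i) + D (par i)) * 2 := by ring
    _ ≤ X i ^ (C (par i) + D (par i)) * X i := Nat.mul_le_mul_left _ (hX i)
    _ = _ := (pow_succ _ _).symm

theorem pow (hX : ∀ i, 2 ≤ X i) (hM : PolyLe X par M) (c : ℕ) :
    PolyLe X par (fun i => M i ^ c) := by
  induction c with
  | zero => simpa using const hX 1
  | succ c ih => simpa only [pow_succ] using ih.mul hM

theorem powPar (hM : PolyLe X par M) (c : ℕ → ℕ) :
    PolyLe X par (fun i => M i ^ c (par i)) :=
  let ⟨C, hC⟩ := hM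
  ⟨fun k => C k * c k, fun i => by
    rw [pow_mul]
    exact Nat.pow_le_pow_left (hC i) _⟩

/-- This passes between the three budgets used below: `s` for parameters of the circuit, `Y = s ^ e`
for subcircuits, and `X` for time. -/
theorem trans {Y : ι → ℕ} (hM : PolyLe X par M) (hX : PolyLe Y par X) : PolyLe Y par M := by
  obtain ⟨C, hC⟩ := hM
  exact (hX.powPar C).mono hC

end PolyLe

/-- The bit length of `f` is bounded by a power of `X`. -/
def BitLe {ι : Type} (X par : ι → ℕ) (f : ι → ℤ) : Prop :=
  PolyLe X par fun i => (f i).natAbs.size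

namespace BitLe

variable {ι : Type} {X par : ι → ℕ} {f g : ι → ℤ}

theorem of_le {L : ι → ℕ} (hX : ∀ i, 2 ≤ X i) (hL : PolyLe X par L)
    (h : ∀ i, |f i| ≤ 2 ^ L i) : BitLe X par f := by
  refine (hL.add hX (PolyLe.const hX 1)).mono fun i => Nat.size_le.2 ?_
  have := h i
  rw [Int.abs_eq_natAbs] at this
  have h2 : (f i).natAbs ≤ 2 ^ L i := by exact_mod_cast this
  exact h2.trans_lt (Nat.pow_lt_pow_right (by norm_num) (by omega))

theorem abs_lt (f : ι → ℤ) (i : ι) : |f i| < 2 ^ (f i).natAbs.size := by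
  rw [Int.abs_eq_natAbs]
  exact_mod_cast Nat.lt_size_self _

theorem mono (hg : BitLe X par g) (h : ∀ i, |f i| ≤ |g i|) : BitLe X par f :=
  PolyLe.mono hg fun i => Nat.size_le_size (by
    have := h i
    rw [Int.abs_eq_natAbs, Int.abs_eq_natAbs] at this
    exact_mod_cast this)

end BitLe

/-! ### Families of inputs and contexts -/

/-- A family of inputs of a machine, each with a budget `X`, a parameter, and a number `base` that
is stored in cell `0`. -/
structure Fam where
  I : Type
  inp : I → List ℤ
  X : I → ℕ
  par : I → ℕ
  base : I → ℤ
  two_le_X : ∀ i, 2 ≤ X i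
  bit_inp : ∃ C : ℕ → ℕ, ∀ i j, ((inp i).getD j 0).natAbs.size ≤ X i ^ C (par i)
  bit_base : BitLe X par base

/-- A family of situations: the input, and the known contents of some of the memory cells
below `dep`. -/
structure Ctx (F : Fam) (β : Type) where
  inst : β → F.I
  dep : ℕ
  st : ℕ → Option (β → ℤ)
  dep_pos : 0 < dep
  st_zero : st 0 = some fun b => F.base (inst b)

namespace Ctx

variable {F : Fam} {β : Type}

def Poly (Γ : Ctx F β) (N : β → ℕ) : Prop :=
  PolyLe (fun b => F.X (Γ.inst b)) (fun b => F.par (Γ.inst b)) N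

def Bit (Γ : Ctx F β) (f : β → ℤ) : Prop :=
  BitLe (fun b => F.X (Γ.inst b)) (fun b => F.par (Γ.inst b)) f

theorem two_le_X (Γ : Ctx F β) (b : β) : 2 ≤ F.X (Γ.inst b) := F.two_le_X _

theorem Poly.const (Γ : Ctx F β) (c : ℕ) : Γ.Poly fun _ => c := PolyLe.const Γ.two_le_X c

theorem Poly.add {Γ : Ctx F β} {M N : β → ℕ} (hM : Γ.Poly M) (hN : Γ.Poly N) :
    Γ.Poly fun b => M b + N b := PolyLe.add Γ.two_le_X hM hN

theorem Poly.mul {Γ : Ctx F β} {M N : β → ℕ} (hM : Γ.Poly M) (hN : Γ.Poly N) :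
    Γ.Poly fun b => M b * N b := PolyLe.mul hM hN

theorem Poly.mono {Γ : Ctx F β} {M N : β → ℕ} (hM : Γ.Poly M) (h : ∀ b, N b ≤ M b) :
    Γ.Poly N := PolyLe.mono hM h

theorem Bit.of_le {Γ : Ctx F β} {L : β → ℕ} {f : β → ℤ} (hL : Γ.Poly L)
    (h : ∀ b, |f b| ≤ 2 ^ L b) : Γ.Bit f := BitLe.of_le Γ.two_le_X hL h

/-- The known cells have the values that they should have. -/
def Holds (Γ : Ctx F β) (b : β) (mem : ℕ → ℤ) : Prop :=
  ∀ i < Γ.dep, ∀ f, Γ.st i = some f → mem i = f b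

theorem Holds.congr {Γ : Ctx F β} {b : β} {m m' : ℕ → ℤ} (h : Γ.Holds b m) (d : ℕ)
    (hm : ∀ i < Γ.dep + d, m' i = m i) : Γ.Holds b m' := fun i hi f hf => by
  rw [hm i (by omega)]
  exact h i hi f hf

/-- The context inside a loop that is run `N` times, whose variables have the values `U i` and `V i`
before round `i`. -/
def loop (Γ : Ctx F β) (d : ℕ) (N : β → ℕ) (U V : β → ℕ → ℤ) :
    Ctx F (Σ b, Fin (N b)) where
  inst x := Γ.inst x.1
  dep := Γ.dep + d + 2
  st i := if i < Γ.dep then (Γ.st i).map (fun f x => f x.1)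
    else if i = Γ.dep + d then some fun x => U x.1 x.2
    else if i = Γ.dep + d + 1 then some fun x => V x.1 x.2 else none
  dep_pos := by omega
  st_zero := by simp [Γ.dep_pos, Γ.st_zero]

theorem holds_loop {Γ : Ctx F β} {d : ℕ} {N : β → ℕ} {U V : β → ℕ → ℤ} {b : β} {i : Fin (N b)}
    {m : ℕ → ℤ} : (Γ.loop d N U V).Holds ⟨b, i⟩ m ↔
      Γ.Holds b m ∧ m (Γ.dep + d) = U b i ∧ m (Γ.dep + d + 1) = V b i := by
  constructor
  · intro h
    refine ⟨fun j hj f hf => ?_, ?_, ?_⟩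
    · refine h j (by simp only [loop]; omega) (fun x => f x.1) ?_
      simp [loop, hj, hf]
    · exact h (Γ.dep + d) (by simp only [loop]; omega) _ (by simp [loop]; rfl)
    · exact h (Γ.dep + d + 1) (by simp only [loop]; omega) (fun x => V x.1 x.2)
        (by simp only [loop]; rw [if_neg (by omega), if_neg (by omega), if_pos trivial])
  · rintro ⟨h, hU, hV⟩ j hj f hf
    simp only [loop] at hf
    split_ifs at hf with h1 h2 h3
    · obtain ⟨g, hg, rfl⟩ := Option.map_eq_some_iff.1 hf
      exact h j h1 g hg
    · cases hf; subst h2; exact hU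
    · cases hf; subst h3; exact hV

theorem Poly.lift {Γ : Ctx F β} {M : β → ℕ} (h : Γ.Poly M) {d : ℕ} {N : β → ℕ}
    {U V : β → ℕ → ℤ} : (Γ.loop d N U V).Poly fun x => M x.1 :=
  PolyLe.comp h (fun x : Σ b, Fin (N b) => x.1)

theorem Bit.lift {Γ : Ctx F β} {f : β → ℤ} (h : Γ.Bit f) {d : ℕ} {N : β → ℕ}
    {U V : β → ℕ → ℤ} : (Γ.loop d N U V).Bit fun x => f x.1 :=
  PolyLe.comp h (fun x : Σ b, Fin (N b) => x.1)

end Ctx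

/-! ### Running programs -/

namespace Ram

/-- The program halts within `T` steps. -/
def ExecLe (inp : List ℤ) (ω : ℕ → Bool) (p : Ram) (σ : RamState) (T : ℕ) (τ : RamState) : Prop :=
  ∃ t ≤ T, Run inp ω p σ t τ

variable {inp : List ℤ} {ω : ℕ → Bool} {p q : Ram} {σ τ υ : RamState} {T T' : ℕ}

theorem Run.execLe {t : ℕ} (h : Run inp ω p σ t τ) : ExecLe inp ω p σ t τ := ⟨t, le_rfl, h⟩

theorem ExecLe.mono (h : ExecLe inp ω p σ T τ) (hT : T ≤ T') : ExecLe inp ω p σ T' τ :=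
  let ⟨t, ht, hr⟩ := h
  ⟨t, ht.trans hT, hr⟩

theorem ExecLe.seq (h : ExecLe inp ω p σ T τ) (h' : ExecLe inp ω q τ T' υ) :
    ExecLe inp ω (.seq p q) σ (T + T') υ :=
  let ⟨t, ht, hr⟩ := h
  let ⟨u, hu, hs⟩ := h'
  ⟨t + u, Nat.add_le_add ht hu, hr.seq hs⟩

/-- Copy the content of cell `a` to another cell `d`. -/
def copy (d a : ℕ) : Ram := .seq (.const d 0) (.add d d a)

theorem execLe_copy {d a : ℕ} (h : a ≠ d) : ExecLe inp ω (copy d a) σ 2 (σ.assign d (σ.mem a)) := by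
  have := (Run.const (inp := inp) (ω := ω) d 0 σ).seq (Run.add d d a _)
  have e : (σ.assign d 0).assign d ((σ.assign d 0).mem d + (σ.assign d 0).mem a) =
      σ.assign d (σ.mem a) := by
    simp [RamState.assign, h]
  rw [e] at this
  exact this.execLe

/-- A loop whose invariant `J i` holds before round `i` is left after `N` rounds. -/
theorem execLe_while {a N : ℕ} (J : ℕ → RamState → Prop)
    (hpos : ∀ i < N, ∀ σ, J i σ → 0 < σ.mem a) (hend : ∀ σ, J N σ → σ.mem a ≤ 0)
    (hstep : ∀ i < N, ∀ σ, J i σ → ∃ τ, ExecLe inp ω p σ T τ ∧ J (i + 1) τ)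
    (hσ : J 0 σ) : ∃ τ, ExecLe inp ω (.whilePos a p) σ (N * (T + 1) + 1) τ ∧ J N τ := by
  suffices H : ∀ k i σ, i + k = N → J i σ →
      ∃ τ, ExecLe inp ω (.whilePos a p) σ (k * (T + 1) + 1) τ ∧ J N τ from
    H N 0 σ (by omega) hσ
  intro k
  induction k with
  | zero =>
    intro i σ hi hJ
    obtain rfl : i = N := by omega
    exact ⟨σ, ⟨1, by omega, .whileFalse (hend σ hJ)⟩, hJ⟩
  | succ k ih =>
    intro i σ hi hJ
    obtain ⟨τ, ⟨t, ht, hr⟩, hτ⟩ := hstep i (by omega) σ hJ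
    obtain ⟨υ, ⟨u, hu, hs⟩, hυ⟩ := ih (i + 1) τ (by omega) hτ
    refine ⟨υ, ⟨1 + t + u, ?_, .whileTrue (hpos i (by omega) σ hJ) hr hs⟩, hυ⟩
    rw [add_mul]
    omega

end Ram

@[simp] theorem RamState.assign_mem (σ : RamState) (d i : ℕ) (v : ℤ) :
    (σ.assign d v).mem i = if i = d then v else σ.mem i := by
  simp [RamState.assign, Function.update_apply]

@[simp] theorem RamState.assign_coins (σ : RamState) (d : ℕ) (v : ℤ) :
    (σ.assign d v).coins = σ.coins := rfl

@[simp] theorem RamState.assign_out (σ : RamState) (d : ℕ) (v : ℤ) :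
    (σ.assign d v).out = σ.out := rfl

/-! ### Functions computed in polynomial time -/

/-- The final configuration differs from `σ` only in cells from `D` on. -/
structure RamState.Frame (D : ℕ) (σ τ : RamState) : Prop where
  mem : ∀ i < D, τ.mem i = σ.mem i
  coins : τ.coins = σ.coins

namespace RamState.Frame

variable {D E : ℕ} {σ τ υ : RamState}

theorem refl (D : ℕ) (σ : RamState) : σ.Frame D σ := ⟨fun _ _ => rfl, rfl⟩

theorem trans (h : σ.Frame D τ) (h' : τ.Frame D υ) : σ.Frame D υ :=
  ⟨fun i hi => (h'.mem i hi).trans (h.mem i hi), h'.coins.trans h.coins⟩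

theorem mono (h : σ.Frame E τ) (hD : D ≤ E) : σ.Frame D τ :=
  ⟨fun i hi => h.mem i (hi.trans_le hD), h.coins⟩

theorem assign {d : ℕ} (h : σ.Frame D τ) (hd : D ≤ d) (v : ℤ) : σ.Frame D (τ.assign d v) :=
  ⟨fun i hi => by simp [h.mem i hi, (show i ≠ d by omega)], h.coins⟩

end RamState.Frame

section Programs

variable {F : Fam} {β : Type}

/-- The integer valued function `f` of the context is computed in polynomial time. The program may
put the result into any given cell that is not in use. -/
def CZ (Γ : Ctx F β) (f : β → ℤ) : Prop :=
  Γ.Bit f ∧ ∀ d, ∃ p : Ram, ∃ t : β → ℕ, Γ.Poly t ∧ ∀ b ω σ, Γ.Holds b σ.mem →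
    ∃ τ, Ram.ExecLe (F.inp (Γ.inst b)) ω p σ (t b) τ ∧ τ.mem (Γ.dep + d) = f b ∧
      σ.Frame (Γ.dep + d) τ ∧ τ.out = σ.out

/-- The list valued function `l` of the context is written in polynomial time. -/
def EM (Γ : Ctx F β) (l : β → List ℤ) : Prop :=
  ∀ d, ∃ p : Ram, ∃ t : β → ℕ, Γ.Poly t ∧ ∀ b ω σ, Γ.Holds b σ.mem →
    ∃ τ, Ram.ExecLe (F.inp (Γ.inst b)) ω p σ (t b) τ ∧
      σ.Frame (Γ.dep + d) τ ∧ τ.out = σ.out ++ l b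

/-- A natural valued function that is computed in polynomial time and has polynomial values. -/
def CN (Γ : Ctx F β) (f : β → ℕ) : Prop := CZ Γ (fun b => (f b : ℤ)) ∧ Γ.Poly f

/-- A property of the context that is decided in polynomial time. -/
def CB (Γ : Ctx F β) (P : β → Prop) : Prop := ∃ c : β → ℤ, CZ Γ c ∧ ∀ b, 0 < c b ↔ P b

namespace CZ

variable {Γ : Ctx F β} {f g : β → ℤ}

theorem congr (hf : CZ Γ f) (h : ∀ b, g b = f b) : CZ Γ g := (funext h : g = f) ▸ hf

theorem const (v : ℤ) : CZ Γ fun _ => v :=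
  ⟨PolyLe.const Γ.two_le_X v.natAbs.size, fun d => ⟨.const (Γ.dep + d) v, fun _ => 1,
    Ctx.Poly.const _ _, fun b ω σ _ => ⟨_, (Ram.Run.const _ _ _).execLe, by simp,
      (RamState.Frame.refl _ _).assign le_rfl _, rfl⟩⟩⟩

/-- A cell whose content is known. -/
theorem var {a : ℕ} (ha : a < Γ.dep) (hst : Γ.st a = some f) (hf : Γ.Bit f) : CZ Γ f :=
  ⟨hf, fun d => ⟨Ram.copy (Γ.dep + d) a, fun _ => 2, Ctx.Poly.const _ _, fun b ω σ h =>
    ⟨_, Ram.execLe_copy (by omega), by simp [h a ha f hst],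
      (RamState.Frame.refl _ _).assign le_rfl _, rfl⟩⟩⟩

theorem base : CZ Γ fun b => F.base (Γ.inst b) :=
  var Γ.dep_pos Γ.st_zero (PolyLe.comp F.bit_base Γ.inst)

/-- Computing two functions and combining them by a program for one operation. -/
theorem op₂ {h : β → ℤ} (hf : CZ Γ f) (hg : CZ Γ g) (hh : Γ.Bit h) (p : ℕ → ℕ → ℕ → Ram)
    (hp : ∀ b ω σ D, σ.mem D = f b → σ.mem (D + 1) = g b → ∃ τ, Ram.ExecLe (F.inp (Γ.inst b)) ω
      (p D D (D + 1)) σ 1 τ ∧ τ.mem D = h b ∧ σ.Frame D τ ∧ τ.out = σ.out) : CZ Γ h := by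
  refine ⟨hh, fun d => ?_⟩
  obtain ⟨p1, t1, ht1, h1⟩ := hf.2 d
  -- The second operand is computed one cell higher, so that the first result survives.
  obtain ⟨p2, t2, ht2, h2⟩ := hg.2 (d + 1)
  refine ⟨.seq p1 (.seq p2 (p (Γ.dep + d) (Γ.dep + d) (Γ.dep + d + 1))), fun b => t1 b + (t2 b + 1),
    ht1.add (ht2.add (Ctx.Poly.const _ _)), fun b ω σ hσ => ?_⟩
  obtain ⟨τ, r1, e1, fr1, o1⟩ := h1 b ω σ hσ
  obtain ⟨υ, r2, e2, fr2, o2⟩ := h2 b ω τ (hσ.congr d fr1.mem)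
  obtain ⟨φ, r3, e3, fr3, o3⟩ := hp b ω υ (Γ.dep + d) ((fr2.mem _ (by omega)).trans e1) e2
  exact ⟨φ, r1.seq (r2.seq r3), e3, (fr1.trans (fr2.mono (by omega))).trans fr3,
    o3.trans (o2.trans o1)⟩

theorem bit_add (hf : Γ.Bit f) (hg : Γ.Bit g) : Γ.Bit fun b => f b + g b := by
  refine Ctx.Bit.of_le (Ctx.Poly.add hf hg) fun b => ?_
  have h1 := BitLe.abs_lt f b
  have h2 := BitLe.abs_lt g b
  rw [pow_add]
  have := abs_add_le (f b) (g b)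
  have h3 : (1 : ℤ) ≤ 2 ^ (f b).natAbs.size := one_le_pow₀ (by norm_num)
  have h4 : (1 : ℤ) ≤ 2 ^ (g b).natAbs.size := one_le_pow₀ (by norm_num)
  nlinarith

theorem bit_neg (hf : Γ.Bit f) : Γ.Bit fun b => -f b :=
  BitLe.mono hf fun b => (abs_neg (f b)).le

theorem add (hf : CZ Γ f) (hg : CZ Γ g) : CZ Γ fun b => f b + g b :=
  hf.op₂ hg (bit_add hf.1 hg.1) Ram.add fun b ω σ D h1 h2 =>
    ⟨_, (Ram.Run.add _ _ _ _).execLe, by simp [h1, h2],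
      (RamState.Frame.refl _ _).assign le_rfl _, rfl⟩

theorem sub (hf : CZ Γ f) (hg : CZ Γ g) : CZ Γ fun b => f b - g b :=
  hf.op₂ hg (by simpa only [sub_eq_add_neg] using bit_add hf.1 (bit_neg hg.1)) Ram.sub
    fun b ω σ D h1 h2 => ⟨_, (Ram.Run.sub _ _ _ _).execLe, by simp [h1, h2],
      (RamState.Frame.refl _ _).assign le_rfl _, rfl⟩

theorem half (hf : CZ Γ f) : CZ Γ fun b => f b / 2 :=
  hf.op₂ (const 0) (BitLe.mono hf.1 fun b => Int.abs_ediv_le_abs _ _) (fun d a _ => Ram.half d a)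
    fun b ω σ D h1 h2 => ⟨_, (Ram.Run.half _ _ _).execLe, by simp [h1],
      (RamState.Frame.refl _ _).assign le_rfl _, rfl⟩

theorem read (hf : CZ Γ f) : CZ Γ fun b => (F.inp (Γ.inst b)).getD (f b).toNat 0 :=
  hf.op₂ (const 0) (let ⟨C, hC⟩ := F.bit_inp; ⟨C, fun b => hC _ _⟩) (fun d a _ => Ram.read d a)
    fun b ω σ D h1 h2 => ⟨_, (Ram.Run.read _ _ _).execLe, by simp [h1],
      (RamState.Frame.refl _ _).assign le_rfl _, rfl⟩

theorem neg (hf : CZ Γ f) : CZ Γ fun b => -f b :=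
  ((const 0).sub hf).congr fun b => by ring

/-- A case distinction. -/
theorem ifPos {c : β → ℤ} (hc : CZ Γ c) (hf : CZ Γ f) (hg : CZ Γ g) :
    CZ Γ fun b => if 0 < c b then f b else g b := by
  refine ⟨(Ctx.Poly.add hf.1 hg.1).mono fun b => by dsimp only; split_ifs <;> omega, fun d => ?_⟩
  obtain ⟨p0, t0, ht0, h0⟩ := hc.2 d
  obtain ⟨p1, t1, ht1, h1⟩ := hf.2 d
  obtain ⟨p2, t2, ht2, h2⟩ := hg.2 d
  refine ⟨.seq p0 (.ifPos (Γ.dep + d) p1 p2), fun b => t0 b + (1 + (t1 b + t2 b)),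
    ht0.add ((Ctx.Poly.const _ _).add (ht1.add ht2)), fun b ω σ hσ => ?_⟩
  obtain ⟨τ, r, e, fr, o⟩ := h0 b ω σ hσ
  have hτ := hσ.congr d fr.mem
  by_cases hb : 0 < c b
  · obtain ⟨υ, ⟨u, hu, r1⟩, e1, fr1, o1⟩ := h1 b ω τ hτ
    exact ⟨υ, r.seq ⟨1 + u, by omega, .ifTrue (by omega) r1⟩, by simp [hb, e1], fr.trans fr1,
      o1.trans o⟩
  · obtain ⟨υ, ⟨u, hu, r1⟩, e1, fr1, o1⟩ := h2 b ω τ hτ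
    exact ⟨υ, r.seq ⟨1 + u, by omega, .ifFalse (by omega) r1⟩, by simp [hb, e1], fr.trans fr1,
      o1.trans o⟩

theorem ite {P : β → Prop} [∀ b, Decidable (P b)] (hP : CB Γ P) (hf : CZ Γ f) (hg : CZ Γ g) :
    CZ Γ fun b => if P b then f b else g b := by
  obtain ⟨c, hc, h⟩ := hP
  exact (hc.ifPos hf hg).congr fun b => by simp [h]

variable {N : β → ℕ} {U V : β → ℕ → ℤ} {d : ℕ}

/-- The program for the outer context is run again in each round, using only cells beyond the two
loop variables. -/
theorem lift (hf : CZ Γ f) : CZ (Γ.loop d N U V) fun x => f x.1 := by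
  refine ⟨hf.1.lift, fun d' => ?_⟩
  obtain ⟨p, t, ht, h⟩ := hf.2 (d + 2 + d')
  refine ⟨p, fun x => t x.1, ht.lift, fun x ω σ hσ => ?_⟩
  obtain ⟨τ, h⟩ := h x.1 ω σ (Ctx.holds_loop.1 hσ).1
  exact ⟨τ, by simpa only [Ctx.loop, add_assoc] using h⟩

theorem loopFst (h : (Γ.loop d N U V).Bit fun x => U x.1 x.2) :
    CZ (Γ.loop d N U V) fun x => U x.1 x.2 :=
  var (a := Γ.dep + d) (by simp only [Ctx.loop]; omega) (by simp [Ctx.loop]) h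

theorem loopSnd (h : (Γ.loop d N U V).Bit fun x => V x.1 x.2) :
    CZ (Γ.loop d N U V) fun x => V x.1 x.2 :=
  var (a := Γ.dep + d + 1) (by simp only [Ctx.loop]; omega)
    (by simp only [Ctx.loop]; rw [if_neg (by omega), if_neg (by omega), if_pos trivial]) h

/-- A loop with two variables, which is left when the first is no longer positive. -/
theorem whilePos (hN : Γ.Poly N) (hU0 : CZ Γ fun b => U b 0) (hV0 : CZ Γ fun b => V b 0)
    (hU : ∀ d, CZ (Γ.loop d N U V) fun x => U x.1 (x.2 + 1))
    (hV : ∀ d, CZ (Γ.loop d N U V) fun x => V x.1 (x.2 + 1))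
    (hpos : ∀ b, ∀ i < N b, 0 < U b i) (hend : ∀ b, U b (N b) ≤ 0) :
    CZ Γ fun b => V b (N b) := by
  constructor
  -- The final value is either the initial one or the result of a last round, and the results of all
  -- rounds share one bound.
  · obtain ⟨C, hC⟩ := (hV 0).1
    obtain ⟨D, hD⟩ := hV0.1
    refine ⟨fun k => C k + D k, fun b => ?_⟩
    have h1 : 1 ≤ F.X (Γ.inst b) := (Γ.two_le_X b).trans' (by norm_num)
    dsimp only
    rcases h : N b with _ | i
    · exact (hD b).trans (Nat.pow_le_pow_right h1 (Nat.le_add_left _ _))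
    · exact (hC ⟨b, ⟨i, by omega⟩⟩).trans (Nat.pow_le_pow_right h1 (Nat.le_add_right _ _))
  intro d
  obtain ⟨pU0, tU0, htU0, hU0⟩ := hU0.2 d
  obtain ⟨pV0, tV0, htV0, hV0⟩ := hV0.2 (d + 1)
  -- Both new values are computed from the old ones, into cells `D + 2` and `D + 3`, before either
  -- variable is overwritten. The exponents `CV` and `CU` are the same for all rounds, so `T` bounds
  -- every round.
  obtain ⟨pV, tV, ⟨CV, htV⟩, hV⟩ := (hV d).2 0
  obtain ⟨pU, tU, ⟨CU, htU⟩, hU⟩ := (hU d).2 1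
  set T : β → ℕ := fun b => F.X (Γ.inst b) ^ CV (F.par (Γ.inst b)) +
    (F.X (Γ.inst b) ^ CU (F.par (Γ.inst b)) + (2 + 2)) with hT
  have hTp : Γ.Poly T := Ctx.Poly.add ⟨CV, fun _ => le_rfl⟩
    (Ctx.Poly.add ⟨CU, fun _ => le_rfl⟩ (Ctx.Poly.const _ _))
  set D := Γ.dep + d with hD
  refine ⟨.seq pU0 (.seq pV0 (.seq (.whilePos D (.seq pV (.seq pU (.seq (Ram.copy (D + 1) (D + 2))
    (Ram.copy D (D + 3)))))) (Ram.copy D (D + 1)))),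
    fun b => tU0 b + (tV0 b + ((N b * (T b + 1) + 1) + 2)),
    htU0.add (htV0.add (((hN.mul (hTp.add (Ctx.Poly.const _ _))).add (Ctx.Poly.const _ _)).add
      (Ctx.Poly.const _ _))), fun b ω σ hσ => ?_⟩
  obtain ⟨τ, r1, e1, fr1, o1⟩ := hU0 b ω σ hσ
  obtain ⟨υ, r2, e2, fr2, o2⟩ := hV0 b ω τ (hσ.congr d fr1.mem)
  have key := Ram.execLe_while (inp := F.inp (Γ.inst b)) (ω := ω) (a := D) (N := N b)
    (p := .seq pV (.seq pU (.seq (Ram.copy (D + 1) (D + 2)) (Ram.copy D (D + 3)))))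
    (T := T b) (σ := υ)
    (fun i φ => φ.mem D = U b i ∧ φ.mem (D + 1) = V b i ∧ σ.Frame D φ ∧ φ.out = σ.out)
    (fun i hi φ h => by rw [h.1]; exact hpos b i hi) (fun φ h => by rw [h.1]; exact hend b)
    (fun i hi φ h => by
      obtain ⟨hφU, hφV, hφ, ho⟩ := h
      have hx : (Γ.loop d N U V).Holds ⟨b, ⟨i, hi⟩⟩ φ.mem :=
        Ctx.holds_loop.2 ⟨hσ.congr d hφ.mem, hφU, hφV⟩
      obtain ⟨φ1, s1, a1, g1, q1⟩ := hV ⟨b, ⟨i, hi⟩⟩ ω φ hx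
      obtain ⟨φ2, s2, a2, g2, q2⟩ := hU ⟨b, ⟨i, hi⟩⟩ ω φ1 (hx.congr 0 g1.mem)
      change φ1.mem (D + 2) = _ at a1
      change φ2.mem (D + 3) = _ at a2
      replace g1 : φ.Frame (D + 2) φ1 := g1
      replace g2 : φ1.Frame (D + 3) φ2 := g2
      refine ⟨_, (s1.seq (s2.seq ((Ram.execLe_copy (a := D + 2) (d := D + 1) (by omega)).seq
        (Ram.execLe_copy (a := D + 3) (d := D) (by omega))))).mono ?_, ?_, ?_, ?_, ?_⟩
      · have := htV ⟨b, ⟨i, hi⟩⟩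
        have := htU ⟨b, ⟨i, hi⟩⟩
        simp only [Ctx.loop] at *
        simp only [hT]
        omega
      · simp [a2]
      · simp [g2.mem (D + 2) (by omega), a1]
      · exact ((hφ.trans (g1.mono (by omega))).trans (g2.mono (by omega))).assign
          (by omega) _ |>.assign (by omega) _
      · simp [q2, q1, ho])
    ⟨(fr2.mem _ (by omega)).trans e1, e2, fr1.trans (fr2.mono (by omega)), o2.trans o1⟩
  obtain ⟨φ, r3, e3, e4, fr3, o3⟩ := key
  exact ⟨_, r1.seq (r2.seq (r3.seq (Ram.execLe_copy (by omega)))), by simp [e4],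
    fr3.assign le_rfl _, o3⟩

end CZ

/-! ### Counted loops -/

/-- The context inside a loop that counts `i = 0, …, N - 1` and has one variable. -/
abbrev Ctx.iter (Γ : Ctx F β) (d : ℕ) (N : β → ℕ) (V : β → ℕ → ℤ) : Ctx F (Σ b, Fin (N b)) :=
  Γ.loop d N (fun b i => (N b : ℤ) - i) V

namespace CN

variable {Γ : Ctx F β} {f g N : β → ℕ} {V : β → ℕ → ℤ} {d : ℕ}

theorem toCZ (hf : CN Γ f) : CZ Γ fun b => (f b : ℤ) := hf.1

theorem congr (hf : CN Γ f) (h : ∀ b, g b = f b) : CN Γ g := (funext h : g = f) ▸ hf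

theorem const (v : ℕ) : CN Γ fun _ => v := ⟨CZ.const v, Ctx.Poly.const _ _⟩

theorem lift {U : β → ℕ → ℤ} (hf : CN Γ f) : CN (Γ.loop d N U V) fun x => f x.1 :=
  ⟨hf.1.lift, hf.2.lift⟩

theorem of_toNat {f : β → ℤ} (hf : CZ Γ f) (hp : Γ.Poly fun b => (f b).toNat) :
    CN Γ fun b => (f b).toNat := by
  refine ⟨((CZ.ifPos hf hf (CZ.const 0))).congr fun b => ?_, hp⟩
  dsimp only
  split_ifs <;> omega

theorem bit (hf : Γ.Poly f) : Γ.Bit fun b => (f b : ℤ) :=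
  Ctx.Bit.of_le hf fun b => by
    rw [Nat.abs_cast]
    exact_mod_cast Nat.lt_two_pow_self.le

/-- The loop counter. -/
theorem idx (hN : CN Γ N) : CN (Γ.iter d N V) fun x => (x.2 : ℕ) := by
  -- The loop variable holds `N - i`, because loops run while it is positive; subtracting it from
  -- `N` recovers `i`.
  refine ⟨(hN.toCZ.lift.sub (CZ.loopFst ?_)).congr fun x => by ring, hN.2.lift.mono fun x => x.2.2.le⟩
  exact (bit (f := fun x : Σ b, Fin (N b) => N x.1 - x.2)
    (hN.2.lift.mono fun x => Nat.sub_le _ _) : (Γ.iter d N V).Bit _).mono fun x => by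
      simp [Nat.cast_sub x.2.2.le]

theorem add (hf : CN Γ f) (hg : CN Γ g) : CN Γ fun b => f b + g b :=
  ⟨(hf.1.add hg.1).congr fun b => by push_cast; rfl, hf.2.add hg.2⟩

theorem tsub (hf : CN Γ f) (hg : CN Γ g) : CN Γ fun b => f b - g b :=
  (of_toNat (hf.1.sub hg.1) (hf.2.mono fun b => by omega)).congr fun b => by omega

end CN

namespace CZ

variable {Γ : Ctx F β} {f g : β → ℤ} {N : β → ℕ} {V : β → ℕ → ℤ}

/-- Iteration. -/
theorem iterate (hN : CN Γ N) (hV0 : CZ Γ fun b => V b 0)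
    (hV : ∀ d, CZ (Γ.iter d N V) fun x => V x.1 (x.2 + 1)) : CZ Γ fun b => V b (N b) :=
  whilePos (U := fun b i => (N b : ℤ) - i) hN.2 (hN.1.congr fun b => by simp) hV0
    (fun d => ((hN.toCZ.lift.sub (CN.idx hN).toCZ).sub (const 1)).congr fun x => by push_cast; ring)
    hV (fun b i hi => by simpa using hi) (fun b => by simp)

/-- The variable of a loop. -/
theorem acc {d : ℕ} (h : (Γ.iter d N V).Bit fun x => V x.1 x.2) :
    CZ (Γ.iter d N V) fun x => V x.1 x.2 := loopSnd h

theorem sum {g : β → ℕ → ℤ} (hN : CN Γ N)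
    (hg : ∀ d V, CZ (Γ.iter d N V) fun x => g x.1 x.2) :
    CZ Γ fun b => ∑ i ∈ Finset.range (N b), g b i := by
  refine iterate (V := fun b j => ∑ i ∈ Finset.range j, g b i) hN (const 0) fun d => ?_
  simp only [Finset.sum_range_succ]
  refine (acc ?_).add (hg d _)
  -- The bit bound on the summands is uniform over the rounds. A partial sum of at most `N ≤ 2 ^ N`
  -- of them lengthens the numbers by at most `N` bits.
  obtain ⟨C, hC⟩ := (hg 0 fun _ _ => 0).1
  have hp : Γ.Poly fun b => N b + F.X (Γ.inst b) ^ C (F.par (Γ.inst b)) :=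
    hN.2.add ⟨C, fun _ => le_rfl⟩
  refine Ctx.Bit.of_le hp.lift fun x => ?_
  have h1 : ∀ i ∈ Finset.range (x.2 : ℕ), |g x.1 i| ≤
      2 ^ (F.X (Γ.inst x.1) ^ C (F.par (Γ.inst x.1))) := fun i hi => by
    have hi : i < N x.1 := (Finset.mem_range.1 hi).trans x.2.2
    refine (BitLe.abs_lt (fun y : Σ b, Fin (N b) => g y.1 y.2) ⟨x.1, ⟨i, hi⟩⟩).le.trans ?_
    exact pow_le_pow_right₀ (by norm_num) (hC ⟨x.1, ⟨i, hi⟩⟩)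
  refine (Finset.abs_sum_le_sum_abs _ _).trans ((Finset.sum_le_card_nsmul _ _ _ h1).trans ?_)
  rw [pow_add, Finset.card_range, nsmul_eq_mul]
  gcongr
  exact_mod_cast x.2.2.le.trans Nat.lt_two_pow_self.le

end CZ

/-! ### Arithmetic in polynomial time -/

namespace CB

variable {Γ : Ctx F β} {P Q : β → Prop} {f g : β → ℤ}

theorem lt (hf : CZ Γ f) (hg : CZ Γ g) : CB Γ fun b => f b < g b :=
  ⟨_, hg.sub hf, fun b => by omega⟩

theorem le (hf : CZ Γ f) (hg : CZ Γ g) : CB Γ fun b => f b ≤ g b :=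
  ⟨_, (hg.sub hf).add (CZ.const 1), fun b => by omega⟩

theorem and (hP : CB Γ P) (hQ : CB Γ Q) : CB Γ fun b => P b ∧ Q b := by
  obtain ⟨c, hc, h⟩ := hP
  obtain ⟨c', hc', h'⟩ := hQ
  refine ⟨_, hc.ifPos hc' (CZ.const 0), fun b => ?_⟩
  have h1 := h b
  have h2 := h' b
  split_ifs <;> grind

theorem congr (hP : CB Γ P) (h : ∀ b, Q b ↔ P b) : CB Γ Q :=
  let ⟨c, hc, h'⟩ := hP
  ⟨c, hc, fun b => (h' b).trans (h b).symm⟩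

theorem eq (hf : CZ Γ f) (hg : CZ Γ g) : CB Γ fun b => f b = g b :=
  ((le hf hg).and (le hg hf)).congr fun b => by omega

end CB

namespace CN

variable {Γ : Ctx F β} {f g N : β → ℕ}

theorem ite {P : β → Prop} [∀ b, Decidable (P b)] (hP : CB Γ P) (hf : CN Γ f) (hg : CN Γ g) :
    CN Γ fun b => if P b then f b else g b :=
  ⟨(CZ.ite hP hf.1 hg.1).congr fun b => by push_cast; rfl,
    (hf.2.add hg.2).mono fun b => by split_ifs <;> omega⟩

theorem lt (hf : CN Γ f) (hg : CN Γ g) : CB Γ fun b => f b < g b :=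
  (CB.lt hf.1 hg.1).congr fun b => by omega

theorem le (hf : CN Γ f) (hg : CN Γ g) : CB Γ fun b => f b ≤ g b :=
  (CB.le hf.1 hg.1).congr fun b => by omega

theorem eq (hf : CN Γ f) (hg : CN Γ g) : CB Γ fun b => f b = g b :=
  (CB.eq hf.1 hg.1).congr fun b => by omega

theorem sum {g : β → ℕ → ℕ} (hN : CN Γ N)
    (hg : ∀ d V, CN (Γ.iter d N V) fun x => g x.1 x.2) :
    CN Γ fun b => ∑ i ∈ Finset.range (N b), g b i := by
  refine ⟨(CZ.sum hN fun d V => (hg d V).1).congr fun b => by push_cast; rfl, ?_⟩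
  obtain ⟨C, hC⟩ := (hg 0 fun _ _ => 0).2
  refine (hN.2.mul (⟨C, fun _ => le_rfl⟩ :
    Γ.Poly fun b => F.X (Γ.inst b) ^ C (F.par (Γ.inst b)))).mono fun b => ?_
  refine (Finset.sum_le_card_nsmul _ (g b) (F.X (Γ.inst b) ^ C (F.par (Γ.inst b)))
    fun i hi => hC ⟨b, ⟨i, Finset.mem_range.1 hi⟩⟩).trans ?_
  rw [Finset.card_range, smul_eq_mul]

end CN

namespace CZ

variable {Γ : Ctx F β} {f g : β → ℤ}

theorem shr {i : β → ℕ} (hf : CZ Γ f) (hi : CN Γ i) : CZ Γ fun b => f b / 2 ^ i b := by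
  refine iterate (V := fun b j => f b / 2 ^ j) hi (hf.congr fun b => by simp) fun d => ?_
  refine (acc ?_).half.congr fun x => ?_
  · exact BitLe.mono hf.1.lift fun x => Int.abs_ediv_le_abs _ _
  · rw [pow_succ, Int.ediv_ediv_of_nonneg (by positivity)]

theorem abs (hf : CZ Γ f) : CZ Γ fun b => |f b| :=
  (hf.ifPos hf hf.neg).congr fun b => by
    split_ifs with h
    · exact abs_of_pos h
    · exact abs_of_nonpos (by omega)

/-- Halve `|f|` until it is zero and count the rounds. The halved number itself is the exit test,
which is why `whilePos` allows a first variable other than a counter. -/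
theorem size (hf : CZ Γ f) : CN Γ fun b => (f b).natAbs.size := by
  refine ⟨?_, hf.1⟩
  have hb : ∀ d, (Γ.loop d (fun b => (f b).natAbs.size) (fun b i => |f b| / 2 ^ i)
      fun _ i => i).Bit fun x => |f x.1| / 2 ^ (x.2 : ℕ) := fun d =>
    BitLe.mono hf.abs.1.lift fun x => Int.abs_ediv_le_abs _ _
  refine whilePos (N := fun b => (f b).natAbs.size) (U := fun b i => |f b| / 2 ^ i)
    (V := fun _ i => (i : ℤ)) hf.1 (hf.abs.congr fun b => by simp) (const 0) (fun d => ?_)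
    (fun d => ?_) (fun b i hi => ?_) fun b => ?_
  · refine (loopFst (hb d)).half.congr fun x => ?_
    rw [pow_succ, Int.ediv_ediv_of_nonneg (by positivity)]
  · refine ((loopSnd ?_).add (const 1)).congr fun x => by push_cast; rfl
    exact CN.bit (f := fun x : Σ b, Fin (f b).natAbs.size => (x.2 : ℕ))
      (Ctx.Poly.mono (Ctx.Poly.lift (Γ := Γ) hf.1) fun x => x.2.2.le)
  · have := Nat.lt_size.1 hi
    refine (Int.le_ediv_iff_mul_le (by positivity)).2 ?_
    rw [Int.abs_eq_natAbs, zero_add, one_mul]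
    exact_mod_cast this
  · rw [Int.ediv_eq_zero_of_lt (abs_nonneg _) (BitLe.abs_lt f b)]

theorem bit_mul (hf : Γ.Bit f) (hg : Γ.Bit g) : Γ.Bit fun b => f b * g b := by
  refine Ctx.Bit.of_le (Ctx.Poly.add hf hg) fun b => ?_
  rw [pow_add, abs_mul]
  exact mul_le_mul (BitLe.abs_lt f b).le (BitLe.abs_lt g b).le (abs_nonneg _) (by positivity)

/-- Shifting out all bits leaves only the sign; this is the starting value of the Horner schemes in
`mul` and `emod`. -/
theorem ediv_two_pow_size (v : ℤ) : v / 2 ^ v.natAbs.size = if v < 0 then -1 else 0 := by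
  have := abs_lt.1 (BitLe.abs_lt (fun _ : Unit => v) ())
  split_ifs with h
  · rw [Int.ediv_eq_iff_of_pos (by positivity)]
    constructor <;> linarith
  · exact Int.ediv_eq_zero_of_lt (by omega) this.2

/-- The shifts of an integer `v` whose length is `s`, in reverse order, differ by one bit. -/
theorem ediv_two_pow_sub_succ (v : ℤ) {i s : ℕ} (h : i < s) :
    2 * (v / 2 ^ (s - i)) + (v / 2 ^ (s - i - 1)) % 2 = v / 2 ^ (s - (i + 1)) := by
  have h1 : v / 2 ^ (s - i) = v / 2 ^ (s - i - 1) / 2 := by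
    rw [Int.ediv_ediv_of_nonneg (by positivity), ← pow_succ]
    congr 2
    omega
  rw [h1, Nat.sub_sub]
  omega

theorem lowBit (hf : CZ Γ f) : CZ Γ fun b => f b % 2 :=
  (hf.sub (hf.half.add hf.half)).congr fun b => by omega

/-- Horner's scheme over the bits of `g` from the top: double the partial product and add `f` if the
next bit is 1. Rounding towards minus infinity makes this correct for negative `g` as well. -/
theorem mul (hf : CZ Γ f) (hg : CZ Γ g) : CZ Γ fun b => f b * g b := by
  have key : CZ Γ fun b => f b * (g b / 2 ^ ((g b).natAbs.size - (g b).natAbs.size)) := by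
    refine iterate (N := fun b => (g b).natAbs.size)
      (V := fun b i => f b * (g b / 2 ^ ((g b).natAbs.size - i)))
      hg.size ((ite (CB.lt hg (const 0)) hf.neg (const 0)).congr fun b => ?_) fun d => ?_
    · rw [Nat.sub_zero, ediv_two_pow_size]
      split_ifs <;> simp
    · have ha := CZ.acc (Γ := Γ) (d := d) (N := fun b => (g b).natAbs.size)
        (V := fun b i => f b * (g b / 2 ^ ((g b).natAbs.size - i))) (by
          refine bit_mul hf.1.lift (BitLe.mono (g := fun x => g x.1) hg.1.lift fun x => ?_)
          exact Int.abs_ediv_le_abs _ _)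
      have hs := (hg.lift (d := d) (N := fun b => (g b).natAbs.size)
        (U := fun b i => ((g b).natAbs.size : ℤ) - i)
        (V := fun b i => f b * (g b / 2 ^ ((g b).natAbs.size - i)))).shr
          ((hg.size.lift.tsub (CN.idx hg.size)).tsub (CN.const 1))
      refine ((ha.add ha).add (hs.lowBit.ifPos hf.lift (const 0))).congr fun x => ?_
      rw [← ediv_two_pow_sub_succ (g x.1) x.2.2]
      have : (g x.1 / 2 ^ ((g x.1).natAbs.size - (x.2 : ℕ) - 1)) % 2 = 0 ∨
        (g x.1 / 2 ^ ((g x.1).natAbs.size - (x.2 : ℕ) - 1)) % 2 = 1 := by omega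
      rcases this with h | h <;> simp [h] <;> ring
  exact key.congr fun b => by simp

theorem pow {k : β → ℕ} (hf : CZ Γ f) (hk : CN Γ k) : CZ Γ fun b => f b ^ k b := by
  refine iterate (V := fun b i => f b ^ i) hk (by simpa using const 1) fun d => ?_
  refine ((acc ?_).mul hf.lift).congr fun x => pow_succ _ _
  refine Ctx.Bit.of_le (Ctx.Poly.lift (Ctx.Poly.mul hf.1 hk.2)) fun x => ?_
  rw [abs_pow]
  refine (pow_le_pow_left₀ (abs_nonneg _) (BitLe.abs_lt f x.1).le _).trans ?_
  rw [← pow_mul]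
  exact pow_le_pow_right₀ (by norm_num) (Nat.mul_le_mul_left _ x.2.2.le)

/-- The remainder modulo a small positive number. -/
theorem emod {q : β → ℕ} (hf : CZ Γ f) (hq : CN Γ q) (h0 : ∀ b, 0 < q b) :
    CN Γ fun b => (f b % q b).toNat := by
  have hpos : ∀ b, (0 : ℤ) < q b := fun b => by exact_mod_cast h0 b
  have key : CZ Γ fun b =>
      (f b / 2 ^ ((f b).natAbs.size - (f b).natAbs.size)) % q b := by
    refine iterate (N := fun b => (f b).natAbs.size)
      (V := fun b i => (f b / 2 ^ ((f b).natAbs.size - i)) % q b)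
      hf.size ((ite (CB.lt hf (const 0)) (hq.1.sub (const 1)) (const 0)).congr fun b => ?_)
      fun d => ?_
    · rw [Nat.sub_zero, ediv_two_pow_size]
      have := hpos b
      split_ifs
      · rw [← Int.add_emod_right, Int.emod_eq_of_lt] <;> omega
      · simp
    · have ha := CZ.acc (Γ := Γ) (d := d) (N := fun b => (f b).natAbs.size)
        (V := fun b i => (f b / 2 ^ ((f b).natAbs.size - i)) % q b) (by
          refine BitLe.mono (g := fun x => (q x.1 : ℤ)) (CN.bit hq.2).lift fun x => ?_
          rw [abs_of_nonneg (Int.emod_nonneg _ (hpos _).ne'), abs_of_pos (hpos _)]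
          exact (Int.emod_lt_of_pos _ (hpos _)).le)
      have hs := (hf.lift (d := d) (N := fun b => (f b).natAbs.size)
        (U := fun b i => ((f b).natAbs.size : ℤ) - i)
        (V := fun b i => (f b / 2 ^ ((f b).natAbs.size - i)) % q b)).shr
          ((hf.size.lift.tsub (CN.idx hf.size)).tsub (CN.const 1))
      have hy := (ha.add ha).add hs.lowBit
      -- Twice a remainder plus a bit is below `2 * q`, so one conditional subtraction reduces it.
      refine (ite (CB.le hq.1.lift hy) (hy.sub hq.1.lift) hy).congr fun x => ?_
      have hq0 := hpos x.1
      rw [← ediv_two_pow_sub_succ (f x.1) x.2.2]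
      set y := f x.1 / 2 ^ ((f x.1).natAbs.size - (x.2 : ℕ))
      set z := (f x.1 / 2 ^ ((f x.1).natAbs.size - (x.2 : ℕ) - 1)) % 2 with hz
      have hz0 : 0 ≤ z ∧ z < 2 := by omega
      have hy0 := Int.emod_nonneg y hq0.ne'
      have hy1 := Int.emod_lt_of_pos y hq0
      have e : (2 * y + z) % q x.1 = (y % q x.1 + y % q x.1 + z) % q x.1 := by
        rw [two_mul, Int.add_emod, Int.add_emod y y, ← Int.add_emod]
      rw [e]
      split_ifs with h
      · rw [← Int.sub_emod_right, Int.emod_eq_of_lt] <;> omega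
      · rw [Int.emod_eq_of_lt] <;> omega
  have hk := key.congr (g := fun b => f b % q b) fun b => by simp
  refine CN.of_toNat hk (hq.2.mono fun b => ?_)
  have := Int.emod_lt_of_pos (f b) (hpos b)
  omega

end CZ

namespace CN

variable {Γ : Ctx F β} {f g N : β → ℕ}

theorem mul (hf : CN Γ f) (hg : CN Γ g) : CN Γ fun b => f b * g b :=
  ⟨(hf.1.mul hg.1).congr fun b => by push_cast; rfl, hf.2.mul hg.2⟩

/-- A power with varying exponent need not have polynomial values, hence the separate bound `h`. -/
theorem pow (hf : CN Γ f) (hg : CN Γ g) (h : Γ.Poly fun b => f b ^ g b) :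
    CN Γ fun b => f b ^ g b :=
  ⟨(hf.1.pow hg).congr fun b => by push_cast; rfl, h⟩

theorem sq (hf : CN Γ f) : CN Γ fun b => f b ^ 2 := (hf.mul hf).congr fun _ => _root_.sq _

theorem size (hf : CN Γ f) : CN Γ fun b => (f b).size := hf.1.size

/-- The quotient counts the `d` with `(d + 1) * g ≤ f`. A loop of length `f` is affordable because
values in `CN` are polynomial. -/
theorem div (hf : CN Γ f) (hg : CN Γ g) : CN Γ fun b => f b / g b := by
  refine (CN.sum (g := fun b d => if 0 < g b ∧ (d + 1) * g b ≤ f b then 1 else 0) hf fun d V =>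
    ite (((CN.const 0).lt hg.lift).and ((((idx hf).add (const 1)).mul hg.lift).le hf.lift))
      (const 1) (const 0)).congr fun b => ?_
  rw [← Finset.sum_filter, Finset.sum_const, smul_eq_mul, mul_one]
  rcases Nat.eq_zero_or_pos (g b) with h | h
  · simp [h]
  · rw [show Finset.filter (fun d => 0 < g b ∧ (d + 1) * g b ≤ f b) (Finset.range (f b)) =
      Finset.range (f b / g b) from ?_, Finset.card_range]
    ext d
    simp only [Finset.mem_filter, Finset.mem_range, h, true_and]
    rw [← Nat.le_div_iff_mul_le h]
    have := Nat.div_le_self (f b) (g b)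
    omega

theorem mod (hf : CN Γ f) (hg : CN Γ g) : CN Γ fun b => f b % g b :=
  (hf.tsub (hg.mul (hf.div hg))).congr fun b => by
    have := Nat.mod_add_div (f b) (g b)
    omega

end CN

/-! ### Writing lists -/

namespace EM

variable {Γ : Ctx F β} {l l' : β → List ℤ}

theorem append (hl : EM Γ l) (hl' : EM Γ l') : EM Γ fun b => l b ++ l' b := fun d => by
  obtain ⟨p1, t1, ht1, h1⟩ := hl d
  obtain ⟨p2, t2, ht2, h2⟩ := hl' d
  refine ⟨.seq p1 p2, fun b => t1 b + t2 b, ht1.add ht2, fun b ω σ hσ => ?_⟩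
  obtain ⟨τ, r1, fr1, o1⟩ := h1 b ω σ hσ
  obtain ⟨υ, r2, fr2, o2⟩ := h2 b ω τ (hσ.congr d fr1.mem)
  exact ⟨υ, r1.seq r2, fr1.trans fr2, by rw [o2, o1, List.append_assoc]⟩

theorem single {f : β → ℤ} (hf : CZ Γ f) : EM Γ fun b => [f b] := fun d => by
  obtain ⟨p, t, ht, h⟩ := hf.2 d
  refine ⟨.seq p (.emit (Γ.dep + d)), fun b => t b + 1, ht.add (Ctx.Poly.const _ _),
    fun b ω σ hσ => ?_⟩
  obtain ⟨τ, r, e, fr, o⟩ := h b ω σ hσ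
  exact ⟨_, r.seq (Ram.Run.emit _ _).execLe, ⟨fr.mem, fr.coins⟩, by simp [e, o]⟩

theorem cons {f : β → ℤ} (hf : CZ Γ f) (hl : EM Γ l) : EM Γ fun b => f b :: l b :=
  (single hf).append hl

/-- A loop that writes a list in each round. -/
theorem flatMap {N : β → ℕ} {l : β → ℕ → List ℤ} (hN : CN Γ N)
    (hl : ∀ d V, EM (Γ.iter d N V) fun x => l x.1 x.2) :
    EM Γ fun b => (List.range (N b)).flatMap (l b) := fun d => by
  obtain ⟨p0, t0, ht0, h0⟩ := hN.1.2 d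
  -- A writing loop needs no accumulator; its second variable is a constant zero.
  obtain ⟨p, t, ⟨C, ht⟩, h⟩ := hl d (fun _ _ => 0) 0
  set D := Γ.dep + d with hD
  set T : β → ℕ := fun b => F.X (Γ.inst b) ^ C (F.par (Γ.inst b)) + (1 + 1) with hT
  have hTp : Γ.Poly T := Ctx.Poly.add ⟨C, fun _ => le_rfl⟩ (Ctx.Poly.const _ _)
  refine ⟨.seq p0 (.seq (.const (D + 1) 0) (.whilePos D (.seq p (.seq (.const (D + 2) 1)
    (.sub D D (D + 2)))))), fun b => t0 b + (1 + (N b * (T b + 1) + 1)),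
    ht0.add ((Ctx.Poly.const _ _).add ((hN.2.mul (hTp.add (Ctx.Poly.const _ _))).add
      (Ctx.Poly.const _ _))), fun b ω σ hσ => ?_⟩
  obtain ⟨τ, r1, e1, fr1, o1⟩ := h0 b ω σ hσ
  have key := Ram.execLe_while (inp := F.inp (Γ.inst b)) (ω := ω) (a := D) (N := N b)
    (p := .seq p (.seq (.const (D + 2) 1) (.sub D D (D + 2))))
    (T := T b) (σ := τ.assign (D + 1) 0)
    (fun i φ => φ.mem D = N b - i ∧ φ.mem (D + 1) = 0 ∧ σ.Frame D φ ∧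
      φ.out = σ.out ++ (List.range i).flatMap (l b))
    (fun i hi φ h => by rw [h.1]; omega) (fun φ h => by rw [h.1]; omega)
    (fun i hi φ hφ => by
      obtain ⟨hφU, hφV, hφ, ho⟩ := hφ
      obtain ⟨φ1, s1, g1, q1⟩ := h ⟨b, ⟨i, hi⟩⟩ ω φ
        (Ctx.holds_loop.2 ⟨hσ.congr d hφ.mem, hφU, hφV⟩)
      replace g1 : φ.Frame (D + 2) φ1 := g1
      refine ⟨_, (s1.seq ((Ram.Run.const _ _ _).execLe.seq (Ram.Run.sub _ _ _ _).execLe)).mono ?_,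
        ?_, ?_, ?_, ?_⟩
      · have := ht ⟨b, ⟨i, hi⟩⟩
        simp only [Ctx.loop] at *
        simp only [hT]
        omega
      · simp [g1.mem D (by omega), hφU]
        ring
      · simp [g1.mem (D + 1) (by omega), hφV]
      · exact ((hφ.trans (g1.mono (by omega))).assign (by omega) _).assign le_rfl _
      · simp [q1, ho, List.range_succ])
    ⟨by simp [e1], by simp, fr1.assign (by omega) _, by simp [o1]⟩
  obtain ⟨φ, r3, e3, e4, fr3, o3⟩ := key
  exact ⟨φ, r1.seq ((Ram.Run.const _ _ _).execLe.seq r3), fr3, o3⟩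

end EM

end Programs

/-! ### Sums over ranges -/

open Finset in
theorem sum_range_mul {M : Type*} [AddCommMonoid M] (f : ℕ → ℕ → M) (A B : ℕ) :
    ∑ u ∈ range (A * B), f (u / B) (u % B) = ∑ a ∈ range A, ∑ b ∈ range B, f a b := by
  induction A with
  | zero => simp
  | succ A ih =>
    rw [add_mul, one_mul, sum_range_add, ih, sum_range_succ]
    congr 1
    refine sum_congr rfl fun b hb => ?_
    have hb := mem_range.1 hb
    rw [mul_comm, Nat.mul_add_div (by omega), Nat.div_eq_of_lt hb, Nat.mul_add_mod,
      Nat.mod_eq_of_lt hb, add_zero]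

open Finset in
/-- A sum over all numbers with `k` digits in base `w` of a product over the digits. -/
theorem sum_prod_digits {R : Type*} [CommSemiring R] (w k : ℕ) (h : ℕ → ℕ → R) :
    ∑ γ ∈ range (w ^ k), ∏ l ∈ range k, h l (γ / w ^ l % w) =
      ∏ l ∈ range k, ∑ c ∈ range w, h l c := by
  induction k generalizing h with
  | zero => simp
  | succ k ih =>
    rw [prod_range_succ', ← ih fun l => h (l + 1), sum_mul_sum, pow_succ, ← sum_range_mul]
    refine sum_congr rfl fun γ _ => ?_
    rw [prod_range_succ']
    simp only [pow_zero, Nat.div_one, pow_succ', Nat.div_div_eq_div_mul]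

/-! ### Threshold gates as sums of exact threshold gates -/

/-- The number `v / 2 ^ i`, rounded down, followed by the bit `i` of `v`. -/
def phi (m : ℕ) (v : ℤ) (i : ℕ) : ℤ := (2 * m + 1) * (v / 2 ^ i) + v / 2 ^ i % 2

/-- The codes `z = (2 * m + 1) * v + d` of the numbers `v > m` that become at most `m` when halved
with error `d - m`. -/
def crosses (m z : ℕ) : ℕ :=
  if m + 1 ≤ z / (2 * m + 1) ∧ z / (2 * m + 1) ≤ m + z % (2 * m + 1) then 1 else 0

/-- A bound on the codes that cross. -/
def codes (m : ℕ) : ℕ := (2 * m + 1) * (3 * m + 1)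

section Threshold

open Finset

variable {m N : ℕ}

/-- If `A' ≥ m + 1` then `A ≥ m + 2`, so the difference on the right is the indicator of `A' ≤ m <
A`. In that case `A ≤ 2 * m + m`, so the code of `A` and `A - 2 * A'` lies below `codes m`, and
exactly one summand survives. Digits `A - 2 * A' + m` below `2 * m + 1` make the code injective. -/
theorem sum_crosses (A A' : ℤ) (h : |A - 2 * A'| ≤ m) :
    ∑ z ∈ range (codes m),
      (crosses m z : ℤ) * (if (2 * m + 1) * A + (A - 2 * A') + m = z then 1 else 0) =
      (if m + 1 ≤ A then 1 else 0) - (if m + 1 ≤ A' then 1 else 0) := by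
  obtain ⟨h1, h2⟩ := abs_le.1 h
  obtain ⟨d, hd⟩ : ∃ d : ℕ, (d : ℤ) = A - 2 * A' + m := ⟨(A - 2 * A' + m).toNat, by omega⟩
  by_cases hA : (m : ℤ) + 1 ≤ A ∧ A' ≤ m
  · obtain ⟨v, rfl⟩ : ∃ v : ℕ, (v : ℤ) = A := ⟨A.toNat, by omega⟩
    have e : (2 * m + 1) * (v : ℤ) + (v - 2 * A') + m = ((2 * m + 1) * v + d : ℕ) := by
      push_cast; omega
    rw [sum_eq_single ((2 * m + 1) * v + d)]
    · have hdiv : ((2 * m + 1) * v + d) / (2 * m + 1) = v := by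
        rw [Nat.mul_add_div (by omega), Nat.div_eq_of_lt (by omega), add_zero]
      have hmod : ((2 * m + 1) * v + d) % (2 * m + 1) = d := by
        rw [Nat.mul_add_mod, Nat.mod_eq_of_lt (by omega)]
      rw [if_pos e, crosses, hdiv, hmod, if_pos (by omega), if_pos hA.1, if_neg (by omega)]
      simp
    · intro z _ hz
      rw [if_neg, mul_zero]
      rw [e]
      exact_mod_cast hz.symm
    · intro hz
      refine absurd (mem_range.2 ?_) hz
      have h3 : v ≤ 3 * m := by omega
      have h4 : (2 * m + 1) * v ≤ (2 * m + 1) * (3 * m) := Nat.mul_le_mul_left _ h3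
      rw [codes, mul_add]
      omega
  · have : ((if (m : ℤ) + 1 ≤ A then 1 else 0) - (if (m : ℤ) + 1 ≤ A' then 1 else 0) : ℤ) = 0 := by
      split_ifs <;> omega
    rw [this]
    refine sum_eq_zero fun z _ => ?_
    split_ifs with e
    · have hA0 : 0 ≤ A := by
        by_contra hA0
        have h5 : A ≤ -1 := by omega
        have : (2 * m + 1) * A ≤ (2 * m + 1) * (-1) :=
          mul_le_mul_of_nonneg_left h5 (by omega)
        omega
      obtain ⟨v, rfl⟩ : ∃ v : ℕ, (v : ℤ) = A := ⟨A.toNat, by omega⟩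
      obtain rfl : z = (2 * m + 1) * v + d := by
        have : (z : ℤ) = ((2 * m + 1) * v + d : ℕ) := by push_cast; omega
        exact_mod_cast this
      rw [crosses, Nat.mul_add_div (by omega), Nat.div_eq_of_lt (show d < 2 * m + 1 by omega),
        Nat.mul_add_mod, Nat.mod_eq_of_lt (show d < 2 * m + 1 by omega), if_neg (by omega)]
      simp
    · simp

/-- The right-hand sides of `sum_crosses` telescope, and `A N ≤ m` kills the last term. -/
theorem sum_sum_crosses (A : ℕ → ℤ) (h : ∀ i < N, |A i - 2 * A (i + 1)| ≤ m) (hN : A N ≤ m) :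
    ∑ i ∈ range N, ∑ z ∈ range (codes m), (crosses m z : ℤ) *
      (if (2 * m + 1) * A i + (A i - 2 * A (i + 1)) + m = z then 1 else 0) =
      if m + 1 ≤ A 0 then 1 else 0 := by
  rw [sum_congr rfl fun i hi => sum_crosses _ _ (h i (mem_range.1 hi)),
    sum_range_sub' (fun i => if (m : ℤ) + 1 ≤ A i then (1 : ℤ) else 0), if_neg (show ¬(m : ℤ) + 1 ≤ A N by omega), sub_zero]

theorem ediv_two_pow_sub (v : ℤ) (i : ℕ) : v / 2 ^ i - 2 * (v / 2 ^ (i + 1)) = v / 2 ^ i % 2 := by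
  rw [pow_succ, ← Int.ediv_ediv_of_nonneg (by positivity)]
  omega

/-- A sum of bits with few nonzero terms. -/
theorem sum_bit_le {L M q : ℕ} {f y : ℕ → ℤ} (hy : ∀ j < L, y j = 0 ∨ y j = 1)
    (hf : ∀ j < L, 0 ≤ f j ∧ f j ≤ q) (hc : #{j ∈ range L | f j ≠ 0} ≤ M) :
    0 ≤ ∑ j ∈ range L, f j * y j ∧ ∑ j ∈ range L, f j * y j ≤ M * q := by
  constructor
  · refine sum_nonneg fun j hj => ?_
    have := hf j (mem_range.1 hj)
    rcases hy j (mem_range.1 hj) with h | h <;> simp [h, this]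
  · calc ∑ j ∈ range L, f j * y j = ∑ j ∈ range L with f j ≠ 0, f j * y j := by
          refine (sum_filter_of_ne fun j _ h => ?_).symm
          exact left_ne_zero_of_mul h
      _ ≤ #{j ∈ range L | f j ≠ 0} • (q : ℤ) := by
          refine sum_le_card_nsmul _ _ _ fun j hj => ?_
          have hj := mem_range.1 (mem_filter.1 hj).1
          have := hf j hj
          rcases hy j hj with h | h <;> simp [h, this]
      _ ≤ M * q := by
          rw [nsmul_eq_mul]
          gcongr

/-- A threshold gate is a sum of exact threshold gates. -/
theorem thr_eq_sum {L : ℕ} {w y : ℕ → ℤ} {t : ℤ} (hy : ∀ j < L, y j = 0 ∨ y j = 1)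
    (hc : #{j ∈ range L | w j ≠ 0} + 1 ≤ m) (hw : ∀ j < L, (m + 1) * w j < 2 ^ N)
    (ht : -2 ^ N ≤ (m + 1) * (t - 1)) :
    ∑ i ∈ range N, ∑ z ∈ range (codes m), (crosses m z : ℤ) *
      (if ∑ j ∈ range L, phi m ((m + 1) * w j) i * y j = phi m ((m + 1) * (t - 1)) i - m + z
        then 1 else 0) = if t ≤ ∑ j ∈ range L, w j * y j then 1 else 0 := by
  set A : ℕ → ℤ := fun i => ∑ j ∈ range L, ((m + 1) * w j / 2 ^ i) * y j -
    (m + 1) * (t - 1) / 2 ^ i with hA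
  have hdiff : ∀ i, A i - 2 * A (i + 1) =
      ∑ j ∈ range L, ((m + 1) * w j / 2 ^ i % 2) * y j - (m + 1) * (t - 1) / 2 ^ i % 2 := fun i => by
    simp only [hA, ← ediv_two_pow_sub, sub_mul, sum_sub_distrib, mul_assoc, ← mul_sum]
    ring
  -- At most `m - 1` bits of weights are added and one bit of the threshold is subtracted.
  have hbit : ∀ i, |A i - 2 * A (i + 1)| ≤ m := fun i => by
    have := sum_bit_le (q := 1) (M := #{j ∈ range L | w j ≠ 0}) hy
      (f := fun j => (m + 1) * w j / 2 ^ i % 2) (fun j _ => by omega)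
      (card_le_card fun j hj => by
        simp only [mem_filter] at hj ⊢
        refine ⟨hj.1, fun h => hj.2 (by simp [h])⟩)
    rw [hdiff, abs_le]
    push_cast at this
    omega
  -- After `N` shifts every weight is at most 0 and the threshold term is at least `-1`, so `A N ≤
  -- 1`.
  have hend : A N ≤ m := by
    have h1 : ∑ j ∈ range L, ((m + 1) * w j / 2 ^ N) * y j ≤ 0 := by
      refine sum_nonpos fun j hj => ?_
      have h2 : (m + 1) * w j / 2 ^ N ≤ 0 := by
        have := Int.ediv_lt_of_lt_mul (by positivity)
          (show (m + 1) * w j < 1 * 2 ^ N by linarith [hw j (mem_range.1 hj)])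
        omega
      rcases hy j (mem_range.1 hj) with h | h <;> simp [h, h2]
    have h3 : -1 ≤ (m + 1) * (t - 1) / 2 ^ N :=
      (Int.le_ediv_iff_mul_le (by positivity)).2 (by linarith)
    simp only [hA]
    omega
  -- By integrality the form minus `t - 1` is either at least 1 or at most 0. Scaling by `m + 1`
  -- moves these cases to opposite sides of the level `m`.
  have hzero : (m : ℤ) + 1 ≤ A 0 ↔ t ≤ ∑ j ∈ range L, w j * y j := by
    have e : A 0 = (m + 1) * (∑ j ∈ range L, w j * y j - t + 1) := by
      simp only [hA, pow_zero, Int.ediv_one, mul_assoc, ← mul_sum]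
      ring
    rw [e]
    constructor
    · intro h
      by_contra h'
      have : (m + 1 : ℤ) * (∑ j ∈ range L, w j * y j - t + 1) ≤ (m + 1) * 0 :=
        mul_le_mul_of_nonneg_left (by omega) (by omega)
      omega
    · intro h
      have : (m + 1 : ℤ) * 1 ≤ (m + 1) * (∑ j ∈ range L, w j * y j - t + 1) :=
        mul_le_mul_of_nonneg_left (by omega) (by omega)
      omega
  rw [← if_congr hzero rfl rfl, ← sum_sum_crosses A (fun i _ => hbit i) hend]
  refine sum_congr rfl fun i _ => sum_congr rfl fun z _ => ?_
  congr 1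
  refine if_congr ?_ rfl rfl
  rw [hdiff]
  simp only [hA, phi, add_mul, sum_add_distrib, mul_assoc, ← mul_sum]
  constructor <;> intro h <;> linarith

/-! ### Exact threshold gates modulo a small number -/

/-- The remainder of an integer. -/
def rem (v : ℤ) (q : ℕ) : ℕ := (v % q).toNat

theorem cast_rem (v : ℤ) {q : ℕ} (hq : 0 < q) : (rem v q : ℤ) = v % q :=
  Int.toNat_of_nonneg (Int.emod_nonneg _ (by omega))

theorem rem_lt (v : ℤ) {q : ℕ} (hq : 0 < q) : rem v q < q := by
  have := Int.emod_lt_of_pos v (show (0 : ℤ) < q by omega)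
  have := cast_rem v hq
  omega

@[simp] theorem rem_zero (q : ℕ) : rem 0 q = 0 := by simp [rem]

variable {L M q : ℕ} {f y : ℕ → ℤ} {θ : ℤ}

theorem sum_rem_bound (hy : ∀ j < L, y j = 0 ∨ y j = 1) (hq : 0 < q)
    (hc : #{j ∈ range L | f j ≠ 0} ≤ M) :
    0 ≤ ∑ j ∈ range L, (rem (f j) q : ℤ) * y j ∧
      ∑ j ∈ range L, (rem (f j) q : ℤ) * y j ≤ M * (q - 1 : ℕ) :=
  sum_bit_le (q := q - 1) (f := fun j => (rem (f j) q : ℤ)) hy (fun j _ => ⟨by positivity, by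
    have := rem_lt (f j) hq
    omega⟩) ((card_le_card fun j hj => by
      simp only [mem_filter] at hj ⊢
      exact ⟨hj.1, fun h => hj.2 (by simp [h])⟩).trans hc)

theorem dvd_iff_dvd_rem (hq : 0 < q) : (q : ℤ) ∣ ∑ j ∈ range L, f j * y j - θ ↔
    (q : ℤ) ∣ ∑ j ∈ range L, (rem (f j) q : ℤ) * y j - rem θ q := by
  refine (dvd_iff_dvd_of_dvd_sub ?_)
  have : ∑ j ∈ range L, f j * y j - θ - (∑ j ∈ range L, (rem (f j) q : ℤ) * y j - rem θ q) =
      ∑ j ∈ range L, (f j - f j % q) * y j - (θ - θ % q) := by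
    simp only [cast_rem _ hq, sub_mul, sum_sub_distrib]
    ring
  rw [this]
  refine dvd_sub (dvd_sum fun j _ => Dvd.dvd.mul_right ?_ _) ?_ <;>
  exact Int.dvd_self_sub_emod

/-- The form with reduced coefficients lies between 0 and `M * (q - 1)`. If it is congruent to the
reduced target, it exceeds it by `c * q` for a unique `c < M`. -/
theorem sum_rem_eq {A : Type*} [AddCommMonoidWithOne A] (hy : ∀ j < L, y j = 0 ∨ y j = 1) (hq : 0 < q) (hM : 0 < M)
    (hc : #{j ∈ range L | f j ≠ 0} ≤ M) :
    ∑ c ∈ range M, (if ∑ j ∈ range L, (rem (f j) q : ℤ) * y j = (rem θ q + c * q : ℕ)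
      then 1 else 0 : A) = if (q : ℤ) ∣ ∑ j ∈ range L, f j * y j - θ then 1 else 0 := by
  obtain ⟨h0, h1⟩ := sum_rem_bound hy hq hc
  have hθ := rem_lt θ hq
  set S := ∑ j ∈ range L, (rem (f j) q : ℤ) * y j
  split_ifs with h
  · obtain ⟨c, hc⟩ := (dvd_iff_dvd_rem hq).1 h
    have hc0 : 0 ≤ c := by
      by_contra hc0
      have : (q : ℤ) * c ≤ q * (-1) := mul_le_mul_of_nonneg_left (by omega) (by omega)
      omega
    obtain ⟨c, rfl⟩ := Int.eq_ofNat_of_zero_le hc0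
    rw [sum_eq_single c]
    · rw [if_pos]
      push_cast
      linarith
    · intro c' _ hne
      rw [if_neg]
      intro h'
      push_cast at h'
      have : (q : ℤ) * c = q * c' := by linarith
      have := mul_left_cancel₀ (by omega) this
      exact hne (by exact_mod_cast this.symm)
    · intro hcM
      refine absurd (mem_range.2 ?_) hcM
      by_contra hcM
      have h2 : (q : ℤ) * M ≤ q * c := mul_le_mul_of_nonneg_left (by omega) (by omega)
      have h3 : ((q - 1 : ℕ) : ℤ) = q - 1 := by omega
      rw [h3] at h1
      have h4 : (1 : ℤ) ≤ M := by omega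
      nlinarith
  · refine sum_eq_zero fun c _ => if_neg fun h' => h ((dvd_iff_dvd_rem hq).2 ⟨c, ?_⟩)
    push_cast at h'
    linarith

end Threshold

/-! ### Prime numbers -/

/-- The number of proper divisors of `x`. -/
def properDivs (x : ℕ) : ℕ := ∑ d ∈ Finset.range x, if x % d = 0 then 1 else 0

/-- The number of primes up to `x`. -/
def primesUpTo (x : ℕ) : ℕ := ∑ y ∈ Finset.range (x + 1), if properDivs y = 1 then 1 else 0

/-- The prime number with index `r`, if it is at most `M`. -/
def primeBelow (M r : ℕ) : ℕ := ∑ x ∈ Finset.range M, if primesUpTo x ≤ r then 1 else 0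

section Primes

open Finset

theorem properDivs_eq_one_iff (x : ℕ) : properDivs x = 1 ↔ x.Prime := by
  have h : properDivs x = #x.properDivisors := by
    rw [properDivs, ← sum_filter, sum_const, smul_eq_mul, mul_one]
    congr 1
    ext d
    simp only [mem_filter, mem_range, Nat.mem_properDivisors, ← Nat.dvd_iff_mod_eq_zero]
    tauto
  rw [h, ← Nat.sum_properDivisors_eq_one_iff_prime]
  constructor
  · intro h1
    obtain ⟨d, hd⟩ := card_eq_one.1 h1
    have hx : 1 < x := by
      have := Nat.mem_properDivisors.1 (hd ▸ mem_singleton_self d)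
      rcases Nat.eq_zero_or_pos d with rfl | h0
      · have := this.1
        simp at this
        omega
      · omega
    have h2 : 1 ∈ x.properDivisors := Nat.one_mem_properDivisors_iff_one_lt.2 hx
    rw [hd] at h2 ⊢
    simpa using (mem_singleton.1 h2).symm
  · intro h1
    rw [Nat.sum_properDivisors_eq_one_iff_prime] at h1
    rw [h1.properDivisors, card_singleton]

theorem primesUpTo_eq (x : ℕ) : primesUpTo x = Nat.count Nat.Prime (x + 1) := by
  rw [primesUpTo, Nat.count_eq_card_filter_range, ← sum_filter, sum_const, smul_eq_mul, mul_one]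
  simp [properDivs_eq_one_iff]

/-- At most `r` primes are `≤ x` exactly when `x` lies below the prime with index `r`, so the sum
counts the numbers below that prime. -/
theorem primeBelow_eq {M r : ℕ} (h : Nat.nth Nat.Prime r ≤ M) :
    primeBelow M r = Nat.nth Nat.Prime r := by
  rw [primeBelow, ← sum_filter, sum_const, smul_eq_mul, mul_one]
  have : {x ∈ range M | primesUpTo x ≤ r} = range (Nat.nth Nat.Prime r) := by
    ext x
    rw [mem_filter, mem_range, mem_range, primesUpTo_eq,
      Nat.count_le_iff_le_nth Nat.infinite_setOfPred_prime, Nat.succ_le_iff]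
    exact ⟨fun h' => h'.2, fun h' => ⟨h'.trans_le h, h'⟩⟩
  rw [this, card_range]

/-- Chebyshev's lower bound at `4 ^ a` gives at least `(4 ^ a - (2 * a + 1)) / (2 * a)` primes. This
beats `2 ^ a - 1` because `2 * a + 2 ≤ 2 ^ a` for `a ≥ 3`. -/
theorem two_pow_le_primeCounting {a : ℕ} (ha : 3 ≤ a) : 2 ^ a ≤ Nat.primeCounting (4 ^ a) := by
  have h := Chebyshev.pi_ge (4 ^ a)
  have h2 : 0 < Real.log 2 := Real.log_pos (by norm_num)
  have e : Real.log ((4 ^ a : ℕ) : ℝ) = 2 * a * Real.log 2 := by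
    rw [show (4 ^ a : ℕ) = 2 ^ (2 * a) by rw [pow_mul]; norm_num]
    push_cast
    rw [Real.log_pow]
    push_cast
    ring
  have e1 : Real.log (((4 ^ a : ℕ) : ℝ) + 1) ≤ (2 * a + 1) * Real.log 2 := by
    have : ((4 ^ a : ℕ) : ℝ) + 1 ≤ 2 ^ (2 * a + 1) := by
      rw [pow_succ, pow_mul]
      push_cast
      norm_num
      have : (1 : ℝ) ≤ 4 ^ a := one_le_pow₀ (by norm_num)
      linarith
    calc Real.log (((4 ^ a : ℕ) : ℝ) + 1) ≤ Real.log (2 ^ (2 * a + 1)) :=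
          Real.log_le_log (by positivity) this
      _ = _ := by rw [Real.log_pow]; push_cast; ring
  have ha' : (0 : ℝ) < a := by positivity
  have h3 : (((4 ^ a : ℕ) : ℝ) - (2 * a + 1)) / (2 * a) ≤ Nat.primeCounting (4 ^ a) := by
    refine le_trans ?_ h
    rw [e, div_le_div_iff₀ (by positivity) (by positivity)]
    have : (((4 ^ a : ℕ) : ℝ) - (2 * a + 1)) * Real.log 2 ≤
        ((4 ^ a : ℕ) : ℝ) * Real.log 2 - Real.log (((4 ^ a : ℕ) : ℝ) + 1) := by linarith
    calc _ = ((((4 ^ a : ℕ) : ℝ) - (2 * a + 1)) * Real.log 2) * (2 * a) := by ring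
      _ ≤ _ := mul_le_mul_of_nonneg_right this (by positivity)
  rw [div_le_iff₀ (by positivity)] at h3
  by_contra hlt
  have h4 : (Nat.primeCounting (4 ^ a) : ℝ) ≤ 2 ^ a - 1 := by
    have : Nat.primeCounting (4 ^ a) + 1 ≤ 2 ^ a := by omega
    have : (Nat.primeCounting (4 ^ a) : ℝ) + 1 ≤ 2 ^ a := by exact_mod_cast this
    linarith
  have h5 : ∀ a : ℕ, 3 ≤ a → 2 * a + 2 ≤ 2 ^ a := fun a ha => by
    induction a, ha using Nat.le_induction with
    | base => norm_num
    | succ a ha ih => rw [pow_succ]; omega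
  have h6 : (2 * a + 2 : ℝ) ≤ 2 ^ a := by exact_mod_cast h5 a ha
  have h7 : ((4 ^ a : ℕ) : ℝ) = 2 ^ a * 2 ^ a := by
    rw [← mul_pow]
    push_cast
    norm_num
  rw [h7] at h3
  have h8 := mul_le_mul_of_nonneg_right h4 (show (0 : ℝ) ≤ 2 * a by positivity)
  nlinarith

theorem nth_prime_le {a r : ℕ} (ha : 3 ≤ a) (hr : r < 2 ^ a) : Nat.nth Nat.Prime r ≤ 4 ^ a :=
  Nat.lt_succ_iff.1 (Nat.nth_lt_of_lt_count (hr.trans_le (two_pow_le_primeCounting ha)))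

/-- Few primes divide a nonzero number. -/
theorem card_prime_dvd_le {B R : ℕ} {v : ℤ} (h0 : v ≠ 0) (hv : |v| < 2 ^ B) :
    #{r ∈ range R | ((Nat.nth Nat.Prime r : ℕ) : ℤ) ∣ v} ≤ B := by
  set S := {r ∈ range R | ((Nat.nth Nat.Prime r : ℕ) : ℤ) ∣ v}
  have hinj := Nat.nth_injective Nat.infinite_setOfPred_prime
  have h1 : ∏ p ∈ S.image (Nat.nth Nat.Prime), p ∣ v.natAbs := by
    refine prod_primes_dvd _ (fun p hp => ?_) fun p hp => ?_
    · obtain ⟨r, _, rfl⟩ := mem_image.1 hp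
      exact (Nat.prime_nth_prime r).prime
    · obtain ⟨r, hr, rfl⟩ := mem_image.1 hp
      exact Int.natCast_dvd.1 (mem_filter.1 hr).2
  have h2 : 2 ^ #S ≤ ∏ p ∈ S.image (Nat.nth Nat.Prime), p := by
    rw [← card_image_of_injective S hinj]
    refine pow_card_le_prod _ _ _ fun p hp => ?_
    obtain ⟨r, _, rfl⟩ := mem_image.1 hp
    exact (Nat.prime_nth_prime r).two_le
  have h3 : v.natAbs < 2 ^ B := by
    rw [Int.abs_eq_natAbs] at hv
    exact_mod_cast hv
  have := (h2.trans (Nat.le_of_dvd (Int.natAbs_pos.2 h0) h1)).trans_lt h3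
  exact ((Nat.pow_lt_pow_iff_right (by norm_num)).1 this).le

end Primes

/-! ### The parameters of the construction -/

/-- The data of a circuit: the parameter `e = ⌈1 / ε⌉`, the number of variables, the number of
bottom gates, the threshold and the weights of the top gate and of the bottom gates. -/
structure Net where
  e : ℕ
  n : ℕ
  w : ℕ
  T : ℤ
  a : ℕ → ℤ
  t : ℕ → ℤ
  W : ℕ → ℕ → ℤ

namespace Net

variable (D : Net)

open Finset

/-- The number of wired variables. -/
def wired : ℕ := ∑ i ∈ range D.n, if 0 < ∑ j ∈ range D.w, |D.W j i| then 1 else 0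

/-- More than the fan-in of any gate. -/
def m : ℕ := D.w + D.wired + 1

def absSum : ℤ := |D.T| + ∑ j ∈ range D.w, (|D.a j| + |D.t j| + ∑ i ∈ range D.n, |D.W j i|)

/-- A bound on the bit lengths. -/
def N : ℕ := ((D.m + 1) * (D.absSum + 1)).natAbs.size

/-- A bound on the bit lengths of the values of the linear forms. -/
def B : ℕ := D.N + codes D.m

def sg : ℕ := D.m.size

/-- The number of coins tossed for each random prime. -/
def b : ℕ := D.B.size + D.sg * D.e + 3

/-- The number of random primes. -/
def k : ℕ := (D.wired + (3 * D.N * codes D.m).size) / (D.sg * D.e) + 1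

/-- A bound on the random primes. -/
def P : ℕ := 4 ^ D.b

/-- The number of exact threshold gates at the bottom. -/
def U : ℕ := D.w * (D.N * codes D.m)

/-- A bound on the coefficients of the quadratic form. -/
def Hb : ℕ := 2 * D.k * D.m * D.P ^ 2

/-- The number of primes that are averaged over. -/
def R : ℕ := 2 * D.U ^ 2 * D.Hb * D.B + 1

/-- The prime with index `r`, for `r < R`. -/
def q (r : ℕ) : ℕ := primeBelow (4 ^ (D.R.size + 3)) r

/-- The random prime with index `l`. -/
def p (ω l : ℕ) : ℕ := primeBelow D.P (ω / 2 ^ (D.b * l) % 2 ^ D.b)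

def ftop (i j : ℕ) : ℤ := phi D.m ((D.m + 1) * D.a j) i

def thtop (i z : ℕ) : ℤ := phi D.m ((D.m + 1) * (D.T - 1)) i - D.m + z

/-- The target of equation `l`, where digit `l` of `γ` in base `w` is the guessed quotient. -/
def tau (ω i z γ l : ℕ) : ℕ :=
  rem (D.thtop i z) (D.p ω l) + γ / D.w ^ l % D.w * D.p ω l

def bl (ω i l j : ℕ) : ℕ := rem (D.ftop i j) (D.p ω l)

/-- The gate, the shift, and the code of an exact threshold gate at the bottom. -/
def aj (u : ℕ) : ℕ := u / (D.N * codes D.m)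
def ai (u : ℕ) : ℕ := u % (D.N * codes D.m) / codes D.m
def az (u : ℕ) : ℕ := u % (D.N * codes D.m) % codes D.m

/-- The coefficient of an exact test once each bottom gate is expanded; codes that do not cross get
weight 0. -/
def bu (ω i l u : ℕ) : ℕ := D.bl ω i l (D.aj u) * crosses D.m (D.az u)

/-- Since an indicator equals its square, the linear part of the expanded squares is put on the
diagonal. -/
def beta (ω i z γ u u' : ℕ) : ℤ :=
  (∑ l ∈ range D.k, D.bu ω i l u * D.bu ω i l u' : ℕ) -
    if u = u' then ((2 * ∑ l ∈ range D.k, D.tau ω i z γ l * D.bu ω i l u : ℕ) : ℤ) else 0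

/-- The constant part of the sum of squares. The extra 1 makes the form positive for a code that
does not cross, so that such a subcircuit never accepts. -/
def kap0 (ω i z γ : ℕ) : ℕ := (∑ l ∈ range D.k, D.tau ω i z γ l ^ 2) + (1 - crosses D.m z)

def fb (u ι : ℕ) : ℤ := phi D.m ((D.m + 1) * D.W (D.aj u) ι) (D.ai u)

def thb (u : ℕ) : ℤ := phi D.m ((D.m + 1) * (D.t (D.aj u) - 1)) (D.ai u) - D.m + D.az u

/-- The coefficients of the linear form that combines two exact threshold gates modulo `q r`. -/
def kap (r u u' ι : ℕ) : ℕ :=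
  rem (D.fb u ι) (D.q r) * ((D.m + 1) * D.q r) + rem (D.fb u' ι) (D.q r)

def lam (r u u' : ℕ) : ℕ := ∑ ι ∈ range D.n, D.kap r u u' ι

/-- Two targets as digits in base `(m + 1) * q r`, matching `kap`; `c` and `c'` are the guessed
quotients. -/
def val (r u u' c c' : ℕ) : ℕ :=
  (rem (D.thb u) (D.q r) + c * D.q r) * ((D.m + 1) * D.q r) +
    (rem (D.thb u') (D.q r) + c' * D.q r)

/-- Among the `2 * Hb` copies of a pair of gates, `Hb - beta` test weak inequalities and the others
strict ones. -/
def kh (ω i z γ u u' h : ℕ) : ℤ := if (h : ℤ) < D.Hb - D.beta ω i z γ u u' then 0 else 1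

/-- The term `- R` puts the threshold halfway between the counts belonging to the values 0 and 1 of
the form, which differ by `2 * R` up to error. -/
def topThr (ω i z γ : ℕ) : ℤ :=
  2 * D.Hb * (D.U * (D.U * (D.R * (D.m * D.m)))) - D.R + 2 * D.R * D.kap0 ω i z γ

/-! ### The values of the forms -/

variable {D}

theorem card_wired_le {j : ℕ} (hj : j < D.w) : #{i ∈ range D.n | D.W j i ≠ 0} ≤ D.wired := by
  rw [wired, ← sum_filter, sum_const, smul_eq_mul, mul_one]
  refine card_le_card fun i hi => ?_
  rw [mem_filter] at hi ⊢
  exact ⟨hi.1, sum_pos' (fun _ _ => abs_nonneg _) ⟨j, mem_range.2 hj, abs_pos.2 hi.2⟩⟩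

theorem absSum_bound {v : ℤ} (hv : |v| ≤ D.absSum + 1) : |(D.m + 1) * v| < 2 ^ D.N := by
  have h := BitLe.abs_lt (fun _ : Unit => ((D.m : ℤ) + 1) * (D.absSum + 1)) ()
  refine lt_of_le_of_lt ?_ h
  rw [abs_mul, abs_mul]
  exact mul_le_mul_of_nonneg_left (hv.trans (le_abs_self _)) (abs_nonneg _)

theorem abs_le_absSum (v : ℤ) (h : |v| ≤ |D.T| ∨ ∃ j < D.w, |v| ≤ |D.a j| ∨ |v| ≤ |D.t j| ∨
    ∃ i < D.n, |v| ≤ |D.W j i|) : |v| ≤ D.absSum := by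
  have h0 : ∀ j, 0 ≤ ∑ i ∈ range D.n, |D.W j i| := fun j => sum_nonneg fun _ _ => abs_nonneg _
  have h1 : ∀ j ∈ range D.w, 0 ≤ |D.a j| + |D.t j| + ∑ i ∈ range D.n, |D.W j i| := fun j _ => by
    have := h0 j
    positivity
  rw [absSum]
  rcases h with h | ⟨j, hj, h⟩
  · have := sum_nonneg h1
    omega
  · have := single_le_sum h1 (mem_range.2 hj)
    have h2 := abs_nonneg D.T
    have h3 := abs_nonneg (D.a j)
    have h4 := abs_nonneg (D.t j)
    have h5 := h0 j
    rcases h with h | h | ⟨i, hi, h⟩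
    · omega
    · omega
    · have := single_le_sum (f := fun i => |D.W j i|) (fun _ _ => abs_nonneg _) (mem_range.2 hi)
      omega

theorem abs_sub_one_le {v c : ℤ} (h : |v| ≤ c) : |v - 1| ≤ c + 1 := by
  have := abs_sub v 1
  rw [abs_one] at this
  omega

end Net

theorem abs_phi_le (m : ℕ) (v : ℤ) (i : ℕ) : |phi m v i| ≤ (2 * m + 1) * |v| + 1 := by
  have h1 := Int.abs_ediv_le_abs v (2 ^ i)
  have h2 : |v / 2 ^ i % 2| ≤ 1 := abs_le.2 (by omega)
  calc |phi m v i| ≤ |(2 * m + 1) * (v / 2 ^ i)| + |v / 2 ^ i % 2| := abs_add_le _ _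
    _ ≤ (2 * m + 1) * |v| + 1 := by
      rw [abs_mul, abs_of_pos (show (0 : ℤ) < 2 * m + 1 by omega)]
      exact add_le_add (mul_le_mul_of_nonneg_left h1 (by omega)) h2

@[simp] theorem phi_zero (m i : ℕ) : phi m 0 i = 0 := by simp [phi]

-- This is the reason for `B = N + codes m`: at most `m - 1` coefficients are nonzero, each of size
-- at most `(2 * m + 1) * 2 ^ N`. Together with the target they cost a factor `m * (2 * m + 1) + m +
-- codes m`, which is below `2 ^ codes m`.
open Finset in
theorem abs_form_lt {m N L z : ℕ} {w y : ℕ → ℤ} {s : ℤ} (i : ℕ)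
    (hy : ∀ j < L, y j = 0 ∨ y j = 1)
    (hc : #{j ∈ range L | w j ≠ 0} + 1 ≤ m) (hw : ∀ j < L, |(m + 1) * w j| < 2 ^ N)
    (hs : |(m + 1) * s| < 2 ^ N) (hz : z < codes m) :
    |∑ j ∈ range L, phi m ((m + 1) * w j) i * y j - (phi m ((m + 1) * s) i - m + z)| <
      2 ^ (N + codes m) := by
  have h1 : ∀ v : ℤ, |v| < 2 ^ N → |phi m v i| ≤ (2 * m + 1) * 2 ^ N := fun v hv => by
    have := abs_phi_le m v i
    have : (2 * m + 1) * (|v| + 1) ≤ (2 * m + 1) * 2 ^ N :=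
      mul_le_mul_of_nonneg_left (by omega) (by omega)
    linarith
  have h2 : |∑ j ∈ range L, phi m ((m + 1) * w j) i * y j| ≤ (m - 1 : ℕ) * ((2 * m + 1) * 2 ^ N) := by
    calc _ = |∑ j ∈ range L with w j ≠ 0, phi m ((m + 1) * w j) i * y j| := by
          congr 1
          refine (sum_filter_of_ne (p := fun j => w j ≠ 0) fun j _ h h' => h ?_).symm
          simp [h']
      _ ≤ ∑ j ∈ range L with w j ≠ 0, |phi m ((m + 1) * w j) i * y j| := abs_sum_le_sum_abs _ _
      _ ≤ #{j ∈ range L | w j ≠ 0} • ((2 * m + 1) * 2 ^ N) := by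
          refine sum_le_card_nsmul _ _ _ fun j hj => ?_
          have hj := mem_range.1 (mem_filter.1 hj).1
          rcases hy j hj with h | h <;> simp only [h, mul_zero, mul_one, abs_zero]
          · positivity
          · exact h1 _ (hw j hj)
      _ ≤ _ := by
          rw [nsmul_eq_mul]
          refine mul_le_mul_of_nonneg_right ?_ (by positivity)
          have : #{j ∈ range L | w j ≠ 0} ≤ m - 1 := by omega
          exact_mod_cast this
  have h3 := h1 _ hs
  have h4 : (1 : ℤ) ≤ 2 ^ N := one_le_pow₀ (by norm_num)
  have h5 : (m * (2 * m + 1) + m + codes m : ℕ) < 2 ^ codes m := by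
    have h6 : ∀ c : ℕ, 3 ≤ c → 2 * c < 2 ^ c := fun c hc => by
      induction c, hc using Nat.le_induction with
      | base => norm_num
      | succ c hc ih => rw [pow_succ]; omega
    have h7 : codes m = m * (2 * m + 1) + m + (4 * m ^ 2 + 3 * m + 1) := by
      rw [codes]; ring
    have : 3 ≤ codes m := by nlinarith [show 1 ≤ m by omega]
    have := h6 _ this
    nlinarith
  have h6 : ((m * (2 * m + 1) + m + codes m : ℕ) : ℤ) < 2 ^ codes m := by exact_mod_cast h5
  have h7 := abs_sub (∑ j ∈ range L, phi m ((m + 1) * w j) i * y j)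
    (phi m ((m + 1) * s) i - m + z)
  have h8 : |phi m ((m + 1) * s) i - m + z| ≤ (2 * m + 1) * 2 ^ N + m + codes m := by
    have := abs_le.1 h3
    rw [abs_le]
    constructor <;> omega
  rw [pow_add]
  have h9 : ((m - 1 : ℕ) : ℤ) = m - 1 := by omega
  rw [h9] at h2
  push_cast at h6
  calc _ ≤ ((m : ℤ) - 1) * ((2 * m + 1) * 2 ^ N) + ((2 * m + 1) * 2 ^ N + m + codes m) := by
        linarith
    _ = 2 ^ N * (m * (2 * m + 1)) + (m + codes m) * 1 := by ring
    _ ≤ 2 ^ N * (m * (2 * m + 1)) + (m + codes m) * 2 ^ N := by gcongr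
    _ = 2 ^ N * (m * (2 * m + 1) + m + codes m) := by ring
    _ < 2 ^ N * 2 ^ codes m := mul_lt_mul_of_pos_left h6 (by positivity)

/-! ### The circuits -/

/-- The values of the variables as a sequence of numbers. -/
def bitSeq {n : ℕ} (x : Fin n → Bool) (i : ℕ) : ℤ := if h : i < n then bitVal (x ⟨i, h⟩) else 0

theorem bitSeq_zero_or_one {n : ℕ} (x : Fin n → Bool) (i : ℕ) :
    bitSeq x i = 0 ∨ bitSeq x i = 1 := by
  simp only [bitSeq, bitVal]
  split_ifs <;> simp

theorem sum_map_range {M : Type*} [AddCommMonoid M] (f : ℕ → M) (n : ℕ) :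
    ((List.range n).map f).sum = ∑ i ∈ Finset.range n, f i := rfl

/-- The gate that compares a sum of variables, or of negated variables, with multiplicities `κ`,
with `s`. -/
def litGate (n : ℕ) (neg : Bool) (κ : ℕ → ℕ) (s : ℤ) : MajGate n :=
  ⟨(List.finRange n).flatMap fun i : Fin n => List.replicate (κ i) ⟨i, neg⟩, s⟩

section LitGate

variable {n : ℕ} {κ : ℕ → ℕ} {s : ℤ} {x : Fin n → Bool}

theorem length_litGate (neg : Bool) :
    (litGate n neg κ s).inputs.length = ∑ i ∈ Finset.range n, κ i := by
  simp only [litGate, List.length_flatMap, List.length_replicate]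
  rw [Finset.sum_range, Fin.sum_univ_def]

theorem countP_litGate (neg : Bool) :
    ((litGate n neg κ s).inputs.countP fun l => l.eval x) =
      ∑ i : Fin n, κ i * if (xor neg (x i)) = true then 1 else 0 := by
  simp only [litGate, List.countP_flatMap, Literal.eval]
  rw [Fin.sum_univ_def]
  congr 1
  refine List.map_congr_left fun i _ => ?_
  rw [Function.comp_apply, List.countP_replicate]
  simp

theorem eval_litGate_false : (litGate n false κ s).eval x = true ↔
    s ≤ ∑ i ∈ Finset.range n, (κ i : ℤ) * bitSeq x i := by
  rw [MajGate.eval, decide_eq_true_iff, countP_litGate, Finset.sum_range]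
  simp [litGate, bitSeq, bitVal]

/-- Negated literals count the total multiplicity minus the form, so unit weights also test upper
bounds. -/
theorem eval_litGate_true : (litGate n true κ s).eval x = true ↔
    s ≤ ((∑ i ∈ Finset.range n, κ i : ℕ) : ℤ) - ∑ i ∈ Finset.range n, (κ i : ℤ) * bitSeq x i := by
  rw [MajGate.eval, decide_eq_true_iff, countP_litGate, Finset.sum_range, Finset.sum_range]
  push_cast
  rw [← Finset.sum_sub_distrib]
  have : ∀ i : Fin n, (κ i : ℤ) * (if (xor true (x i)) = true then 1 else 0) =
      κ i - κ i * bitSeq x i := fun i => by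
    simp only [bitSeq, bitVal, i.2, dif_pos]
    cases x i <;> simp
  rw [Finset.sum_congr rfl fun i _ => this i]
  rfl

end LitGate

/-- Completing squares of linear forms in bits. -/
theorem quadratic_form {U k : ℕ} (b : ℕ → ℕ → ℤ) (τ E : ℕ → ℤ) (hE : ∀ u, E u * E u = E u) :
    ∑ u ∈ Finset.range U, ∑ u' ∈ Finset.range U,
      ((∑ l ∈ Finset.range k, b l u * b l u') -
        if u = u' then 2 * ∑ l ∈ Finset.range k, τ l * b l u else 0) * (E u * E u') +
      ∑ l ∈ Finset.range k, τ l ^ 2 =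
    ∑ l ∈ Finset.range k, (∑ u ∈ Finset.range U, b l u * E u - τ l) ^ 2 := by
  have h1 : ∀ l, (∑ u ∈ Finset.range U, b l u * E u - τ l) ^ 2 =
      (∑ u ∈ Finset.range U, ∑ u' ∈ Finset.range U, b l u * b l u' * (E u * E u')) -
        2 * (∑ u ∈ Finset.range U, τ l * b l u * E u) + τ l ^ 2 := fun l => by
    have : ∑ u ∈ Finset.range U, ∑ u' ∈ Finset.range U, b l u * b l u' * (E u * E u') =
        (∑ u ∈ Finset.range U, b l u * E u) * ∑ u ∈ Finset.range U, b l u * E u := by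
      rw [Finset.sum_mul_sum]
      exact Finset.sum_congr rfl fun u _ => Finset.sum_congr rfl fun u' _ => by ring
    rw [this, show ∑ u ∈ Finset.range U, τ l * b l u * E u =
      τ l * ∑ u ∈ Finset.range U, b l u * E u by
        rw [Finset.mul_sum]
        exact Finset.sum_congr rfl fun u _ => by ring]
    ring
  -- Here `hE` turns the diagonal products into the linear terms of the squares.
  have h2 : ∀ u ∈ Finset.range U, ∑ u' ∈ Finset.range U,
      ((if u = u' then 2 * ∑ l ∈ Finset.range k, τ l * b l u else 0) * (E u * E u')) =
        2 * ∑ l ∈ Finset.range k, τ l * b l u * E u := fun u hu => by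
    simp only [ite_mul, zero_mul]
    rw [Finset.sum_ite_eq, if_pos hu, hE, mul_assoc, Finset.sum_mul]
  simp only [h1, sub_mul, Finset.sum_sub_distrib, Finset.sum_add_distrib]
  rw [Finset.sum_congr rfl h2, ← Finset.mul_sum, ← Finset.mul_sum]
  congr 2
  · symm
    rw [Finset.sum_comm]
    refine Finset.sum_congr rfl fun u _ => ?_
    rw [Finset.sum_comm]
    refine Finset.sum_congr rfl fun u' _ => ?_
    rw [Finset.sum_mul]
  · rw [Finset.sum_comm]

namespace Net

variable (D : Net)

/-- The bottom gates of a subcircuit. -/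
def gates (ω i z γ : ℕ) : List (MajGate D.n) :=
  (List.range D.U).flatMap fun u => (List.range D.U).flatMap fun u' =>
    (List.range D.R).flatMap fun r => (List.range D.m).flatMap fun c =>
      (List.range D.m).flatMap fun c' => (List.range (2 * D.Hb)).flatMap fun h =>
        [litGate D.n false (D.kap r u u') (D.val r u u' c c' + D.kh ω i z γ u u' h),
          litGate D.n true (D.kap r u u')
            (D.lam r u u' - D.val r u u' c c' + D.kh ω i z γ u u' h)]

/-- One of the subcircuits. -/
def sub (ω i z γ : ℕ) : MajMaj D.n := ⟨D.gates ω i z γ, D.topThr ω i z γ⟩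

/-- All the subcircuits. -/
def subs (ω : ℕ) : List (MajMaj D.n) :=
  (List.range D.N).flatMap fun i => (List.range (codes D.m)).flatMap fun z =>
    (List.range (D.w ^ D.k)).map fun γ => D.sub ω i z γ

/-! ### The quadratic form in the exact tests -/

section Semantics

open Finset

variable {D} {y : ℕ → ℤ} (hy : ∀ i, y i = 0 ∨ y i = 1)

/-- The value of the linear form of a bottom exact threshold gate, minus its target. -/
def form (D : Net) (y : ℕ → ℤ) (u : ℕ) : ℤ := ∑ ι ∈ range D.n, D.fb u ι * y ι - D.thb u

/-- The value of a bottom gate. -/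
def bot (D : Net) (y : ℕ → ℤ) (j : ℕ) : ℤ :=
  if D.t j ≤ ∑ i ∈ range D.n, D.W j i * y i then 1 else 0

/-- The value of an exact threshold gate at the bottom. -/
def exact (D : Net) (y : ℕ → ℤ) (u : ℕ) : ℤ := if D.form y u = 0 then 1 else 0

/-- The value of the linear form of a top exact threshold gate, minus its target. -/
def topForm (D : Net) (y : ℕ → ℤ) (i z : ℕ) : ℤ :=
  ∑ j ∈ range D.w, D.ftop i j * D.bot y j - D.thtop i z

/-- The quadratic form that vanishes if a subcircuit should accept. -/
def quad (D : Net) (y : ℕ → ℤ) (ω i z γ : ℕ) : ℤ :=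
  ∑ l ∈ range D.k, (∑ j ∈ range D.w, (D.bl ω i l j : ℤ) * D.bot y j - D.tau ω i z γ l) ^ 2 +
    (1 - crosses D.m z : ℕ)

theorem bot_zero_or_one (j : ℕ) : D.bot y j = 0 ∨ D.bot y j = 1 := by
  rw [bot]
  split_ifs <;> simp

-- This is `thr_eq_sum` for one bottom gate, with shift and code packed into the index `v`.
include hy in
theorem sum_exact {j : ℕ} (hj : j < D.w) : ∑ v ∈ range (D.N * codes D.m),
    (crosses D.m (v % codes D.m) : ℤ) * D.exact y (j * (D.N * codes D.m) + v) = D.bot y j := by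
  have h := thr_eq_sum (m := D.m) (N := D.N) (L := D.n) (w := D.W j) (t := D.t j) (y := y)
    (fun i _ => hy i) (by have := D.card_wired_le hj; rw [m]; omega)
    (fun i hi => (abs_lt.1 (D.absSum_bound ((D.abs_le_absSum _
      (.inr ⟨j, hj, .inr (.inr ⟨i, hi, le_rfl⟩)⟩)).trans (by omega)))).2)
    (abs_lt.1 (D.absSum_bound (abs_sub_one_le (D.abs_le_absSum _
      (.inr ⟨j, hj, .inr (.inl le_rfl)⟩))))).1.le
  rw [bot, ← h, ← sum_range_mul]
  refine sum_congr rfl fun v hv => ?_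
  have hv := mem_range.1 hv
  congr 1
  have h1 : D.aj (j * (D.N * codes D.m) + v) = j := by
    rw [aj, mul_comm j, Nat.mul_add_div (by omega), Nat.div_eq_of_lt hv, add_zero]
  have h2 : (j * (D.N * codes D.m) + v) % (D.N * codes D.m) = v := by
    rw [mul_comm j, Nat.mul_add_mod, Nat.mod_eq_of_lt hv]
  simp only [exact, form, fb, thb, h1, ai, az, h2]
  exact if_congr sub_eq_zero rfl rfl

include hy in
theorem sum_bu (ω i l : ℕ) : ∑ u ∈ range D.U, (D.bu ω i l u : ℤ) * D.exact y u =
    ∑ j ∈ range D.w, (D.bl ω i l j : ℤ) * D.bot y j := by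
  rw [U]
  have h := sum_range_mul (fun j v => (D.bl ω i l j : ℤ) *
    ((crosses D.m (v % codes D.m) : ℤ) * D.exact y (j * (D.N * codes D.m) + v))) D.w
      (D.N * codes D.m)
  simp only [← mul_sum] at h
  rw [← sum_congr rfl fun j hj => congrArg _ (D.sum_exact hy (mem_range.1 hj)), ← h]
  refine sum_congr rfl fun u _ => ?_
  rw [mul_comm (u / _), Nat.div_add_mod, bu, aj, az]
  push_cast
  ring

-- Substituting `sum_bu` into the squares of `quad` and expanding by `quadratic_form` makes the form
-- quadratic in the exact tests.
include hy in
theorem sum_beta (ω i z γ : ℕ) : ∑ u ∈ range D.U, ∑ u' ∈ range D.U,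
    D.beta ω i z γ u u' * (D.exact y u * D.exact y u') + D.kap0 ω i z γ = D.quad y ω i z γ := by
  have h := quadratic_form (U := D.U) (k := D.k) (fun l u => (D.bu ω i l u : ℤ))
    (fun l => (D.tau ω i z γ l : ℤ)) (D.exact y) (fun u => by
      rw [exact]
      split_ifs <;> simp)
  rw [quad]
  simp only [← D.sum_bu hy]
  rw [← h, kap0]
  simp only [beta]
  push_cast
  ring

end Semantics

end Net

/-! ### Counting the true gates of a subcircuit -/

section Correctness

open Finset

/-- The number of true gates among those that represent one term of a quadratic form. -/
theorem sum_copies {H : ℕ} {β V Φ Λ : ℤ} (hβ : |β| ≤ H) :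
    ∑ h ∈ range (2 * H), ((if V + (if (h : ℤ) < H - β then 0 else 1) ≤ Φ then 1 else 0) +
      (if Λ - V + (if (h : ℤ) < H - β then 0 else 1) ≤ Λ - Φ then 1 else 0)) =
      (2 * H - 2 * β * if Φ = V then 1 else 0 : ℤ) := by
  have h1 := abs_le.1 hβ
  -- A pair with weak inequalities has `1 + [Φ = V]` true gates, and a pair with strict ones has `1
  -- - [Φ = V]`. The mixture of the two realises a coefficient of either sign.
  have h2 : ∀ h : ℕ, ((if V + (if (h : ℤ) < H - β then 0 else 1) ≤ Φ then 1 else 0) +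
      (if Λ - V + (if (h : ℤ) < H - β then 0 else 1) ≤ Λ - Φ then 1 else 0) : ℤ) =
      (1 - if Φ = V then 1 else 0) +
        (if (h : ℤ) < H - β then 1 else 0) * (2 * if Φ = V then 1 else 0) := fun h => by
    split_ifs <;> omega
  have h3 : ∑ h ∈ range (2 * H), (if (h : ℤ) < H - β then 1 else 0 : ℤ) = H - β := by
    rw [← sum_filter, sum_const, show {h ∈ range (2 * H) | ((h : ℕ) : ℤ) < H - β} =
      range (H - β).toNat from ?_, card_range]
    · simp
      omega
    · ext h
      simp only [mem_filter, mem_range]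
      omega
  simp only [h2]
  rw [sum_add_distrib, ← sum_mul, h3]
  simp only [sum_const, card_range, nsmul_eq_mul]
  push_cast
  ring

theorem abs_sum_range_le {U : ℕ} {f : ℕ → ℤ} {c : ℤ} (h : ∀ u < U, |f u| ≤ c) :
    |∑ u ∈ range U, f u| ≤ U * c := by
  refine (abs_sum_le_sum_abs _ _).trans ((sum_le_card_nsmul _ _ c fun u hu =>
    h u (mem_range.1 hu)).trans_eq ?_)
  rw [card_range, nsmul_eq_mul]

/-- Two exact conditions combined into one. -/
theorem combine_iff {S S' v v' Y : ℤ} (h : |S' - v'| < Y) :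
    S * Y + S' = v * Y + v' ↔ S = v ∧ S' = v' := by
  obtain ⟨h1, h2⟩ := abs_lt.1 h
  constructor
  · intro e
    have e1 : S' - v' = (v - S) * Y := by linarith
    have : v - S = 0 := by
      by_contra hne
      rcases lt_or_gt_of_ne hne with h0 | h0
      · have : (v - S) * Y ≤ (-1) * Y := mul_le_mul_of_nonneg_right (by omega) (by omega)
        omega
      · have : 1 * Y ≤ (v - S) * Y := mul_le_mul_of_nonneg_right (by omega) (by omega)
        omega
    rw [this] at e1
    constructor <;> omega
  · rintro ⟨rfl, rfl⟩
    rfl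

namespace Net

variable {D : Net}

theorem q_eq {r : ℕ} (hr : r < D.R) : D.q r = Nat.nth Nat.Prime r :=
  primeBelow_eq (nth_prime_le (by omega) (hr.trans (D.R.lt_size_self.trans_le
    (Nat.pow_le_pow_right (by norm_num) (by omega)))))

theorem q_pos {r : ℕ} (hr : r < D.R) : 0 < D.q r := by
  rw [q_eq hr]
  exact (Nat.prime_nth_prime r).pos

theorem p_eq (ω l : ℕ) : D.p ω l = Nat.nth Nat.Prime (ω / 2 ^ (D.b * l) % 2 ^ D.b) :=
  primeBelow_eq (nth_prime_le (by rw [b]; omega) (Nat.mod_lt _ (by positivity)))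

theorem p_pos (ω l : ℕ) : 0 < D.p ω l := by
  rw [p_eq]
  exact (Nat.prime_nth_prime _).pos

theorem p_le (ω l : ℕ) : D.p ω l ≤ D.P := by
  rw [p_eq]
  exact nth_prime_le (by rw [b]; omega) (Nat.mod_lt _ (by positivity))

theorem aj_lt {u : ℕ} (hu : u < D.U) : D.aj u < D.w :=
  Nat.div_lt_of_lt_mul (by rwa [U, mul_comm] at hu)

theorem card_fb_le {u : ℕ} (hu : u < D.U) : #{ι ∈ range D.n | D.fb u ι ≠ 0} ≤ D.m := by
  refine (card_le_card fun i hi => ?_).trans ((D.card_wired_le (D.aj_lt hu)).trans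
    (by rw [m]; omega))
  simp only [mem_filter] at hi ⊢
  exact ⟨hi.1, fun h => hi.2 (by simp [fb, h])⟩

theorem m_pos : 0 < D.m := by rw [m]; omega

section

variable {y : ℕ → ℤ} (hy : ∀ i, y i = 0 ∨ y i = 1)
include hy

/-- Each divisibility is a sum over quotients by `sum_rem_eq`, and the product of two equations is
one equation in base `(m + 1) * q`. The base suffices because the lower value and its target both
lie between 0 and `m * q`. -/
theorem sum_combined {r u u' : ℕ} (hr : r < D.R) (hu : u < D.U) (hu' : u' < D.U) :
    ∑ c ∈ range D.m, ∑ c' ∈ range D.m,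
      (if ∑ ι ∈ range D.n, (D.kap r u u' ι : ℤ) * y ι = D.val r u u' c c' then 1 else 0 : ℤ) =
      (if (D.q r : ℤ) ∣ D.form y u then 1 else 0) * if (D.q r : ℤ) ∣ D.form y u' then 1 else 0 := by
  have hq := D.q_pos hr
  rw [form, form, ← sum_rem_eq (fun i _ => hy i) hq D.m_pos (D.card_fb_le hu),
    ← sum_rem_eq (fun i _ => hy i) hq D.m_pos (D.card_fb_le hu'), sum_mul_sum]
  refine sum_congr rfl fun c _ => sum_congr rfl fun c' hc' => ?_
  rw [ite_zero_mul_ite_zero, one_mul]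
  refine if_congr ?_ rfl rfl
  rw [show ∑ ι ∈ range D.n, (D.kap r u u' ι : ℤ) * y ι =
    (∑ ι ∈ range D.n, (rem (D.fb u ι) (D.q r) : ℤ) * y ι) * ((D.m + 1) * D.q r) +
      ∑ ι ∈ range D.n, (rem (D.fb u' ι) (D.q r) : ℤ) * y ι from ?_, val]
  · push_cast
    refine combine_iff ?_
    obtain ⟨h1, h2⟩ := sum_rem_bound (fun i _ => hy i) hq (D.card_fb_le hu')
    have h3 := rem_lt (D.thb u') hq
    generalize D.q r = q at *
    generalize D.m = m at *
    have h4 : (c' : ℤ) * q ≤ (m - 1) * q :=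
      mul_le_mul_of_nonneg_right (by have := mem_range.1 hc'; omega) (by omega)
    have h5 : (m : ℤ) * (q - 1 : ℕ) ≤ m * q :=
      mul_le_mul_of_nonneg_left (by omega) (by omega)
    have h6 : (0 : ℤ) ≤ c' * q := by positivity
    rw [abs_lt]
    constructor <;> linarith
  · rw [sum_mul, ← sum_add_distrib]
    refine sum_congr rfl fun ι _ => ?_
    rw [kap]
    push_cast
    ring

omit hy in
theorem abs_form_lt {u : ℕ} (hy : ∀ i, y i = 0 ∨ y i = 1) (hu : u < D.U) :
    |D.form y u| < 2 ^ D.B := by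
  have hj := D.aj_lt hu
  refine _root_.abs_form_lt (m := D.m) (N := D.N) (w := D.W (D.aj u)) (s := D.t (D.aj u) - 1)
    (D.ai u) (fun i _ => hy i) ?_ (fun i hi => ?_) ?_ (Nat.mod_lt _ (by rw [codes]; positivity))
  · have := D.card_wired_le hj
    rw [m]
    omega
  · exact D.absSum_bound ((D.abs_le_absSum _
      (.inr ⟨_, hj, .inr (.inr ⟨i, hi, le_rfl⟩)⟩)).trans (by omega))
  · exact D.absSum_bound (abs_sub_one_le (D.abs_le_absSum _ (.inr ⟨_, hj, .inr (.inl le_rfl)⟩)))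

/-- If both forms vanish, every prime contributes 1 and there is no error. Otherwise the true
product is 0, and only the at most `B` primes dividing a nonzero form contribute. -/
theorem sum_dvd_bound {u u' : ℕ} (hu : u < D.U) (hu' : u' < D.U) :
    |∑ r ∈ range D.R, ((if (D.q r : ℤ) ∣ D.form y u then 1 else 0) *
      if (D.q r : ℤ) ∣ D.form y u' then 1 else 0 : ℤ) - D.R * (D.exact y u * D.exact y u')| ≤
      D.B := by
  have hone : ∀ u < D.U, D.form y u ≠ 0 →
      ∑ r ∈ range D.R, (if (D.q r : ℤ) ∣ D.form y u then 1 else 0 : ℤ) ≤ D.B := fun u hu h0 => by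
    rw [← sum_filter, sum_const, nsmul_eq_mul, mul_one]
    have := card_prime_dvd_le (R := D.R) h0 (D.abs_form_lt hy hu)
    rw [filter_congr (q := fun r => ((Nat.nth Nat.Prime r : ℕ) : ℤ) ∣ D.form y u)
      fun r hr => by rw [q_eq (mem_range.1 hr)]]
    exact_mod_cast this
  have hnn : 0 ≤ ∑ r ∈ range D.R, ((if (D.q r : ℤ) ∣ D.form y u then 1 else 0) *
      if (D.q r : ℤ) ∣ D.form y u' then 1 else 0 : ℤ) :=
    sum_nonneg fun r _ => by split_ifs <;> simp
  by_cases h : D.form y u = 0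
  · by_cases h' : D.form y u' = 0
    · simp only [Net.exact, h, h', if_true, dvd_zero, mul_one, sum_const, card_range,
        nsmul_eq_mul, sub_self, abs_zero]
      exact Nat.cast_nonneg _
    · have := hone u' hu' h'
      simp only [Net.exact, h, h', if_true, if_false, dvd_zero, one_mul, mul_zero, sub_zero] at hnn ⊢
      rwa [abs_of_nonneg hnn]
  · have := hone u hu h
    simp only [Net.exact, h, if_false, zero_mul, mul_zero, sub_zero]
    rw [abs_of_nonneg hnn]
    refine le_trans (sum_le_sum fun r _ => ?_) this
    split_ifs <;> simp

end

theorem bl_le (ω i l j : ℕ) : D.bl ω i l j ≤ D.P := (rem_lt _ (D.p_pos ω l)).le.trans (D.p_le ω l)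

theorem crosses_le_one (m z : ℕ) : crosses m z ≤ 1 := by
  rw [crosses]
  split_ifs <;> omega

theorem bu_le (ω i l u : ℕ) : D.bu ω i l u ≤ D.P :=
  (Nat.mul_le_mul (D.bl_le ω i l _) (crosses_le_one _ _)).trans (by simp)

theorem tau_le (hw : 0 < D.w) (ω i z γ l : ℕ) : D.tau ω i z γ l ≤ D.w * D.P := by
  have h1 := rem_lt (D.thtop i z) (D.p_pos ω l)
  have h2 := D.p_le ω l
  have h3 : γ / D.w ^ l % D.w + 1 ≤ D.w := Nat.mod_lt _ hw
  rw [tau]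
  calc _ ≤ (γ / D.w ^ l % D.w + 1) * D.p ω l := by rw [add_mul]; omega
    _ ≤ _ := Nat.mul_le_mul h3 h2

/-- `beta` is a difference of nonnegative numbers, so it is enough that each of them is at most
`Hb`. -/
theorem abs_beta_le (hw : 0 < D.w) (ω i z γ u u' : ℕ) : |D.beta ω i z γ u u'| ≤ D.Hb := by
  have h1 : ∑ l ∈ range D.k, D.bu ω i l u * D.bu ω i l u' ≤ D.k * (D.P * D.P) := by
    refine (sum_le_card_nsmul _ _ (D.P * D.P) fun l _ =>
      Nat.mul_le_mul (D.bu_le _ _ _ _) (D.bu_le _ _ _ _)).trans ?_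
    simp
  have h2 : ∑ l ∈ range D.k, D.tau ω i z γ l * D.bu ω i l u ≤ D.k * (D.w * D.P * D.P) := by
    refine (sum_le_card_nsmul _ _ (D.w * D.P * D.P) fun l _ =>
      Nat.mul_le_mul (D.tau_le hw _ _ _ _ _) (D.bu_le _ _ _ _)).trans ?_
    simp
  have h3 : D.Hb = D.k * (D.P * D.P) * (2 * D.m) := by rw [Hb]; ring
  have h4 : 2 * (D.k * (D.w * D.P * D.P)) ≤ D.Hb := by
    rw [show 2 * (D.k * (D.w * D.P * D.P)) = D.k * (D.P * D.P) * (2 * D.w) by ring, h3]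
    exact Nat.mul_le_mul_left _ (by rw [m]; omega)
  have h5 : D.k * (D.P * D.P) ≤ D.Hb := by
    rw [h3]
    exact Nat.le_mul_of_pos_right _ (by rw [m]; omega)
  rw [beta, abs_le]
  split_ifs <;> constructor <;> omega

/-! ### Correctness of the subcircuits -/

/-- Sum `sum_copies` over all pairs, primes and quotients. Its constant part depends on no input,
and `sum_combined` collapses the quotients in the rest. -/
theorem countP_gates (hw : 0 < D.w) (ω i z γ : ℕ) (x : Fin D.n → Bool) :
    ((D.gates ω i z γ).countP fun g => g.eval x : ℕ) =
      2 * (D.Hb : ℤ) * (D.U * (D.U * (D.R * (D.m * D.m)))) -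
      2 * ∑ u ∈ range D.U, ∑ u' ∈ range D.U, D.beta ω i z γ u u' *
        ∑ r ∈ range D.R, ((if (D.q r : ℤ) ∣ D.form (bitSeq x) u then 1 else 0) *
          if (D.q r : ℤ) ∣ D.form (bitSeq x) u' then 1 else 0) := by
  have hy := bitSeq_zero_or_one x
  have h2 : ∀ r u u' c c' h, ((List.countP (fun g => g.eval x)
      [litGate D.n false (D.kap r u u') (D.val r u u' c c' + D.kh ω i z γ u u' h),
        litGate D.n true (D.kap r u u')
          (D.lam r u u' - D.val r u u' c c' + D.kh ω i z γ u u' h)] : ℕ) : ℤ) =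
      (if (D.val r u u' c c' + (if (h : ℤ) < D.Hb - D.beta ω i z γ u u' then 0 else 1) : ℤ) ≤
        ∑ ι ∈ range D.n, (D.kap r u u' ι : ℤ) * bitSeq x ι then 1 else 0) +
      (if ((D.lam r u u' : ℤ) - D.val r u u' c c' +
        (if (h : ℤ) < D.Hb - D.beta ω i z γ u u' then 0 else 1) : ℤ) ≤
        D.lam r u u' - ∑ ι ∈ range D.n, (D.kap r u u' ι : ℤ) * bitSeq x ι then 1 else 0) := by
    intro r u u' c c' h
    simp only [List.countP_cons, List.countP_nil, eval_litGate_false, eval_litGate_true, kh, lam]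
    push_cast
    ring
  have h3 : ((D.gates ω i z γ).countP fun g => g.eval x : ℕ) =
      ∑ u ∈ range D.U, ∑ u' ∈ range D.U, ∑ r ∈ range D.R, ∑ c ∈ range D.m, ∑ c' ∈ range D.m,
        (2 * (D.Hb : ℤ) - 2 * D.beta ω i z γ u u' *
          if ∑ ι ∈ range D.n, (D.kap r u u' ι : ℤ) * bitSeq x ι = D.val r u u' c c'
            then 1 else 0) := by
    simp only [gates, List.countP_flatMap, Function.comp_def, sum_map_range, Nat.cast_sum]
    refine sum_congr rfl fun u _ => sum_congr rfl fun u' _ => sum_congr rfl fun r _ =>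
      sum_congr rfl fun c _ => sum_congr rfl fun c' _ => ?_
    rw [sum_congr rfl fun h _ => h2 r u u' c c' h]
    exact sum_copies (D.abs_beta_le hw ω i z γ u u')
  have h4 : ∀ u ∈ range D.U, ∀ u' ∈ range D.U,
      ∑ r ∈ range D.R, ∑ c ∈ range D.m, ∑ c' ∈ range D.m,
        (2 * (D.Hb : ℤ) - 2 * D.beta ω i z γ u u' *
          if ∑ ι ∈ range D.n, (D.kap r u u' ι : ℤ) * bitSeq x ι = D.val r u u' c c'
            then 1 else 0) = 2 * (D.Hb : ℤ) * (D.R * (D.m * D.m)) -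
        2 * (D.beta ω i z γ u u' *
        ∑ r ∈ range D.R, ((if (D.q r : ℤ) ∣ D.form (bitSeq x) u then 1 else 0) *
          if (D.q r : ℤ) ∣ D.form (bitSeq x) u' then 1 else 0)) := fun u hu u' hu' => by
    simp only [sum_sub_distrib, ← mul_sum, sum_const, card_range, nsmul_eq_mul]
    rw [sum_congr rfl fun r hr =>
      D.sum_combined hy (mem_range.1 hr) (mem_range.1 hu) (mem_range.1 hu')]
    ring
  rw [h3, sum_congr rfl fun u hu => sum_congr rfl fun u' hu' => h4 u hu u' hu']
  simp only [sum_sub_distrib, ← mul_sum, sum_const, card_range, nsmul_eq_mul]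
  ring

/-- A subcircuit accepts if and only if its quadratic form vanishes. -/
theorem eval_sub (hw : 0 < D.w) (ω i z γ : ℕ) (x : Fin D.n → Bool) :
    (D.sub ω i z γ).eval x = true ↔ D.quad (bitSeq x) ω i z γ = 0 := by
  have hy := bitSeq_zero_or_one x
  set y := bitSeq x with hy'
  set G : ℕ → ℕ → ℤ := fun u u' => ∑ r ∈ range D.R, ((if (D.q r : ℤ) ∣ D.form y u then 1 else 0) *
    if (D.q r : ℤ) ∣ D.form y u' then 1 else 0) with hG
  -- There are `U ^ 2` products, each with error at most `B` and coefficient at most `Hb`.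
  have herr : |∑ u ∈ range D.U, ∑ u' ∈ range D.U, D.beta ω i z γ u u' * G u u' -
      D.R * (D.quad y ω i z γ - D.kap0 ω i z γ)| ≤ D.U * (D.U * (D.Hb * D.B)) := by
    rw [← D.sum_beta hy, add_sub_cancel_right, mul_sum, ← sum_sub_distrib]
    refine abs_sum_range_le fun u hu => ?_
    rw [mul_sum, ← sum_sub_distrib]
    refine abs_sum_range_le fun u' hu' => ?_
    rw [show D.beta ω i z γ u u' * G u u' -
      D.R * (D.beta ω i z γ u u' * (D.exact y u * D.exact y u')) =
      D.beta ω i z γ u u' * (G u u' - D.R * (D.exact y u * D.exact y u')) by ring, abs_mul]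
    exact mul_le_mul (D.abs_beta_le hw _ _ _ _ _ _)
      (D.sum_dvd_bound hy hu hu') (abs_nonneg _) (by positivity)
  have hR : (D.R : ℤ) = 2 * (D.U * (D.U * (D.Hb * D.B))) + 1 := by
    rw [R]
    push_cast
    ring
  have hQ : 0 ≤ D.quad y ω i z γ :=
    add_nonneg (sum_nonneg fun _ _ => sq_nonneg _) (by positivity)
  rw [MajMaj.eval, decide_eq_true_iff]
  change D.topThr ω i z γ ≤ (((D.gates ω i z γ).countP fun g => g.eval x : ℕ) : ℤ) ↔ _
  rw [D.countP_gates hw, topThr]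
  obtain ⟨h1, h2⟩ := abs_le.1 herr
  set S := ∑ u ∈ range D.U, ∑ u' ∈ range D.U, D.beta ω i z γ u u' * G u u'
  have h3 : (D.R : ℤ) * (D.quad y ω i z γ - D.kap0 ω i z γ) =
    D.R * D.quad y ω i z γ - D.R * D.kap0 ω i z γ := by ring
  have h4 : (2 : ℤ) * D.R * D.kap0 ω i z γ = 2 * (D.R * D.kap0 ω i z γ) := by ring
  rw [h4]
  rw [h3] at h1 h2
  -- In the doubled sum the error is at most `R - 1`. A nonzero form is at least 1 and contributes
  -- at least `2 * R`, which exceeds the slack `R` even after this error; a zero form stays within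
  -- the slack.
  constructor
  · intro h
    by_contra hne
    have : (D.R : ℤ) * 1 ≤ D.R * D.quad y ω i z γ :=
      mul_le_mul_of_nonneg_left (by omega) (by omega)
    omega
  · intro h
    rw [h] at h1 h2
    omega

end Net

/-! ### Summing over the subcircuits, and the choice of random primes -/

open Finset

theorem countP_range (p : ℕ → Bool) (n : ℕ) :
    ((List.range n).countP p : ℤ) = ∑ i ∈ range n, if p i = true then 1 else 0 := by
  induction n with
  | zero => simp
  | succ n ih =>
    rw [List.range_succ, List.countP_append, sum_range_succ, ← ih]
    simp

namespace Net

variable {D : Net}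

/-- No random prime is bad for all exact threshold gates at the top that are false. -/
def Good (D : Net) (ω : ℕ) : Prop :=
  ∀ x : Fin D.n → Bool, ∀ i < D.N, ∀ z < codes D.m, D.topForm (bitSeq x) i z ≠ 0 →
    ∃ l < D.k, ¬((D.p ω l : ℕ) : ℤ) ∣ D.topForm (bitSeq x) i z

/-- A sum of squares and a nonnegative penalty vanishes only termwise. -/
theorem quad_eq_zero_iff {y : ℕ → ℤ} {ω i z γ : ℕ} : D.quad y ω i z γ = 0 ↔ crosses D.m z = 1 ∧
    ∀ l ∈ range D.k, ∑ j ∈ range D.w, (rem (D.ftop i j) (D.p ω l) : ℤ) * D.bot y j =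
      (rem (D.thtop i z) (D.p ω l) + γ / D.w ^ l % D.w * D.p ω l : ℕ) := by
  have h1 := crosses_le_one D.m z
  have h2 : ∑ l ∈ range D.k, (∑ j ∈ range D.w, (D.bl ω i l j : ℤ) * D.bot y j -
      D.tau ω i z γ l) ^ 2 = 0 ↔ ∀ l ∈ range D.k, _ :=
    sum_eq_zero_iff_of_nonneg fun l _ => sq_nonneg _
  have h3 := sum_nonneg fun l (_ : l ∈ range D.k) => sq_nonneg
    (∑ j ∈ range D.w, (D.bl ω i l j : ℤ) * D.bot y j - D.tau ω i z γ l)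
  simp only [sq_eq_zero_iff, sub_eq_zero] at h2
  simp only [← tau.eq_def, ← bl.eq_def]
  rw [← h2, quad]
  omega

theorem card_ftop_le (i : ℕ) : #{j ∈ range D.w | D.ftop i j ≠ 0} ≤ D.w :=
  (card_filter_le _ _).trans (card_range _).le

/-- Summing over `γ` means summing over each digit independently, so the sum of products becomes a
product of sums (`sum_prod_digits`). Factor `l` is the indicator that the prime `l` divides the top
form, and `Good` says that a nonzero form escapes some prime. -/
theorem sum_quad (hw : 0 < D.w) {ω : ℕ} (hω : D.Good ω) (x : Fin D.n → Bool) {i z : ℕ}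
    (hi : i < D.N) (hz : z < codes D.m) : ∑ γ ∈ range (D.w ^ D.k),
      (if D.quad (bitSeq x) ω i z γ = 0 then 1 else 0 : ℤ) =
      crosses D.m z * if D.topForm (bitSeq x) i z = 0 then 1 else 0 := by
  have h1 : ∀ γ, (if D.quad (bitSeq x) ω i z γ = 0 then 1 else 0 : ℤ) =
      crosses D.m z * ∏ l ∈ range D.k,
        if ∑ j ∈ range D.w, (rem (D.ftop i j) (D.p ω l) : ℤ) * D.bot (bitSeq x) j =
          (rem (D.thtop i z) (D.p ω l) + γ / D.w ^ l % D.w * D.p ω l : ℕ) then 1 else 0 := fun γ => by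
    rw [prod_boole]
    simp only [quad_eq_zero_iff]
    have := crosses_le_one D.m z
    interval_cases crosses D.m z <;> simp
  simp only [h1]
  rw [← mul_sum, sum_prod_digits D.w D.k fun l c =>
    if ∑ j ∈ range D.w, (rem (D.ftop i j) (D.p ω l) : ℤ) * D.bot (bitSeq x) j =
      (rem (D.thtop i z) (D.p ω l) + c * D.p ω l : ℕ) then (1 : ℤ) else 0]
  congr 1
  rw [prod_congr rfl fun l _ => sum_rem_eq (fun j _ => D.bot_zero_or_one j) (D.p_pos ω l) hw
    (D.card_ftop_le i), prod_boole]
  refine if_congr ?_ rfl rfl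
  constructor
  · intro h
    by_contra h0
    obtain ⟨l, hl, hd⟩ := hω x i hi z hz h0
    exact hd (h l (mem_range.2 hl))
  · intro h l _
    rw [topForm] at h
    rw [h]
    exact dvd_zero _

/-- An equality of counts rather than an equivalence: it shows that exactly one subcircuit accepts
when the circuit does, and none otherwise. -/
theorem countP_subs (hw : 0 < D.w) {ω : ℕ} (hω : D.Good ω) (x : Fin D.n → Bool) :
    (((D.subs ω).countP fun s => s.eval x : ℕ) : ℤ) =
      if D.T ≤ ∑ j ∈ range D.w, D.a j * D.bot (bitSeq x) j then 1 else 0 := by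
  have h := thr_eq_sum (m := D.m) (N := D.N) (L := D.w) (w := D.a) (t := D.T)
    (y := D.bot (bitSeq x)) (fun j _ => D.bot_zero_or_one j)
    (by have := card_filter_le (range D.w) (fun j => D.a j ≠ 0); rw [card_range] at this; rw [m]; omega)
    (fun j hj => (abs_lt.1 (D.absSum_bound ((D.abs_le_absSum _
      (.inr ⟨j, hj, .inl le_rfl⟩)).trans (by omega)))).2)
    (abs_lt.1 (D.absSum_bound (abs_sub_one_le (D.abs_le_absSum _ (.inl le_rfl))))).1.le
  rw [← h]
  simp only [subs, List.countP_flatMap, Function.comp_def, sum_map_range, Nat.cast_sum,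
    List.countP_map]
  refine sum_congr rfl fun i hi => sum_congr rfl fun z hz => ?_
  have h2 := D.sum_quad hw hω x (mem_range.1 hi) (mem_range.1 hz)
  simp only [topForm, sub_eq_zero] at h2
  refine Eq.trans ?_ h2
  rw [countP_range]
  simp only [D.eval_sub hw]

/-! ### Most random numbers are good -/

/-- The set of wired variables. -/
def wiredSet (D : Net) : Finset ℕ := {i ∈ range D.n | 0 < ∑ j ∈ range D.w, |D.W j i|}

theorem card_wiredSet : #D.wiredSet = D.wired := by
  rw [wired, ← sum_filter, sum_const, smul_eq_mul, mul_one, wiredSet]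

/-- Only wired variables matter, so the union bound runs over `2 ^ wired` assignments. -/
theorem topForm_congr {y y' : ℕ → ℤ} (h : ∀ i ∈ D.wiredSet, y i = y' i) (i z : ℕ) :
    D.topForm y i z = D.topForm y' i z := by
  rw [topForm, topForm]
  congr 1
  refine sum_congr rfl fun j hj => ?_
  rw [bot, bot, sum_congr rfl fun i hi => ?_]
  by_cases hi' : i ∈ D.wiredSet
  · rw [h i hi']
  · have : D.W j i = 0 := by
      by_contra h0
      exact hi' (mem_filter.2 ⟨hi, sum_pos' (fun _ _ => abs_nonneg _) ⟨j, hj, abs_pos.2 h0⟩⟩)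
    simp [this]

theorem abs_topForm_lt (y : ℕ → ℤ) {i z : ℕ} (hz : z < codes D.m) : |D.topForm y i z| < 2 ^ D.B := by
  refine _root_.abs_form_lt (m := D.m) (N := D.N) (w := D.a) (s := D.T - 1)
    i (fun j _ => D.bot_zero_or_one j) ?_ (fun j hj => ?_) ?_ hz
  · have := card_filter_le (range D.w) (fun j => D.a j ≠ 0)
    rw [card_range] at this
    rw [m]
    omega
  · exact D.absSum_bound ((D.abs_le_absSum _ (.inr ⟨j, hj, .inl le_rfl⟩)).trans (by omega))
  · exact D.absSum_bound (abs_sub_one_le (D.abs_le_absSum _ (.inl le_rfl)))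

/-- Few random numbers are bad for a given nonzero number. -/
theorem card_bad_le {v : ℤ} (h0 : v ≠ 0) (hv : |v| < 2 ^ D.B) :
    #{ω ∈ range ((2 ^ D.b) ^ D.k) | ∀ l < D.k, ((D.p ω l : ℕ) : ℤ) ∣ v} ≤ D.B ^ D.k := by
  -- A number below `(2 ^ b) ^ k` is a string of `k` independent prime indices, so the number of
  -- strings with only bad indices is a `k`-th power.
  have h1 := sum_prod_digits (R := ℕ) (2 ^ D.b) D.k
    fun _ c => if ((Nat.nth Nat.Prime c : ℕ) : ℤ) ∣ v then 1 else 0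
  simp only [prod_boole] at h1
  rw [← sum_filter, sum_const, smul_eq_mul, mul_one, ← sum_filter, sum_const, smul_eq_mul, mul_one,
    prod_const, card_range] at h1
  simp only [p_eq, pow_mul]
  simp only [mem_range] at h1
  rw [h1]
  exact Nat.pow_le_pow_left (card_prime_dvd_le h0 hv) _

/-- Union bound over subsets of wired variables, shifts and codes. The choice of `k` makes `2 ^ (sg
* e * k)` at least three times the number of cases, and `b` leaves `sg * e` bits per prime beyond
the bits of `B`. -/
theorem three_mul_card_not_good_le (he : 0 < D.e) (G : Finset ℕ)
    (hG : ∀ ω ∈ G, ω < (2 ^ D.b) ^ D.k ∧ ¬D.Good ω) : 3 * #G ≤ (2 ^ D.b) ^ D.k := by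
  set Y : Finset ℕ → ℕ → ℤ := fun s i => if i ∈ s then 1 else 0
  set J := D.wiredSet.powerset ×ˢ (range D.N ×ˢ range (codes D.m)) with hJ
  set A : Finset ℕ × ℕ × ℕ → Finset ℕ := fun j => if D.topForm (Y j.1) j.2.1 j.2.2 = 0 then ∅ else
    {ω ∈ range ((2 ^ D.b) ^ D.k) | ∀ l < D.k, ((D.p ω l : ℕ) : ℤ) ∣ D.topForm (Y j.1) j.2.1 j.2.2}
  have h1 : G ⊆ J.biUnion A := fun ω hω => by
    obtain ⟨hlt, hbad⟩ := hG ω hω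
    rw [Good] at hbad
    push Not at hbad
    obtain ⟨x, i, hi, z, hz, hne, hd⟩ := hbad
    have e : D.topForm (bitSeq x) i z =
        D.topForm (Y {i ∈ D.wiredSet | bitSeq x i = 1}) i z := topForm_congr (fun i hi => by
      have := bitSeq_zero_or_one x i
      simp only [Y, mem_filter, hi, true_and]
      split_ifs <;> omega) i z
    refine mem_biUnion.2 ⟨({i ∈ D.wiredSet | bitSeq x i = 1}, i, z), ?_, ?_⟩
    · simp only [hJ, mem_product, mem_powerset, mem_range]
      exact ⟨filter_subset _ _, hi, hz⟩
    · simp only [A]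
      rw [← e, if_neg hne, mem_filter, mem_range]
      exact ⟨hlt, hd⟩
  have h2 : ∀ j ∈ J, #(A j) ≤ D.B ^ D.k := fun j hj => by
    simp only [A]
    split_ifs with h
    · simp
    · simp only [hJ, mem_product, mem_range] at hj
      exact D.card_bad_le h (D.abs_topForm_lt _ hj.2.2)
  have h3 := (card_le_card h1).trans (card_biUnion_le_card_mul J A _ h2)
  rw [hJ, card_product, card_product, card_powerset, card_wiredSet, card_range, card_range] at h3
  have hse : 0 < D.sg * D.e := Nat.mul_pos (Nat.size_pos.2 D.m_pos) he
  have h4 : D.wired + (3 * D.N * codes D.m).size ≤ D.sg * D.e * D.k := by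
    rw [k]
    have := Nat.lt_mul_div_succ (D.wired + (3 * D.N * codes D.m).size) hse
    omega
  calc 3 * #G ≤ 3 * (2 ^ D.wired * (D.N * codes D.m) * D.B ^ D.k) := Nat.mul_le_mul_left _ h3
    _ = 2 ^ D.wired * (3 * D.N * codes D.m) * D.B ^ D.k := by ring
    _ ≤ 2 ^ D.wired * 2 ^ (3 * D.N * codes D.m).size * (2 ^ D.B.size) ^ D.k := by
        gcongr
        · exact (Nat.lt_size_self _).le
        · exact (Nat.lt_size_self _).le
    _ = 2 ^ (D.wired + (3 * D.N * codes D.m).size) * (2 ^ D.B.size) ^ D.k := by rw [pow_add]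
    _ ≤ 2 ^ (D.sg * D.e * D.k) * (2 ^ D.B.size) ^ D.k := by gcongr; norm_num
    _ = (2 ^ (D.sg * D.e + D.B.size)) ^ D.k := by rw [pow_mul, ← mul_pow, ← pow_add]
    _ ≤ _ := by
        gcongr
        · norm_num
        · rw [b]; omega

end Net

/-! ### Random numbers -/

/-- The number whose binary digits are the first `q` coins. -/
def coinNum (ω : ℕ → Bool) : ℕ → ℕ
  | 0 => 0
  | q + 1 => 2 * coinNum ω q + if ω q then 1 else 0

theorem coinNum_lt (ω : ℕ → Bool) (q : ℕ) : coinNum ω q < 2 ^ q := by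
  induction q with
  | zero => simp [coinNum]
  | succ q ih => rw [coinNum, pow_succ]; split_ifs <;> omega

theorem coinNum_congr {ω ω' : ℕ → Bool} {q : ℕ} (h : ∀ i < q, ω i = ω' i) :
    coinNum ω q = coinNum ω' q := by
  induction q with
  | zero => rfl
  | succ q ih => rw [coinNum, coinNum, ih fun i hi => h i (by omega), h q (by omega)]

theorem coinNum_inj {ω ω' : ℕ → Bool} {q : ℕ} (h : coinNum ω q = coinNum ω' q) :
    ∀ i < q, ω i = ω' i := by
  induction q with
  | zero => simp
  | succ q ih =>
    rw [coinNum, coinNum] at h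
    intro i hi
    rcases Nat.lt_succ_iff_lt_or_eq.1 hi with hi | rfl
    · exact ih (by split_ifs at h <;> omega) i hi
    · cases h1 : ω i <;> cases h2 : ω' i <;> simp [h1, h2] at h ⊢ <;> omega

/-- The coins determine a uniformly distributed number. -/
theorem card_coinNum_eq {q v : ℕ} (T : ℕ) (hv : v < 2 ^ q) :
    #{r : Fin (q + T) → Bool | coinNum (extendCoins r) q = v} = 2 ^ T := by
  set f : (Fin q → Bool) → Fin (2 ^ q) := fun r => ⟨coinNum (extendCoins r) q, coinNum_lt _ _⟩
  have hf : Function.Injective f := fun r r' h => by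
    funext i
    have := coinNum_inj (Fin.mk.inj_iff.1 h) i i.2
    simpa [extendCoins] using this
  have hbij : Function.Bijective f :=
    (Fintype.bijective_iff_injective_and_card f).2 ⟨hf, by simp⟩
  obtain ⟨r₀, hr₀⟩ := hbij.2 ⟨v, hv⟩
  have hr₀ : coinNum (extendCoins r₀) q = v := by simpa [f] using hr₀
  have key : ∀ r : Fin (q + T) → Bool, coinNum (extendCoins r) q = v ↔
      ∀ i : Fin q, r (Fin.castAdd T i) = r₀ i := fun r => by
    rw [← hr₀]
    constructor
    · intro h i
      have := coinNum_inj h i i.2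
      have hi : (i : ℕ) < q + T := by omega
      simp only [extendCoins, hi, i.2, dif_pos] at this
      exact this
    · intro h
      refine coinNum_congr fun i hi => ?_
      have := h ⟨i, hi⟩
      have hi' : i < q + T := by omega
      simpa [extendCoins, hi, hi'] using this
  rw [show #{r : Fin (q + T) → Bool | coinNum (extendCoins r) q = v} =
    #(univ : Finset (Fin T → Bool)) from ?_]
  · simp
  symm
  refine card_bij (fun s _ => Fin.append r₀ s) (fun s _ => ?_) (fun s _ s' _ h => ?_) fun r hr => ?_
  · rw [mem_filter, key]
    exact ⟨mem_univ _, fun i => Fin.append_left _ _ _⟩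
  · funext i
    have := congrFun h (Fin.natAdd q i)
    simpa using this
  · rw [mem_filter, key] at hr
    refine ⟨fun i => r (Fin.natAdd q i), mem_univ _, ?_⟩
    funext i
    refine Fin.addCases (fun i => ?_) (fun i => ?_) i
    · rw [Fin.append_left, hr.2]
    · rw [Fin.append_right]

theorem card_coinNum_mem {q : ℕ} (T : ℕ) {G : Finset ℕ} (hG : ∀ v ∈ G, v < 2 ^ q) :
    #{r : Fin (q + T) → Bool | coinNum (extendCoins r) q ∈ G} = #G * 2 ^ T := by
  rw [card_eq_sum_card_fiberwise (t := G) (f := fun r => coinNum (extendCoins r) q)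
    fun r hr => by simpa using hr, ← smul_eq_mul, ← sum_const]
  refine sum_congr rfl fun v hv => ?_
  rw [← card_coinNum_eq T (hG v hv), filter_filter]
  congr 1
  ext r
  simp only [mem_filter, mem_univ, true_and, and_iff_right_iff_imp]
  rintro rfl
  exact hv

end Correctness

/-! ### The circuits and their descriptions -/

/-- The data of a circuit that is described by a list of integers. -/
def Net.ofInput (I : List ℤ) : Net where
  e := (I.getD 0 0).toNat
  n := (I.getD 1 0).toNat
  w := (I.getD 2 0).toNat
  T := I.getD 3 0
  a j := I.getD (4 + j) 0
  t j := I.getD (4 + (I.getD 2 0).toNat + j * ((I.getD 1 0).toNat + 1)) 0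
  W j i := I.getD (4 + (I.getD 2 0).toNat + j * ((I.getD 1 0).toNat + 1) + 1 + i) 0

theorem getD_flatten {ℓ : ℕ} (L : List (List ℤ)) (h : ∀ l ∈ L, l.length = ℓ) {j r : ℕ}
    (hj : j < L.length) (hr : r < ℓ) : L.flatten.getD (j * ℓ + r) 0 = L[j].getD r 0 := by
  induction L generalizing j with
  | nil => simp at hj
  | cons l L ih =>
    have hl := h l (by simp)
    rw [List.flatten_cons]
    cases j with
    | zero => rw [zero_mul, zero_add, List.getD_append _ _ _ _ (by omega)]; rfl
    | succ j =>
      rw [List.getD_append_right _ _ _ _ (by rw [hl, add_mul]; omega),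
        show (j + 1) * ℓ + r - l.length = j * ℓ + r by rw [hl, add_mul]; omega,
        ih (fun l hl => h l (by simp [hl])) (by simpa using hj)]
      rfl

/-- An input of the main program with at least one bottom gate. -/
structure Inst where
  s : ℕ
  n : ℕ
  k : ℕ
  e : ℕ
  c : ThrThr ℤ n
  two_le_e : 2 ≤ e
  size_le : c.size ≤ s
  width_pos : 0 < c.width
  weightsLE : c.WeightsLE (k * s ^ k)

namespace Inst

open Finset

variable (i : Inst)

def inp : List ℤ := (i.e : ℤ) :: i.c.encode

def net : Net := Net.ofInput i.inp

@[simp] theorem net_e : i.net.e = i.e := rfl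

@[simp] theorem net_n : i.net.n = i.n := rfl

@[simp] theorem net_w : i.net.w = i.c.width := rfl

@[simp] theorem net_T : i.net.T = i.c.top.threshold := rfl

theorem inp_eq : i.inp = (i.e : ℤ) :: (i.n : ℤ) :: (i.c.width : ℤ) :: i.c.top.threshold ::
    (List.ofFn i.c.top.weight ++ (List.ofFn fun j => (i.c.bottom j).encode).flatten) := rfl

theorem net_a (j : Fin i.c.width) : i.net.a j = i.c.top.weight j := by
  change i.inp.getD (4 + j) 0 = _
  rw [inp_eq, add_comm]
  simp only [List.getD_cons_succ]
  rw [List.getD_append _ _ _ _ (by simp), List.getD_eq_getElem _ _ (by simp)]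
  simp

theorem getD_bottom (j : Fin i.c.width) {r : ℕ} (hr : r < i.n + 1) :
    i.inp.getD (4 + i.c.width + j * (i.n + 1) + r) 0 = (i.c.bottom j).encode.getD r 0 := by
  rw [inp_eq, show 4 + i.c.width + j * (i.n + 1) + r =
    (i.c.width + (j * (i.n + 1) + r)) + 4 by omega]
  simp only [List.getD_cons_succ]
  rw [List.getD_append_right _ _ _ _ (by simp), List.length_ofFn, Nat.add_sub_cancel_left,
    getD_flatten _ (fun l hl => ?_) (by simp) hr]
  · simp
  · obtain ⟨j, rfl⟩ := List.mem_ofFn.1 hl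
    simp [ThrGate.encode]

theorem net_t (j : Fin i.c.width) : i.net.t j = (i.c.bottom j).threshold :=
  i.getD_bottom j (r := 0) (by omega)

theorem net_W (j : Fin i.c.width) (ι : Fin i.n) : i.net.W j ι = (i.c.bottom j).weight ι := by
  have := i.getD_bottom j (r := 1 + ι) (by omega)
  rw [← add_assoc] at this
  refine Eq.trans this ?_
  rw [ThrGate.encode, add_comm, List.getD_cons_succ, List.getD_eq_getElem _ _ (by simp)]
  simp

theorem wired_eq : i.net.wired = {ι : Fin i.n | ∃ j, (i.c.bottom j).weight ι ≠ 0}.ncard := by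
  rw [Net.wired, net_n, sum_range fun ι => if 0 < ∑ j ∈ range i.net.w, |i.net.W j ι| then 1 else 0,
    Set.ncard_eq_toFinset_card', ← sum_filter, sum_const, smul_eq_mul, mul_one]
  congr 1
  ext ι
  simp only [mem_filter, mem_univ, true_and, Set.mem_toFinset, Set.mem_ofPred_eq]
  rw [net_w, sum_range]
  simp only [net_W]
  constructor
  · intro h
    by_contra! h0
    simp [h0] at h
  · rintro ⟨j, hj⟩
    exact sum_pos' (fun _ _ => abs_nonneg _) ⟨j, mem_univ _, abs_pos.2 hj⟩

theorem m_le : i.net.m ≤ i.s := by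
  refine le_trans (le_of_eq ?_) i.size_le
  rw [Net.m, wired_eq, ThrThr.size, net_w]
  omega

theorem two_le_s : 2 ≤ i.s := by
  have := i.m_le
  have := i.width_pos
  rw [Net.m, net_w] at *
  omega

theorem wired_le_n : i.net.wired ≤ i.n := by
  rw [Net.wired, net_n, ← sum_filter, sum_const, smul_eq_mul, mul_one]
  exact (card_filter_le _ _).trans (card_range _).le

theorem abs_T_le : |i.net.T| ≤ 2 ^ (i.k * i.s ^ i.k) := i.weightsLE.1.1

theorem abs_a_le {j : ℕ} (hj : j < i.net.w) : |i.net.a j| ≤ 2 ^ (i.k * i.s ^ i.k) := by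
  have := i.net_a ⟨j, hj⟩
  dsimp only at this
  rw [this]
  exact i.weightsLE.1.2 _

theorem abs_t_le {j : ℕ} (hj : j < i.net.w) : |i.net.t j| ≤ 2 ^ (i.k * i.s ^ i.k) := by
  have := i.net_t ⟨j, hj⟩
  dsimp only at this
  rw [this]
  exact (i.weightsLE.2 _).1

theorem abs_W_le {j ι : ℕ} (hj : j < i.net.w) (hι : ι < i.net.n) :
    |i.net.W j ι| ≤ 2 ^ (i.k * i.s ^ i.k) := by
  have := i.net_W ⟨j, hj⟩ ⟨ι, hι⟩
  dsimp only at this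
  rw [this]
  exact (i.weightsLE.2 _).2 _

theorem absSum_le : i.net.absSum + 1 ≤
    2 ^ (i.k * i.s ^ i.k) * (2 + i.net.w * (2 + i.net.wired) : ℕ) := by
  set M : ℤ := 2 ^ (i.k * i.s ^ i.k) with hM
  have hM1 : 1 ≤ M := one_le_pow₀ (by norm_num)
  have h1 : ∀ j ∈ range i.net.w, |i.net.a j| + |i.net.t j| + ∑ ι ∈ range i.net.n, |i.net.W j ι| ≤
      M * (2 + i.net.wired) := fun j hj => by
    have hj := mem_range.1 hj
    have h2 : ∑ ι ∈ range i.net.n, |i.net.W j ι| ≤ i.net.wired * M := by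
      -- Unwired variables are discarded, since the bound has to involve `wired` and not `n`, which
      -- may be much larger than `s`.
      rw [← sum_filter_of_ne (p := fun ι => i.net.W j ι ≠ 0) fun ι _ h h' => h (by simp [h'])]
      refine (sum_le_card_nsmul _ _ M fun ι hι =>
        i.abs_W_le hj (mem_range.1 (mem_filter.1 hι).1)).trans ?_
      rw [nsmul_eq_mul]
      have := i.net.card_wired_le hj
      gcongr
    have h3 := i.abs_a_le hj
    have h4 := i.abs_t_le hj
    rw [← hM] at h3 h4
    linarith
  have h5 := sum_le_card_nsmul _ _ _ h1
  rw [card_range, nsmul_eq_mul] at h5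
  have h6 := i.abs_T_le
  rw [Net.absSum]
  push_cast
  rw [← hM] at h6
  linarith

theorem N_le : i.net.N ≤ i.k * i.s ^ i.k + (i.s + 1) * (2 + i.s * (2 + i.s)) := by
  have h0 : 0 ≤ i.net.absSum := by
    have := i.net.abs_le_absSum 0 (.inl (by simp))
    simpa using this
  rw [Net.N, Nat.size_le]
  have hw : i.net.w ≤ i.s := le_trans (by rw [Net.m]; omega) i.m_le
  have hwi : i.net.wired ≤ i.s := le_trans (by rw [Net.m]; omega) i.m_le
  have h1 : ((i.net.m + 1) * (i.net.absSum + 1) : ℤ) ≤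
      ((i.s + 1) * (2 ^ (i.k * i.s ^ i.k) * (2 + i.s * (2 + i.s))) : ℕ) := by
    have hm := i.m_le
    push_cast
    refine mul_le_mul (by omega) (i.absSum_le.trans ?_) (by omega) (by positivity)
    push_cast
    gcongr
  have h2 : ((i.net.m + 1) * (i.net.absSum + 1) : ℤ).natAbs ≤
      (i.s + 1) * (2 ^ (i.k * i.s ^ i.k) * (2 + i.s * (2 + i.s))) := by
    have : (0 : ℤ) ≤ (i.net.m + 1) * (i.net.absSum + 1) := by positivity
    omega
  refine h2.trans_lt ?_
  rw [pow_add, mul_left_comm]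
  exact Nat.mul_lt_mul_of_pos_left Nat.lt_two_pow_self (by positivity)

/-! ### Bounds for the parameters -/

theorem poly_s : PolyLe Inst.s Inst.k Inst.s := PolyLe.self

theorem poly_w : PolyLe Inst.s Inst.k fun i => i.net.w :=
  poly_s.mono fun i => le_trans (by rw [Net.m]; omega) i.m_le

theorem poly_wired : PolyLe Inst.s Inst.k fun i => i.net.wired :=
  poly_s.mono fun i => le_trans (by rw [Net.m]; omega) i.m_le

theorem poly_m : PolyLe Inst.s Inst.k fun i => i.net.m := poly_s.mono m_le

theorem poly_const (c : ℕ) : PolyLe Inst.s Inst.k fun _ => c := PolyLe.const two_le_s c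

theorem poly_bits : PolyLe Inst.s Inst.k fun i => i.k * i.s ^ i.k :=
  (PolyLe.ofPar two_le_s fun k => k).mul (poly_s.powPar fun k => k)

theorem poly_N : PolyLe Inst.s Inst.k fun i => i.net.N :=
  (poly_bits.add two_le_s ((poly_s.add two_le_s (poly_const 1)).mul
    ((poly_const 2).add two_le_s (poly_s.mul ((poly_const 2).add two_le_s poly_s))))).mono N_le

theorem poly_codes : PolyLe Inst.s Inst.k fun i => codes i.net.m := by
  unfold codes
  exact (((poly_const 2).mul poly_m).add two_le_s (poly_const 1)).mul
    (((poly_const 3).mul poly_m).add two_le_s (poly_const 1))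

theorem poly_B : PolyLe Inst.s Inst.k fun i => i.net.B := poly_N.add two_le_s poly_codes

theorem two_pow_size_le {v : ℕ} (hv : 0 < v) : 2 ^ v.size ≤ 2 * v := by
  have h : 0 < v.size := Nat.size_pos.2 hv
  have : 2 ^ (v.size - 1) ≤ v := Nat.lt_size.1 (by omega)
  calc 2 ^ v.size = 2 * 2 ^ (v.size - 1) := by rw [← pow_succ']; congr 1; omega
    _ ≤ 2 * v := Nat.mul_le_mul_left _ this

theorem size_le_self (v : ℕ) : v.size ≤ v := Nat.size_le.2 Nat.lt_two_pow_self

theorem poly_sg : PolyLe Inst.s Inst.k fun i => i.net.sg := poly_m.mono fun _ => size_le_self _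

theorem poly_k : PolyLe Inst.s Inst.k fun i => i.net.k :=
  ((poly_wired.add two_le_s (((poly_const 3).mul poly_N).mul poly_codes)).add two_le_s
    (poly_const 1)).mono fun i => by
      rw [Net.k]
      have := size_le_self (3 * i.net.N * codes i.net.m)
      have := Nat.div_le_self (i.net.wired + (3 * i.net.N * codes i.net.m).size)
        (i.net.sg * i.net.e)
      omega

theorem poly_U : PolyLe Inst.s Inst.k fun i => i.net.U := poly_w.mul (poly_N.mul poly_codes)

/-- The budget for the subcircuits. -/
def Y : ℕ := i.s ^ i.e

theorem s_le_Y : i.s ≤ i.Y := Nat.le_self_pow (by have := i.two_le_e; omega) _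

theorem two_le_Y : 2 ≤ i.Y := i.two_le_s.trans i.s_le_Y

theorem polyY_s : PolyLe Inst.Y Inst.k Inst.s := PolyLe.self.mono s_le_Y

theorem polyY_const (c : ℕ) : PolyLe Inst.Y Inst.k fun _ => c := PolyLe.const two_le_Y c

theorem polyY_e : PolyLe Inst.Y Inst.k Inst.e := PolyLe.self.mono fun i =>
  Nat.lt_two_pow_self.le.trans (Nat.pow_le_pow_left i.two_le_s _)

theorem B_pos : 0 < i.net.B := by
  rw [Net.B, codes]
  positivity

/-- Here `2 ^ sg ≤ 2 * m ≤ s ^ 2`, so the power is at most `Y ^ 2`. This keeps the random primes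
within `s ^ O(e)`. -/
theorem polyY_two_pow_sg_e : PolyLe Inst.Y Inst.k fun i => 2 ^ (i.net.sg * i.net.e) :=
  (PolyLe.self.mul PolyLe.self).mono fun i => by
    rw [Y, ← mul_pow, pow_mul]
    refine Nat.pow_le_pow_left ((two_pow_size_le i.net.m_pos).trans ?_) _
    exact Nat.mul_le_mul i.two_le_s i.m_le

theorem polyY_b : PolyLe Inst.Y Inst.k fun i => i.net.b :=
  (((poly_B.trans polyY_s).add two_le_Y ((poly_sg.trans polyY_s).mul polyY_e)).add two_le_Y
    (polyY_const 3)).mono fun i => by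
      rw [Net.b]
      have := size_le_self i.net.B
      simp only [net_e]
      omega

theorem polyY_two_pow_b : PolyLe Inst.Y Inst.k fun i => 2 ^ i.net.b :=
  ((((polyY_const 2).mul (poly_B.trans polyY_s)).mul polyY_two_pow_sg_e).mul
    (polyY_const (2 ^ 3))).mono fun i => by
      rw [Net.b, pow_add, pow_add]
      gcongr
      exact two_pow_size_le i.B_pos

theorem polyY_P : PolyLe Inst.Y Inst.k fun i => i.net.P :=
  (polyY_two_pow_b.mul polyY_two_pow_b).mono fun i => by
    rw [Net.P, ← mul_pow]
    norm_num

theorem polyY_m : PolyLe Inst.Y Inst.k fun i => i.net.m := poly_m.trans polyY_s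

theorem polyY_k : PolyLe Inst.Y Inst.k fun i => i.net.k := poly_k.trans polyY_s

theorem polyY_U : PolyLe Inst.Y Inst.k fun i => i.net.U := poly_U.trans polyY_s

theorem polyY_Hb : PolyLe Inst.Y Inst.k fun i => i.net.Hb :=
  (((polyY_const 2).mul polyY_k).mul polyY_m).mul (polyY_P.pow two_le_Y 2)

theorem polyY_R : PolyLe Inst.Y Inst.k fun i => i.net.R :=
  ((((polyY_const 2).mul (polyY_U.pow two_le_Y 2)).mul polyY_Hb).mul
    (poly_B.trans polyY_s)).add two_le_Y (polyY_const 1)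

/-- A bound on the primes that are averaged over. -/
theorem polyY_Q : PolyLe Inst.Y Inst.k fun i => 4 ^ (i.net.R.size + 3) :=
  ((((polyY_const 2).mul polyY_R).pow two_le_Y 2).mul (polyY_const (4 ^ 3))).mono fun i => by
    rw [pow_add, show (4 : ℕ) ^ i.net.R.size = (2 ^ i.net.R.size) ^ 2 by
      rw [← pow_mul, mul_comm, pow_mul]; norm_num]
    gcongr
    exact two_pow_size_le (by rw [Net.R]; omega)

/-- The budget for the running time. -/
def X : ℕ := i.Y * 2 ^ (i.n / i.e + 1)

theorem Y_le_X : i.Y ≤ i.X := Nat.le_mul_of_pos_right _ (by positivity)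

theorem two_le_X : 2 ≤ i.X := i.two_le_Y.trans i.Y_le_X

theorem polyX_Y : PolyLe Inst.X Inst.k Inst.Y := PolyLe.self.mono Y_le_X

/-- Reading all weights takes time depending on `n`, which `s` does not bound; the factor `2 ^ (n /
e + 1)` of the time budget does, up to a factor `e`. -/
theorem polyX_n : PolyLe Inst.X Inst.k Inst.n := PolyLe.self.mono fun i => by
  have h1 : i.n ≤ i.e * (i.n / i.e + 1) :=
    (Nat.lt_mul_div_succ _ (by have := i.two_le_e; omega)).le
  refine h1.trans (Nat.mul_le_mul ?_ Nat.lt_two_pow_self.le)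
  exact Nat.lt_two_pow_self.le.trans (Nat.pow_le_pow_left i.two_le_s _)

/-- The number of branches is small. -/
theorem w_pow_k_le : i.net.w ^ i.net.k ≤
    2 ^ (i.n / i.e + 1) * (2 ^ (3 * i.net.N * codes i.net.m).size * 2 ^ i.net.sg) := by
  have h1 : i.net.w ≤ 2 ^ i.net.sg :=
    le_trans (by rw [Net.m]; omega) (Nat.lt_size_self i.net.m).le
  refine (Nat.pow_le_pow_left h1 _).trans ?_
  rw [← pow_mul, ← pow_add, ← pow_add]
  refine Nat.pow_le_pow_right (by norm_num) ?_
  have he := i.two_le_e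
  rw [Net.k, mul_add, mul_one, ← add_assoc]
  refine Nat.add_le_add_right ?_ _
  calc i.net.sg * ((i.net.wired + (3 * i.net.N * codes i.net.m).size) / (i.net.sg * i.net.e))
      ≤ (i.net.wired + (3 * i.net.N * codes i.net.m).size) / i.e := by
        rw [mul_comm i.net.sg i.net.e, ← Nat.div_div_eq_div_mul, net_e]
        exact Nat.mul_div_le _ _
    -- Enlarging the logarithmic term by the factor `e` lets it leave the quotient intact, as a
    -- polynomial factor.
    _ ≤ (i.n + i.e * (3 * i.net.N * codes i.net.m).size) / i.e := by
        refine Nat.div_le_div_right (Nat.add_le_add i.wired_le_n ?_)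
        exact Nat.le_mul_of_pos_left _ (by omega)
    _ = i.n / i.e + (3 * i.net.N * codes i.net.m).size := Nat.add_mul_div_left _ _ (by omega)
    _ ≤ _ := by omega

theorem poly_branches : PolyLe Inst.s Inst.k
    fun i => 2 ^ (3 * i.net.N * codes i.net.m).size * 2 ^ i.net.sg :=
  ((((poly_const 2).mul (((poly_const 3).mul poly_N).mul poly_codes)).add two_le_s
    (poly_const 1)).mul ((poly_const 2).mul poly_m)).mono fun i => by
      refine Nat.mul_le_mul ?_ (two_pow_size_le i.net.m_pos)
      rcases Nat.eq_zero_or_pos (3 * i.net.N * codes i.net.m) with h | h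
      · simp [h]
      · exact (two_pow_size_le h).trans (Nat.le_succ _)

theorem polyX_w_pow_k : PolyLe Inst.X Inst.k fun i => i.net.w ^ i.net.k :=
  (PolyLe.self.mul ((poly_branches.trans polyY_s).trans polyX_Y)).mono fun i =>
    i.w_pow_k_le.trans (Nat.mul_le_mul_right _
      (Nat.le_mul_of_pos_left _ (by have := i.two_le_Y; omega)))

end Inst

/-! ### Computing the parameters -/

namespace Inst

variable (i : Inst)

theorem abs_inp_le (v : ℤ) (hv : v ∈ i.inp) :
    |v| ≤ 2 ^ (i.k * i.s ^ i.k + (i.e + (i.n + i.c.width))) := by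
  have h1 : ∀ x ≤ i.e + (i.n + i.c.width),
      |(x : ℤ)| ≤ 2 ^ (i.k * i.s ^ i.k + (i.e + (i.n + i.c.width))) := fun x hx => by
    rw [Nat.abs_cast]
    have : x ≤ 2 ^ (i.k * i.s ^ i.k + (i.e + (i.n + i.c.width))) :=
      Nat.lt_two_pow_self.le.trans (Nat.pow_le_pow_right (by norm_num) (by omega))
    exact_mod_cast this
  have h2 : ∀ v : ℤ, |v| ≤ 2 ^ (i.k * i.s ^ i.k) →
      |v| ≤ 2 ^ (i.k * i.s ^ i.k + (i.e + (i.n + i.c.width))) := fun v hv =>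
    hv.trans (pow_le_pow_right₀ (by norm_num) (by omega))
  rw [inp_eq] at hv
  simp only [List.mem_cons, List.mem_append, List.mem_flatten] at hv
  rcases hv with rfl | rfl | rfl | rfl | hv | ⟨l, hl, hv⟩
  · exact h1 _ (by omega)
  · exact h1 _ (by omega)
  · exact h1 _ (by omega)
  · exact h2 _ i.weightsLE.1.1
  · obtain ⟨j, rfl⟩ := List.mem_ofFn.1 hv
    exact h2 _ (i.weightsLE.1.2 j)
  · obtain ⟨j, rfl⟩ := List.mem_ofFn.1 hl
    rw [ThrGate.encode, List.mem_cons] at hv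
    rcases hv with rfl | hv
    · exact h2 _ (i.weightsLE.2 j).1
    · obtain ⟨ι, rfl⟩ := List.mem_ofFn.1 hv
      exact h2 _ ((i.weightsLE.2 j).2 ι)

theorem polyX_s : PolyLe Inst.X Inst.k Inst.s := polyY_s.trans polyX_Y

end Inst

/-- The inputs of the main program, each with a random number in cell `0`. -/
def mainFam : Fam where
  I := Σ i : Inst, Fin ((2 ^ i.net.b) ^ i.net.k)
  inp x := x.1.inp
  X x := x.1.X
  par x := x.1.k
  base x := (x.2 : ℕ)
  two_le_X x := x.1.two_le_X
  bit_inp := by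
    have h : PolyLe Inst.X Inst.k fun i => i.k * i.s ^ i.k + (i.e + (i.n + i.c.width)) + 1 :=
      ((Inst.poly_bits.trans Inst.polyX_s).add Inst.two_le_X
        ((Inst.polyY_e.trans Inst.polyX_Y).add Inst.two_le_X (Inst.polyX_n.add Inst.two_le_X
          (Inst.poly_w.trans Inst.polyX_s)))).add Inst.two_le_X (PolyLe.const Inst.two_le_X 1)
    obtain ⟨C, hC⟩ := h
    refine ⟨C, fun x j => (Nat.size_le.2 ?_).trans (hC x.1)⟩
    have h1 : |x.1.inp.getD j 0| ≤
        2 ^ (x.1.k * x.1.s ^ x.1.k + (x.1.e + (x.1.n + x.1.c.width))) := by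
      rcases lt_or_ge j x.1.inp.length with hj | hj
      · rw [List.getD_eq_getElem _ _ hj]
        exact x.1.abs_inp_le _ (List.getElem_mem _)
      · rw [List.getD_eq_default _ _ hj, abs_zero]
        positivity
    rw [Int.abs_eq_natAbs] at h1
    have h2 : (x.1.inp.getD j 0).natAbs ≤
        2 ^ (x.1.k * x.1.s ^ x.1.k + (x.1.e + (x.1.n + x.1.c.width))) := by exact_mod_cast h1
    exact lt_of_le_of_lt h2 (Nat.pow_lt_pow_right (by norm_num) (Nat.lt_succ_self _))
  bit_base := by
    have h : PolyLe Inst.X Inst.k fun i => i.net.b * i.net.k :=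
      (Inst.polyY_b.trans Inst.polyX_Y).mul (Inst.polyY_k.trans Inst.polyX_Y)
    obtain ⟨C, hC⟩ := h
    refine ⟨C, fun x => (Nat.size_le.2 ?_).trans (hC x.1)⟩
    rw [pow_mul]
    simp

section Compute

variable {β : Type} {Γ : Ctx mainFam β}

theorem Ctx.Poly.of_inst {f : Inst → ℕ} (h : PolyLe Inst.X Inst.k f) :
    Γ.Poly fun b => f (Γ.inst b).1 := PolyLe.comp h fun b => (Γ.inst b).1

theorem Ctx.Poly.of_instY {f : Inst → ℕ} (h : PolyLe Inst.Y Inst.k f) :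
    Γ.Poly fun b => f (Γ.inst b).1 := .of_inst (h.trans Inst.polyX_Y)

theorem CZ.readNat {j : β → ℕ} (hj : CN Γ j) : CZ Γ fun b => (Γ.inst b).1.inp.getD (j b) 0 :=
  hj.toCZ.read

/-! Lemmas on functions that are not tied to the input. -/

theorem CN.crosses {m z : β → ℕ} (hm : CN Γ m) (hz : CN Γ z) :
    CN Γ fun b => crosses (m b) (z b) :=
  have hK := ((CN.const 2).mul hm).add (CN.const 1)
  CN.ite (((hm.add (CN.const 1)).le (hz.div hK)).and ((hz.div hK).le (hm.add (hz.mod hK))))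
    (CN.const 1) (CN.const 0)

theorem CN.codes {m : β → ℕ} (hm : CN Γ m) : CN Γ fun b => codes (m b) :=
  (((CN.const 2).mul hm).add (CN.const 1)).mul (((CN.const 3).mul hm).add (CN.const 1))

theorem CZ.phi {m i : β → ℕ} {v : β → ℤ} (hm : CN Γ m) (hv : CZ Γ v) (hi : CN Γ i) :
    CZ Γ fun b => phi (m b) (v b) (i b) :=
  ((((CZ.const 2).mul hm.toCZ).add (CZ.const 1)).mul (hv.shr hi)).add (hv.shr hi).lowBit

theorem CN.properDivs {x : β → ℕ} (hx : CN Γ x) : CN Γ fun b => properDivs (x b) :=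
  CN.sum hx fun _ _ => CN.ite ((hx.lift.mod (CN.idx hx)).eq (CN.const 0))
    (CN.const 1) (CN.const 0)

theorem CN.primesUpTo {x : β → ℕ} (hx : CN Γ x) : CN Γ fun b => primesUpTo (x b) :=
  have hx1 := hx.add (CN.const 1)
  CN.sum hx1 fun _ _ => CN.ite ((CN.properDivs (CN.idx hx1)).eq (CN.const 1))
    (CN.const 1) (CN.const 0)

theorem CN.primeBelow {M r : β → ℕ} (hM : CN Γ M) (hr : CN Γ r) :
    CN Γ fun b => primeBelow (M b) (r b) :=
  CN.sum hM fun _ _ => CN.ite ((CN.primesUpTo (CN.idx hM)).le hr.lift) (CN.const 1) (CN.const 0)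

/-! The data of the circuit. -/

theorem CN.net_e : CN Γ fun b => (Γ.inst b).1.net.e :=
  CN.of_toNat (CZ.readNat (CN.const 0)) (.of_instY Inst.polyY_e)

theorem CN.net_n : CN Γ fun b => (Γ.inst b).1.net.n :=
  CN.of_toNat (CZ.readNat (CN.const 1)) (.of_inst Inst.polyX_n)

theorem CN.net_w : CN Γ fun b => (Γ.inst b).1.net.w :=
  CN.of_toNat (CZ.readNat (CN.const 2)) (.of_inst (Inst.poly_w.trans Inst.polyX_s))

theorem CZ.net_T : CZ Γ fun b => (Γ.inst b).1.net.T := CZ.readNat (CN.const 3)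

theorem CZ.net_a {j : β → ℕ} (hj : CN Γ j) : CZ Γ fun b => (Γ.inst b).1.net.a (j b) :=
  CZ.readNat ((CN.const 4).add hj)

theorem CZ.net_t {j : β → ℕ} (hj : CN Γ j) : CZ Γ fun b => (Γ.inst b).1.net.t (j b) :=
  CZ.readNat (((CN.const 4).add CN.net_w).add (hj.mul (CN.net_n.add (CN.const 1))))

theorem CZ.net_W {j i : β → ℕ} (hj : CN Γ j) (hi : CN Γ i) :
    CZ Γ fun b => (Γ.inst b).1.net.W (j b) (i b) :=
  CZ.readNat (((((CN.const 4).add CN.net_w).add (hj.mul (CN.net_n.add (CN.const 1)))).add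
    (CN.const 1)).add hi)

theorem CN.net_wired : CN Γ fun b => (Γ.inst b).1.net.wired :=
  CN.sum CN.net_n fun _ _ => CN.ite (CB.lt (CZ.const 0) (CZ.sum CN.net_w fun _ _ =>
    (CZ.net_W (CN.idx CN.net_w) (CN.idx CN.net_n).lift).abs)) (CN.const 1) (CN.const 0)

theorem CN.net_m : CN Γ fun b => (Γ.inst b).1.net.m :=
  (CN.net_w.add CN.net_wired).add (CN.const 1)

theorem CZ.net_absSum : CZ Γ fun b => (Γ.inst b).1.net.absSum :=
  CZ.net_T.abs.add (CZ.sum CN.net_w fun _ _ =>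
    ((CZ.net_a (CN.idx CN.net_w)).abs.add (CZ.net_t (CN.idx CN.net_w)).abs).add
      (CZ.sum CN.net_n fun _ _ => (CZ.net_W (CN.idx CN.net_w).lift (CN.idx CN.net_n)).abs))

theorem CN.net_N : CN Γ fun b => (Γ.inst b).1.net.N :=
  ((CN.net_m.toCZ.add (CZ.const 1)).mul (CZ.net_absSum.add (CZ.const 1))).size

theorem CN.net_codes : CN Γ fun b => _root_.codes (Γ.inst b).1.net.m := CN.codes CN.net_m

theorem CN.net_B : CN Γ fun b => (Γ.inst b).1.net.B := CN.net_N.add CN.net_codes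

theorem CN.net_sg : CN Γ fun b => (Γ.inst b).1.net.sg := CN.net_m.size

theorem CN.net_b : CN Γ fun b => (Γ.inst b).1.net.b :=
  (CN.net_B.size.add (CN.net_sg.mul CN.net_e)).add (CN.const 3)

theorem CN.net_k : CN Γ fun b => (Γ.inst b).1.net.k :=
  ((CN.net_wired.add (((CN.const 3).mul CN.net_N).mul CN.net_codes).size).div
    (CN.net_sg.mul CN.net_e)).add (CN.const 1)

theorem CN.net_P : CN Γ fun b => (Γ.inst b).1.net.P :=
  (CN.const 4).pow CN.net_b (.of_instY Inst.polyY_P)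

theorem CN.net_U : CN Γ fun b => (Γ.inst b).1.net.U := CN.net_w.mul (CN.net_N.mul CN.net_codes)

theorem CN.net_Hb : CN Γ fun b => (Γ.inst b).1.net.Hb :=
  (((CN.const 2).mul CN.net_k).mul CN.net_m).mul CN.net_P.sq

theorem CN.net_R : CN Γ fun b => (Γ.inst b).1.net.R :=
  ((((CN.const 2).mul CN.net_U.sq).mul CN.net_Hb).mul CN.net_B).add (CN.const 1)

theorem CN.net_q {r : β → ℕ} (hr : CN Γ r) : CN Γ fun b => (Γ.inst b).1.net.q (r b) := by
  have h : Γ.Poly fun b => 4 ^ ((Γ.inst b).1.net.R.size + 3) :=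
    .of_instY (f := fun i => 4 ^ (i.net.R.size + 3)) Inst.polyY_Q
  unfold Net.q
  exact CN.primeBelow ((CN.const 4).pow (CN.net_R.size.add (CN.const 3)) h) hr

/-- The digit is extracted by a shift and a remainder of long integers: the random number has
polynomial length, but its value is not polynomial. -/
theorem CN.net_p {l : β → ℕ} (hl : CN Γ l) :
    CN Γ fun b => (Γ.inst b).1.net.p (Γ.inst b).2 (l b) := by
  refine CN.primeBelow CN.net_P ((CZ.emod (CZ.base.shr (CN.net_b.mul hl))
    ((CN.const 2).pow CN.net_b (.of_instY Inst.polyY_two_pow_b)) fun b => by positivity).congr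
      fun b => ?_)
  change _ = ((((Γ.inst b).2 : ℕ) : ℤ) / 2 ^ _ % _).toNat
  have : ((((Γ.inst b).2 : ℕ) : ℤ) / 2 ^ ((Γ.inst b).1.net.b * l b) %
      (2 ^ (Γ.inst b).1.net.b : ℕ)) =
    ((((Γ.inst b).2 : ℕ) / 2 ^ ((Γ.inst b).1.net.b * l b) % 2 ^ (Γ.inst b).1.net.b : ℕ) : ℤ) := by
    push_cast
    rfl
  rw [this, Int.toNat_natCast]

theorem CN.rem {v : β → ℤ} {q : β → ℕ} (hv : CZ Γ v) (hq : CN Γ q) (h0 : ∀ b, 0 < q b) :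
    CN Γ fun b => rem (v b) (q b) := CZ.emod hv hq h0

theorem CZ.net_ftop {i j : β → ℕ} (hi : CN Γ i) (hj : CN Γ j) :
    CZ Γ fun b => (Γ.inst b).1.net.ftop (i b) (j b) :=
  CZ.phi CN.net_m ((CN.net_m.toCZ.add (CZ.const 1)).mul (CZ.net_a hj)) hi

theorem CZ.net_thtop {i z : β → ℕ} (hi : CN Γ i) (hz : CN Γ z) :
    CZ Γ fun b => (Γ.inst b).1.net.thtop (i b) (z b) :=
  ((CZ.phi CN.net_m ((CN.net_m.toCZ.add (CZ.const 1)).mul (CZ.net_T.sub (CZ.const 1))) hi).sub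
    CN.net_m.toCZ).add hz.toCZ

/-- The hypothesis `hlk` bounds `w ^ l` by the number `w ^ k` of branches, which is within the time
budget. -/
theorem CN.net_tau {i z γ l : β → ℕ} (hi : CN Γ i) (hz : CN Γ z) (hγ : CN Γ γ) (hl : CN Γ l)
    (hlk : ∀ b, l b < (Γ.inst b).1.net.k) :
    CN Γ fun b => (Γ.inst b).1.net.tau (Γ.inst b).2 (i b) (z b) (γ b) (l b) :=
  (CN.rem (CZ.net_thtop hi hz) (CN.net_p hl) fun _ => Net.p_pos _ _).add
    (((hγ.div (CN.net_w.pow hl ((Ctx.Poly.of_inst Inst.polyX_w_pow_k).mono fun b =>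
      Nat.pow_le_pow_right (Γ.inst b).1.width_pos (hlk b).le))).mod CN.net_w).mul (CN.net_p hl))

theorem CN.net_bu {i l u : β → ℕ} (hi : CN Γ i) (hl : CN Γ l) (hu : CN Γ u) :
    CN Γ fun b => (Γ.inst b).1.net.bu (Γ.inst b).2 (i b) (l b) (u b) :=
  have hM := CN.net_N.mul CN.net_codes
  (CN.rem (CZ.net_ftop hi (hu.div hM)) (CN.net_p hl) fun _ => Net.p_pos _ _).mul
    (CN.crosses CN.net_m ((hu.mod hM).mod CN.net_codes))

theorem CZ.net_beta {i z γ u u' : β → ℕ} (hi : CN Γ i) (hz : CN Γ z) (hγ : CN Γ γ) (hu : CN Γ u)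
    (hu' : CN Γ u') :
    CZ Γ fun b => (Γ.inst b).1.net.beta (Γ.inst b).2 (i b) (z b) (γ b) (u b) (u' b) := by
  unfold Net.beta
  refine (CN.sum CN.net_k fun _ _ => ?_).toCZ.sub (CZ.ite (hu.eq hu')
    ((CN.const 2).mul (CN.sum CN.net_k fun _ _ => ?_)).toCZ (CZ.const 0))
  · exact (CN.net_bu hi.lift (CN.idx CN.net_k) hu.lift).mul
      (CN.net_bu hi.lift (CN.idx CN.net_k) hu'.lift)
  · exact (CN.net_tau hi.lift hz.lift hγ.lift (CN.idx CN.net_k) fun x => x.2.2).mul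
      (CN.net_bu hi.lift (CN.idx CN.net_k) hu.lift)

theorem CN.net_kap0 {i z γ : β → ℕ} (hi : CN Γ i) (hz : CN Γ z) (hγ : CN Γ γ) :
    CN Γ fun b => (Γ.inst b).1.net.kap0 (Γ.inst b).2 (i b) (z b) (γ b) := by
  unfold Net.kap0
  refine (CN.sum CN.net_k fun _ _ => ?_).add ((CN.const 1).tsub (CN.crosses CN.net_m hz))
  exact (CN.net_tau hi.lift hz.lift hγ.lift (CN.idx CN.net_k) fun x => x.2.2).sq

theorem CZ.net_fb {u ι : β → ℕ} (hu : CN Γ u) (hι : CN Γ ι) :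
    CZ Γ fun b => (Γ.inst b).1.net.fb (u b) (ι b) :=
  have hM := CN.net_N.mul CN.net_codes
  CZ.phi CN.net_m ((CN.net_m.toCZ.add (CZ.const 1)).mul (CZ.net_W (hu.div hM) hι))
    ((hu.mod hM).div CN.net_codes)

theorem CZ.net_thb {u : β → ℕ} (hu : CN Γ u) : CZ Γ fun b => (Γ.inst b).1.net.thb (u b) :=
  have hM := CN.net_N.mul CN.net_codes
  ((CZ.phi CN.net_m ((CN.net_m.toCZ.add (CZ.const 1)).mul
    ((CZ.net_t (hu.div hM)).sub (CZ.const 1))) ((hu.mod hM).div CN.net_codes)).sub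
    CN.net_m.toCZ).add ((hu.mod hM).mod CN.net_codes).toCZ

section Gate

variable {r u u' c c' ι : β → ℕ} (hr : CN Γ r) (hu : CN Γ u) (hu' : CN Γ u') (hc : CN Γ c)
  (hc' : CN Γ c') (hι : CN Γ ι) (hrR : ∀ b, r b < (Γ.inst b).1.net.R)

include hr hu hu' hι hrR in
theorem CN.net_kap : CN Γ fun b => (Γ.inst b).1.net.kap (r b) (u b) (u' b) (ι b) :=
  ((CN.rem (CZ.net_fb hu hι) (CN.net_q hr) fun b => Net.q_pos (hrR b)).mul
    ((CN.net_m.add (CN.const 1)).mul (CN.net_q hr))).add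
    (CN.rem (CZ.net_fb hu' hι) (CN.net_q hr) fun b => Net.q_pos (hrR b))

include hr hu hu' hrR in
theorem CN.net_lam : CN Γ fun b => (Γ.inst b).1.net.lam (r b) (u b) (u' b) :=
  CN.sum CN.net_n fun _ _ =>
    CN.net_kap hr.lift hu.lift hu'.lift (CN.idx CN.net_n) fun x => hrR x.1

include hr hu hu' hc hc' hrR in
theorem CN.net_val : CN Γ fun b => (Γ.inst b).1.net.val (r b) (u b) (u' b) (c b) (c' b) :=
  (((CN.rem (CZ.net_thb hu) (CN.net_q hr) fun b => Net.q_pos (hrR b)).add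
    (hc.mul (CN.net_q hr))).mul ((CN.net_m.add (CN.const 1)).mul (CN.net_q hr))).add
    ((CN.rem (CZ.net_thb hu') (CN.net_q hr) fun b => Net.q_pos (hrR b)).add
      (hc'.mul (CN.net_q hr)))

end Gate

theorem CZ.net_kh {i z γ u u' h : β → ℕ} (hi : CN Γ i) (hz : CN Γ z) (hγ : CN Γ γ) (hu : CN Γ u)
    (hu' : CN Γ u') (hh : CN Γ h) :
    CZ Γ fun b => (Γ.inst b).1.net.kh (Γ.inst b).2 (i b) (z b) (γ b) (u b) (u' b) (h b) :=
  CZ.ite (CB.lt hh.toCZ (CN.net_Hb.toCZ.sub (CZ.net_beta hi hz hγ hu hu')))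
    (CZ.const 0) (CZ.const 1)

theorem CZ.net_topThr {i z γ : β → ℕ} (hi : CN Γ i) (hz : CN Γ z) (hγ : CN Γ γ) :
    CZ Γ fun b => (Γ.inst b).1.net.topThr (Γ.inst b).2 (i b) (z b) (γ b) :=
  ((((CZ.const 2).mul CN.net_Hb.toCZ).mul (CN.net_U.toCZ.mul (CN.net_U.toCZ.mul
    (CN.net_R.toCZ.mul (CN.net_m.toCZ.mul CN.net_m.toCZ))))).sub CN.net_R.toCZ).add
    (((CZ.const 2).mul CN.net_R.toCZ).mul (CN.net_kap0 hi hz hγ).toCZ)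

end Compute

/-! ### Writing the circuits -/

theorem encode_litGate (n : ℕ) (neg : Bool) (κ : ℕ → ℕ) (s : ℤ) :
    (litGate n neg κ s).encode = s :: ((∑ ι ∈ Finset.range n, κ ι : ℕ) : ℤ) ::
      (List.range n).flatMap fun ι => (List.range (κ ι)).flatMap fun _ =>
        [if neg then -((ι : ℤ) + 1) else (ι : ℤ) + 1] := by
  rw [MajGate.encode, length_litGate]
  congr 2
  rw [← List.map_coe_finRange_eq_range, List.flatMap_map]
  simp only [litGate, List.map_flatMap, List.map_replicate]
  congr 1
  funext ι
  rw [← List.map_eq_flatMap, List.map_const', List.length_range]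
  rfl

theorem length_flatMap_range {α : Type*} {N ℓ : ℕ} {f : ℕ → List α} (h : ∀ i, (f i).length = ℓ) :
    ((List.range N).flatMap f).length = N * ℓ := by
  simp [List.length_flatMap, h]

namespace Net

variable (D : Net) (ω i z γ : ℕ)

theorem length_gates : (D.gates ω i z γ).length =
    D.U * (D.U * (D.R * (D.m * (D.m * (2 * D.Hb * 2))))) := by
  unfold gates
  refine length_flatMap_range fun u => length_flatMap_range fun u' => length_flatMap_range fun r =>
    length_flatMap_range fun c => length_flatMap_range fun c' => length_flatMap_range fun h => rfl

theorem length_subs : (D.subs ω).length = D.N * (codes D.m * D.w ^ D.k) := by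
  exact length_flatMap_range fun i => length_flatMap_range fun z => by simp

theorem encode_sub : (D.sub ω i z γ).encode = D.topThr ω i z γ ::
    ((D.U * (D.U * (D.R * (D.m * (D.m * (2 * D.Hb * 2))))) : ℕ) : ℤ) ::
    (List.range D.U).flatMap fun u => (List.range D.U).flatMap fun u' =>
      (List.range D.R).flatMap fun r => (List.range D.m).flatMap fun c =>
        (List.range D.m).flatMap fun c' => (List.range (2 * D.Hb)).flatMap fun h =>
          (litGate D.n false (D.kap r u u') (D.val r u u' c c' + D.kh ω i z γ u u' h)).encode ++
            (litGate D.n true (D.kap r u u')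
              (D.lam r u u' - D.val r u u' c c' + D.kh ω i z γ u u' h)).encode := by
  rw [MajMaj.encode, ← length_gates D ω i z γ]
  congr 2
  rw [← List.flatMap_def]
  simp only [sub, gates, List.flatMap_assoc, List.flatMap_cons, List.flatMap_nil, List.append_nil]

theorem encode_subs : (((D.subs ω).length : ℤ) :: ((D.subs ω).map MajMaj.encode).flatten) =
    ((D.N * (codes D.m * D.w ^ D.k) : ℕ) : ℤ) :: (List.range D.N).flatMap fun i =>
      (List.range (codes D.m)).flatMap fun z => (List.range (D.w ^ D.k)).flatMap fun γ =>
        (D.sub ω i z γ).encode := by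
  rw [length_subs, ← List.flatMap_def]
  simp only [subs, List.flatMap_assoc, List.flatMap_map]

end Net

namespace EM

variable {β : Type} {Γ : Ctx mainFam β}

theorem litGate {neg : Bool} {κ : β → ℕ → ℕ} {s : β → ℤ}
    (hκ : ∀ d V, CN (Γ.iter d (fun b => (Γ.inst b).1.net.n) V) fun x => κ x.1 x.2)
    (hs : CZ Γ s) : EM Γ fun b => (litGate (Γ.inst b).1.net.n neg (κ b) (s b)).encode := by
  simp only [encode_litGate]
  refine EM.cons hs (EM.cons (CN.sum CN.net_n hκ).toCZ (EM.flatMap CN.net_n fun d V => ?_))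
  refine EM.flatMap (hκ d V) fun d' V' => EM.single ?_
  have h : CZ ((Γ.iter d (fun b => (Γ.inst b).1.net.n) V).iter d' (fun x => κ x.1 x.2) V')
      fun x => (x.1.2 : ℤ) + 1 := (CN.idx CN.net_n).toCZ.lift.add (CZ.const 1)
  cases neg
  · exact h
  · exact h.neg

section Gates

variable {i z γ : β → ℕ} (hi : CN Γ i) (hz : CN Γ z) (hγ : CN Γ γ)

include hi hz hγ in
theorem gatePair {u u' r c c' h : β → ℕ} (hu : CN Γ u)
    (hu' : CN Γ u') (hr : CN Γ r) (hrR : ∀ b, r b < (Γ.inst b).1.net.R) (hc : CN Γ c)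
    (hc' : CN Γ c') (hh : CN Γ h) : EM Γ fun b =>
      (_root_.litGate (Γ.inst b).1.net.n false ((Γ.inst b).1.net.kap (r b) (u b) (u' b))
        ((Γ.inst b).1.net.val (r b) (u b) (u' b) (c b) (c' b) +
          (Γ.inst b).1.net.kh (Γ.inst b).2 (i b) (z b) (γ b) (u b) (u' b) (h b))).encode ++
      (_root_.litGate (Γ.inst b).1.net.n true ((Γ.inst b).1.net.kap (r b) (u b) (u' b))
        ((Γ.inst b).1.net.lam (r b) (u b) (u' b) -
          (Γ.inst b).1.net.val (r b) (u b) (u' b) (c b) (c' b) +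
            (Γ.inst b).1.net.kh (Γ.inst b).2 (i b) (z b) (γ b) (u b) (u' b) (h b))).encode := by
  have hκ : ∀ d V, CN (Γ.iter d (fun b => (Γ.inst b).1.net.n) V) fun x =>
      (Γ.inst x.1).1.net.kap (r x.1) (u x.1) (u' x.1) x.2 := fun d V =>
    CN.net_kap hr.lift hu.lift hu'.lift (CN.idx CN.net_n) fun x => hrR x.1
  have hk := CZ.net_kh hi hz hγ hu hu' hh
  have hv := (CN.net_val hr hu hu' hc hc' hrR).toCZ
  exact (EM.litGate hκ (hv.add hk)).append
    (EM.litGate hκ (((CN.net_lam hr hu hu' hrR).toCZ.sub hv).add hk))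

include hi hz hγ in
theorem sub : EM Γ fun b => ((Γ.inst b).1.net.sub (Γ.inst b).2 (i b) (z b) (γ b)).encode := by
  simp only [Net.encode_sub]
  refine EM.cons (CZ.net_topThr hi hz hγ) (EM.cons (CN.toCZ ?_) ?_)
  · exact CN.net_U.mul (CN.net_U.mul (CN.net_R.mul (CN.net_m.mul (CN.net_m.mul
      (((CN.const 2).mul CN.net_Hb).mul (CN.const 2))))))
  refine EM.flatMap CN.net_U fun _ _ => EM.flatMap CN.net_U fun _ _ =>
    EM.flatMap CN.net_R fun _ _ => EM.flatMap CN.net_m fun _ _ =>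
    EM.flatMap CN.net_m fun _ _ => EM.flatMap ((CN.const 2).mul CN.net_Hb) fun _ _ => ?_
  exact gatePair hi.lift.lift.lift.lift.lift.lift hz.lift.lift.lift.lift.lift.lift
    hγ.lift.lift.lift.lift.lift.lift (CN.idx CN.net_U).lift.lift.lift.lift.lift
    (CN.idx CN.net_U).lift.lift.lift.lift (CN.idx CN.net_R).lift.lift.lift
    (fun b => b.1.1.1.2.2) (CN.idx CN.net_m).lift.lift (CN.idx CN.net_m).lift
    (CN.idx ((CN.const 2).mul CN.net_Hb))

end Gates

theorem subs : EM Γ fun b => (((Γ.inst b).1.net.subs (Γ.inst b).2).length : ℤ) ::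
    (((Γ.inst b).1.net.subs (Γ.inst b).2).map MajMaj.encode).flatten := by
  simp only [Net.encode_subs]
  have hw : CN Γ fun b => (Γ.inst b).1.net.w ^ (Γ.inst b).1.net.k :=
    CN.net_w.pow CN.net_k (.of_inst (f := fun i => i.net.w ^ i.net.k) Inst.polyX_w_pow_k)
  refine EM.cons (CN.net_N.mul (CN.net_codes.mul hw)).toCZ ?_
  refine EM.flatMap CN.net_N fun _ _ => EM.flatMap CN.net_codes fun _ _ => EM.flatMap ?_ fun _ _ => ?_
  · exact hw.lift.lift
  · exact EM.sub (CN.idx CN.net_N).lift.lift (CN.idx CN.net_codes).lift (CN.idx hw.lift.lift)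

end EM

/-! ### Size and correctness of the circuits -/

namespace Net

variable {D : Net}

theorem q_le (r : ℕ) : D.q r ≤ 4 ^ (D.R.size + 3) := by
  rw [q, primeBelow, ← Finset.card_filter]
  exact (Finset.card_filter_le _ _).trans (Finset.card_range _).le

theorem fb_eq_zero {u ι : ℕ} (hu : u < D.U) (hι : ι ∈ Finset.range D.n)
    (h : ι ∉ D.wiredSet) : D.fb u ι = 0 := by
  have h1 : D.W (D.aj u) ι = 0 := by
    by_contra h0
    refine h (Finset.mem_filter.2 ⟨hι, Finset.sum_pos' (fun _ _ => abs_nonneg _)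
      ⟨_, Finset.mem_range.2 (aj_lt hu), abs_pos.2 h0⟩⟩)
  rw [fb, h1, mul_zero, phi_zero]

/-- Unwired variables have coefficient 0, so the fan-in of a bottom gate does not depend on `n`. -/
theorem lam_le {r u u' : ℕ} (hr : r < D.R) (hu : u < D.U) (hu' : u' < D.U) : D.lam r u u' ≤
    D.wired * (4 ^ (D.R.size + 3) * ((D.m + 1) * 4 ^ (D.R.size + 3)) + 4 ^ (D.R.size + 3)) := by
  have hq := D.q_le r
  have h1 : D.lam r u u' = ∑ ι ∈ D.wiredSet, D.kap r u u' ι := by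
    symm
    refine Finset.sum_subset (Finset.filter_subset _ _) fun ι hι h => ?_
    have h0 : rem 0 (D.q r) = 0 := by rw [rem, Int.zero_emod, Int.toNat_zero]
    rw [kap, fb_eq_zero hu hι h, fb_eq_zero hu' hι h, h0, zero_mul, add_zero]
  rw [h1, ← card_wiredSet]
  generalize 4 ^ (D.R.size + 3) = Q at *
  refine Finset.sum_le_card_nsmul _ _ _ fun ι _ => Nat.add_le_add (Nat.mul_le_mul ?_
    (Nat.mul_le_mul_left _ hq)) ?_ <;> exact (rem_lt _ (q_pos hr)).le.trans hq

theorem size_sub_le (ω i z γ : ℕ) : (D.sub ω i z γ).size ≤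
    1 + D.U * (D.U * (D.R * (D.m * (D.m * (2 * D.Hb * 2))))) * (D.wired *
      (4 ^ (D.R.size + 3) * ((D.m + 1) * 4 ^ (D.R.size + 3)) + 4 ^ (D.R.size + 3)) + 2) := by
  rw [MajMaj.size, ← length_gates D ω i z γ]
  refine Nat.add_le_add_left ?_ 1
  change ((D.gates ω i z γ).map fun g => g.inputs.length + 2).sum ≤ _
  refine (List.sum_le_card_nsmul _ _ fun v hv => ?_).trans (by rw [List.length_map, smul_eq_mul])
  obtain ⟨g, hg, rfl⟩ := List.mem_map.1 hv
  simp only [gates, List.mem_flatMap, List.mem_range] at hg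
  obtain ⟨u, hu, u', hu', r, hr, c, _, c', _, h, _, hg⟩ := hg
  have key := lam_le hr hu hu'
  simp only [List.mem_cons, List.not_mem_nil, or_false] at hg
  rcases hg with rfl | rfl <;> rw [length_litGate] <;> exact Nat.add_le_add_right key 2

end Net

namespace Inst

open Finset

variable (i : Inst)

theorem polyY_size : ∃ C : ℕ → ℕ, ∀ i : Inst, ∀ ω a z γ,
    (i.net.sub ω a z γ).size ≤ i.Y ^ C i.k := by
  have hU := polyY_U
  have hm := polyY_m
  obtain ⟨C, hC⟩ := (polyY_const 1).add two_le_Y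
    ((hU.mul (hU.mul (polyY_R.mul (hm.mul (hm.mul (((polyY_const 2).mul polyY_Hb).mul
      (polyY_const 2))))))).mul (((poly_wired.trans polyY_s).mul
        ((polyY_Q.mul ((hm.add two_le_Y (polyY_const 1)).mul polyY_Q)).add two_le_Y
          polyY_Q)).add two_le_Y (polyY_const 2)))
  exact ⟨C, fun i ω a z γ => (Net.size_sub_le ω a z γ).trans (hC i)⟩

theorem poly_length : ∃ C : ℕ → ℕ, ∀ i : Inst, ∀ ω,
    (i.net.subs ω).length ≤ 2 ^ (i.n / i.e + 1) * i.s ^ C i.k := by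
  obtain ⟨C, hC⟩ := poly_N.mul (poly_codes.mul poly_branches)
  refine ⟨C, fun i ω => ?_⟩
  rw [Net.length_subs]
  calc _ ≤ i.net.N * (codes i.net.m * (2 ^ (i.n / i.e + 1) *
        (2 ^ (3 * i.net.N * codes i.net.m).size * 2 ^ i.net.sg))) := by
        gcongr
        exact i.w_pow_k_le
    _ = 2 ^ (i.n / i.e + 1) * (i.net.N * (codes i.net.m *
        (2 ^ (3 * i.net.N * codes i.net.m).size * 2 ^ i.net.sg))) := by ring
    _ ≤ _ := Nat.mul_le_mul_left _ (hC i)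

theorem sum_weight {m : ℕ} (f : Fin m → ℤ) (g : ℕ → ℤ) (h : ∀ j : Fin m, g j = f j)
    (x : Fin m → Bool) (y : ℕ → ℤ) (hy : ∀ j : Fin m, y j = bitVal (x j)) :
    ∑ j ∈ range m, g j * y j = ∑ j, f j * bitVal (x j) := by
  rw [sum_range]
  exact sum_congr rfl fun j _ => by rw [h, hy]

theorem bot_eq (x : Fin i.n → Bool) (j : Fin i.c.width) :
    i.net.bot (bitSeq x) j = bitVal ((i.c.bottom j).eval x) := by
  rw [Net.bot, net_t, net_n, sum_weight _ (i.net.W j) (i.net_W j) x _ fun ι => by simp [bitSeq],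
    ThrGate.eval, bitVal]
  simp

theorem net_eval (x : Fin i.n → Bool) :
    (i.net.T ≤ ∑ j ∈ range i.net.w, i.net.a j * i.net.bot (bitSeq x) j) ↔ i.c.eval x = true := by
  rw [net_w, sum_weight _ i.net.a i.net_a (fun j => (i.c.bottom j).eval x) _ (i.bot_eq x),
    ThrThr.eval, ThrGate.eval, decide_eq_true_iff, net_T]

theorem countP_subs {ω : ℕ} (hω : i.net.Good ω) (x : Fin i.n → Bool) :
    (i.net.subs ω).countP (fun m => m.eval x) = if i.c.eval x = true then 1 else 0 := by
  have h := Net.countP_subs (D := i.net) i.width_pos hω x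
  by_cases hx : i.c.eval x = true
  · rw [if_pos hx]
    exact_mod_cast h.trans (if_pos ((i.net_eval x).2 hx))
  · rw [if_neg hx]
    exact_mod_cast h.trans (if_neg (mt (i.net_eval x).1 hx))

/-- The equivalent circuit. -/
def circuit {ω : ℕ} (hω : i.net.Good ω) : DisjOrMajMaj i.n where
  subs := i.net.subs ω
  disjoint x := (i.countP_subs hω x).le.trans (by split_ifs <;> simp)

theorem eval_circuit {ω : ℕ} (hω : i.net.Good ω) (x : Fin i.n → Bool) :
    (i.circuit hω).eval x = i.c.eval x := by
  have h := i.countP_subs hω x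
  rw [Bool.eq_iff_iff, DisjOrMajMaj.eval, List.any_eq_true, ← List.countP_pos_iff]
  change 0 < (i.net.subs ω).countP (fun m => m.eval x) ↔ _
  rw [h]
  split_ifs with h1 <;> simp [h1]

end Inst

/-! ### The program -/

/-- The configurations with given contents of cell `0`, before the main phase. -/
def mainCtx : Ctx mainFam mainFam.I where
  inst x := x
  dep := 1
  st i := if i = 0 then some mainFam.base else none
  dep_pos := one_pos
  st_zero := rfl

/-- The initial configurations, in which cell `0` contains `0`. -/
def initCtx : Ctx mainFam Inst where
  inst i := ⟨i, ⟨0, by positivity⟩⟩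
  dep := 1
  st i := if i = 0 then some fun _ => 0 else none
  dep_pos := one_pos
  st_zero := rfl

/-- Tossing as many coins as cell `1` tells, and putting the resulting number into cell `0`. -/
def tossProgram : Ram :=
  .whilePos 1 (.seq (.flip 2) (.seq (.add 0 0 0) (.seq (.add 0 0 2) (.seq (.const 2 1)
    (.sub 1 1 2)))))

theorem execLe_tossProgram (inp : List ℤ) (ω : ℕ → Bool) (q : ℕ) (σ : RamState) (h0 : σ.mem 0 = 0)
    (h1 : σ.mem 1 = q) (hc : σ.coins = 0) : ∃ τ, Ram.ExecLe inp ω tossProgram σ (q * 6 + 1) τ ∧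
      τ.mem 0 = coinNum ω q ∧ τ.out = σ.out := by
  obtain ⟨τ, hτ, h, -, -, ho⟩ := Ram.execLe_while (inp := inp) (ω := ω) (a := 1) (N := q)
    (p := .seq (.flip 2) (.seq (.add 0 0 0) (.seq (.add 0 0 2) (.seq (.const 2 1) (.sub 1 1 2)))))
    (T := 5) (σ := σ)
    (fun i φ => φ.mem 0 = coinNum ω i ∧ φ.mem 1 = q - i ∧ φ.coins = i ∧ φ.out = σ.out)
    (fun i hi φ h => by rw [h.2.1]; omega) (fun φ h => by rw [h.2.1]; omega)
    (fun i hi φ h => by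
      obtain ⟨hφ0, hφ1, hφc, ho⟩ := h
      refine ⟨_, ((Ram.Run.flip 2 φ).seq ((Ram.Run.add 0 0 0 _).seq ((Ram.Run.add 0 0 2 _).seq
        ((Ram.Run.const 2 1 _).seq (Ram.Run.sub 1 1 2 _))))).execLe, ?_, ?_, ?_, ?_⟩
      · simp [hφ0, hφc, coinNum, bitVal, two_mul]
      · simp [hφ1]
        ring
      · simp [hφc]
      · simp [ho])
    ⟨by simpa [coinNum] using h0, by simpa using h1, hc, rfl⟩
  exact ⟨τ, hτ, h, ho⟩

/-- The number of coins is computed in `initCtx`, where cell 0 is zero and no coin has been tossed.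
The tosses then fill cell 0, and `mainCtx` treats the result as part of the instance. -/
theorem exists_coreProgram : ∃ p : Ram, ∃ C : ℕ → ℕ, ∀ (i : Inst) (ω : ℕ → Bool) (σ : RamState),
    σ.mem 0 = 0 → σ.coins = 0 → ∃ τ, Ram.ExecLe i.inp ω p σ (i.X ^ C i.k) τ ∧
      τ.out = σ.out ++ (((i.net.subs (coinNum ω (i.net.b * i.net.k))).length : ℤ) ::
        ((i.net.subs (coinNum ω (i.net.b * i.net.k))).map MajMaj.encode).flatten) := by
  have hq : CN initCtx fun i => i.net.b * i.net.k := CN.net_b.mul CN.net_k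
  obtain ⟨p1, t1, ht1, h1⟩ := hq.1.2 0
  obtain ⟨p2, t2, ⟨C2, hC2⟩, h2⟩ := EM.subs (Γ := mainCtx) 0
  have hp : initCtx.Poly fun i => t1 i + ((i.net.b * i.net.k * 6 + 1) + i.X ^ C2 i.k) :=
    ht1.add (((hq.2.mul (Ctx.Poly.const _ 6)).add (Ctx.Poly.const _ 1)).add ⟨C2, fun _ => le_rfl⟩)
  obtain ⟨C, hC⟩ := hp
  refine ⟨.seq p1 (.seq tossProgram p2), C, fun i ω σ h0 hc => ?_⟩
  obtain ⟨τ, r1, e1, fr1, o1⟩ := h1 i ω σ fun j hj f hf => by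
    obtain rfl : j = 0 := Nat.lt_one_iff.1 hj
    cases hf
    exact h0
  obtain ⟨υ, r2, e2, o2⟩ := execLe_tossProgram i.inp ω _ τ ((fr1.mem 0 one_pos).trans h0) e1
    (fr1.coins.trans hc)
  have hlt : coinNum ω (i.net.b * i.net.k) < (2 ^ i.net.b) ^ i.net.k := by
    rw [← pow_mul]
    exact coinNum_lt _ _
  obtain ⟨φ, r3, -, o3⟩ := h2 ⟨i, ⟨_, hlt⟩⟩ ω υ fun j hj f hf => by
    obtain rfl : j = 0 := Nat.lt_one_iff.1 hj
    cases hf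
    exact e2
  refine ⟨φ, (r1.seq (r2.seq (r3.mono (hC2 _)))).mono (hC i), ?_⟩
  rw [o3, o2, o1]
  rfl

/-- One program for all inputs. -/
theorem exists_program : ∃ p : Ram, (∃ C : ℕ → ℕ, ∀ (i : Inst) (ω : ℕ → Bool),
    p.Outputs i.inp ω (i.X ^ C i.k)
      (((i.net.subs (coinNum ω (i.net.b * i.net.k))).length : ℤ) ::
        ((i.net.subs (coinNum ω (i.net.b * i.net.k))).map MajMaj.encode).flatten)) ∧
    ∀ (e n : ℕ) (c : ThrThr ℤ n) (ω : ℕ → Bool), c.width = 0 →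
      p.Outputs ((e : ℤ) :: c.encode) ω 10 (if 0 < c.top.threshold then [0] else [1, 0, 0]) := by
  obtain ⟨p, C, h⟩ := exists_coreProgram
  -- Input positions 2 and 3 hold the width and the top threshold. Without bottom gates the circuit
  -- is constant: `[0]` describes the empty OR, and `[1, 0, 0]` one subcircuit with threshold 0 and
  -- no gates.
  refine ⟨.seq (.const 1 2) (.seq (.read 1 1) (.ifPos 1 p (.seq (.const 1 3) (.seq (.read 1 1)
    (.ifPos 1 (.emit 0) (.seq (.const 1 1) (.seq (.emit 1) (.seq (.emit 0) (.emit 0))))))))),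
    ?_, fun e n c ω hw => ?_⟩
  · have hp : PolyLe Inst.X Inst.k fun i => 1 + (1 + (1 + i.X ^ C i.k)) := by
      have h1 := PolyLe.const (par := Inst.k) Inst.two_le_X 1
      exact h1.add Inst.two_le_X (h1.add Inst.two_le_X (h1.add Inst.two_le_X
        ⟨C, fun _ => le_rfl⟩))
    obtain ⟨C', hC'⟩ := hp
    refine ⟨C', fun i ω => ?_⟩
    obtain ⟨τ, ⟨t, ht, hr⟩, ho⟩ := h i ω ((RamState.init.assign 1 2).assign 1 i.c.width) rfl rfl
    have hpos : (0 : ℤ) < i.c.width := by exact_mod_cast i.width_pos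
    exact ⟨1 + (1 + (1 + t)), (by omega : _ ≤ 1 + (1 + (1 + i.X ^ C i.k))).trans (hC' i),
      τ, (Ram.Run.const _ _ _).seq ((Ram.Run.read _ _ _).seq (.ifTrue hpos hr)), ho⟩
  · set inp := (e : ℤ) :: c.encode with hinp
    set σ := (RamState.init.assign 1 2).assign 1 c.width with hσ
  
    have h4 : ∀ q τ t, Ram.Run inp ω q ((σ.assign 1 3).assign 1 c.top.threshold) t τ →
        Ram.Run inp ω (.seq (.const 1 2) (.seq (.read 1 1) (.ifPos 1 p (.seq (.const 1 3)
          (.seq (.read 1 1) q))))) RamState.init (1 + (1 + (1 + (1 + (1 + t))))) τ :=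
      fun q τ t hq => (Ram.Run.const _ _ _).seq ((Ram.Run.read _ _ _).seq
        (.ifFalse (by
          change (c.width : ℤ) ≤ 0
          omega) ((Ram.Run.const _ _ _).seq ((Ram.Run.read _ _ _).seq hq))))
    split_ifs with hT
    · exact ⟨_, by norm_num, _, h4 _ _ _ (.ifTrue (by simpa using hT) (.emit 0 _)), rfl⟩
    · exact ⟨_, by norm_num, _, h4 _ _ _ (.ifFalse (by simpa using hT)
        ((Ram.Run.const 1 1 _).seq ((Ram.Run.emit 1 _).seq ((Ram.Run.emit 0 _).seq
          (.emit 0 _))))), rfl⟩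

/-! ### Probability and bounds -/

theorem Ram.Outputs.mono {p : Ram} {inp out : List ℤ} {ω : ℕ → Bool} {T T' : ℕ}
    (h : p.Outputs inp ω T out) (hT : T ≤ T') : p.Outputs inp ω T' out :=
  let ⟨t, ht, h⟩ := h
  ⟨t, ht.trans hT, h⟩

-- The first `q` coins form a uniform number, and each bad value of it arises from `2 ^ T` outcomes
-- of the remaining coins. All other outcomes succeed.
open Finset in
open scoped Classical in
theorem Ram.two_thirds_le_prob {p : Ram} {inp : List ℤ} {T q : ℕ} {Q : List ℤ → Prop}
    {P : ℕ → Prop} (hq : q ≤ T)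
    (h : ∀ ω : ℕ → Bool, P (coinNum ω q) → ∃ out, Q out ∧ p.Outputs inp ω T out)
    (hP : ∀ G : Finset ℕ, (∀ v ∈ G, v < 2 ^ q ∧ ¬P v) → 3 * #G ≤ 2 ^ q) :
    2 / 3 ≤ p.prob inp T Q := by
  obtain ⟨T, rfl⟩ := Nat.exists_eq_add_of_le hq
  set G : Finset ℕ := {v ∈ range (2 ^ q) | ¬P v} with hG
  have hG' : ∀ v ∈ G, v < 2 ^ q ∧ ¬P v := fun v hv => by
    simpa [hG] using hv
  have h1 := card_coinNum_mem T fun v hv => (hG' v hv).1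
  have h2 := hP G hG'
  rw [Ram.prob, Nat.card_eq_fintype_card, Fintype.card_subtype, le_div_iff₀ (by positivity)]
  set A : Finset (Fin (q + T) → Bool) :=
    {r | ∃ out, Q out ∧ p.Outputs inp (extendCoins r) (q + T) out} with hA
  set B : Finset (Fin (q + T) → Bool) := {r | coinNum (extendCoins r) q ∈ G} with hB
  have h3 : univ ⊆ A ∪ B := fun r _ => by
    by_cases hr : P (coinNum (extendCoins r) q)
    · exact mem_union_left _ (by simpa [hA] using h _ hr)
    · refine mem_union_right _ ?_
      simpa [hB, hG] using ⟨coinNum_lt _ _, hr⟩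
  have h4 := (card_le_card h3).trans (card_union_le _ _)
  rw [h1] at h4
  simp only [card_univ, Fintype.card_pi, Fintype.card_bool, prod_const, Fintype.card_fin] at h4
  have h5 : 2 * 2 ^ (q + T) ≤ 3 * #A := by
    have h6 : 3 * (#G * 2 ^ T) ≤ 2 ^ (q + T) := by
      rw [pow_add, ← mul_assoc]
      exact Nat.mul_le_mul_right _ h2
    omega
  have h6 : (2 * 2 ^ (q + T) : ℝ) ≤ 3 * #A := by exact_mod_cast h5
  linarith

theorem Ram.prob_eq_one {p : Ram} {inp : List ℤ} {T : ℕ} {Q : List ℤ → Prop}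
    (h : ∀ ω : ℕ → Bool, ∃ out, Q out ∧ p.Outputs inp ω T out) : p.prob inp T Q = 1 := by
  classical
  rw [Ram.prob, Nat.card_eq_fintype_card, Fintype.card_subtype,
    Finset.filter_true_of_mem fun r _ => h _]
  simp

section Bounds

variable {n s C A : ℕ} {ε : ℝ}

theorem le_timeBound (hε : 0 < ε) (hs : 0 < s) : (C : ℝ) ≤ timeBound C n s ε := by
  have hs : (1 : ℝ) ≤ s := by exact_mod_cast hs
  have h1 : (1 : ℝ) ≤ 2 ^ ((C : ℝ) * ε * n) := Real.one_le_rpow (by norm_num) (by positivity)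
  have h2 : (1 : ℝ) ≤ (s : ℝ) ^ ((C : ℝ) / ε) := Real.one_le_rpow hs (by positivity)
  have h3 : (1 : ℝ) ≤ (s : ℝ) ^ C := one_le_pow₀ hs
  rw [timeBound]
  calc (C : ℝ) = 1 * 1 * (C * 1) := by ring
    _ ≤ _ := by gcongr

theorem le_fanInBound (hε : 0 < ε) (hs : 0 < s) : (C : ℝ) ≤ fanInBound C n s ε := by
  have hs : (1 : ℝ) ≤ s := by exact_mod_cast hs
  have h1 : (1 : ℝ) ≤ 2 ^ ((C : ℝ) * ε * n) := Real.one_le_rpow (by norm_num) (by positivity)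
  have h3 : (1 : ℝ) ≤ (s : ℝ) ^ C := one_le_pow₀ hs
  rw [fanInBound]
  calc (C : ℝ) = 1 * (C * 1) := by ring
    _ ≤ _ := by gcongr

theorem le_subSizeBound (hε : 0 < ε) (hs : 0 < s) : (C : ℝ) ≤ subSizeBound C s ε := by
  have hs : (1 : ℝ) ≤ s := by exact_mod_cast hs
  have h2 : (1 : ℝ) ≤ (s : ℝ) ^ ((C : ℝ) / ε) := Real.one_le_rpow hs (by positivity)
  have h3 : (1 : ℝ) ≤ (s : ℝ) ^ C := one_le_pow₀ hs
  rw [subSizeBound]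
  calc (C : ℝ) = 1 * (C * 1) := by ring
    _ ≤ _ := by gcongr

theorem two_pow_div_le (hε : 0 < ε) :
    (2 : ℝ) ^ (n / ⌈1 / ε⌉₊ + 1) ≤ 2 * 2 ^ (ε * n) := by
  rw [pow_succ, mul_comm, ← Real.rpow_natCast]
  refine mul_le_mul_of_nonneg_left (Real.rpow_le_rpow_of_exponent_le (by norm_num) ?_) (by norm_num)
  refine Nat.cast_div_le.trans ?_
  have h1 : 1 / ε ≤ ⌈1 / ε⌉₊ := Nat.le_ceil _
  have h2 : 0 < 1 / ε := by positivity
  calc (n : ℝ) / ⌈1 / ε⌉₊ ≤ n / (1 / ε) := by gcongr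
    _ = ε * n := by field_simp

/-- Rounding up adds less than 1, and `1 ≤ 1 / ε` because `ε < 1`. -/
theorem pow_ceil_le (hε : 0 < ε) (hε1 : ε < 1) (hs : 0 < s) :
    (s : ℝ) ^ ⌈1 / ε⌉₊ ≤ (s : ℝ) ^ (2 / ε) := by
  have hs : (1 : ℝ) ≤ s := by exact_mod_cast hs
  rw [← Real.rpow_natCast]
  refine Real.rpow_le_rpow_of_exponent_le hs ?_
  have h1 := (Nat.ceil_lt_add_one (show 0 ≤ 1 / ε by positivity)).le
  have h2 : 1 ≤ 1 / ε := by rw [le_div_iff₀ hε]; linarith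
  calc (⌈1 / ε⌉₊ : ℝ) ≤ 1 / ε + 1 / ε := by linarith
    _ = 2 / ε := by ring

theorem fanIn_le (hε : 0 < ε) (hs : 0 < s) (hC : 2 + A ≤ C) :
    (2 : ℝ) ^ (n / ⌈1 / ε⌉₊ + 1) * s ^ A ≤ fanInBound C n s ε := by
  have hs : (1 : ℝ) ≤ s := by exact_mod_cast hs
  have h1 := two_pow_div_le (n := n) hε
  have h2 : (2 : ℝ) ^ (ε * n) ≤ 2 ^ ((C : ℝ) * ε * n) := by
    refine Real.rpow_le_rpow_of_exponent_le (by norm_num) ?_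
    rw [mul_assoc]
    refine le_mul_of_one_le_left (by positivity) ?_
    exact_mod_cast (by omega : 1 ≤ C)
  have h3 : (s : ℝ) ^ A ≤ s ^ C := pow_le_pow_right₀ hs (by omega)
  have h4 : (2 : ℝ) ≤ C := by exact_mod_cast (by omega : 2 ≤ C)
  rw [fanInBound]
  calc (2 : ℝ) ^ (n / ⌈1 / ε⌉₊ + 1) * s ^ A ≤ (2 * 2 ^ (ε * n)) * s ^ A := by gcongr
    _ = 2 ^ (ε * n) * (2 * s ^ A) := by ring
    _ ≤ _ := by gcongr

theorem rpow_bound (hε : 0 < ε) (hε1 : ε < 1) (hs : 0 < s) (hC : 2 * A ≤ C) :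
    ((s : ℝ) ^ ⌈1 / ε⌉₊) ^ A ≤ (s : ℝ) ^ ((C : ℝ) / ε) := by
  have hs' : (1 : ℝ) ≤ s := by exact_mod_cast hs
  refine (pow_le_pow_left₀ (by positivity) (pow_ceil_le hε hε1 hs) A).trans ?_
  rw [← Real.rpow_mul_natCast (by positivity)]
  refine Real.rpow_le_rpow_of_exponent_le hs' ?_
  rw [div_mul_eq_mul_div]
  refine div_le_div_of_nonneg_right ?_ hε.le
  exact_mod_cast hC

theorem subSize_le (hε : 0 < ε) (hε1 : ε < 1) (hs : 0 < s) (hC : 2 * A + 1 ≤ C) :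
    ((s : ℝ) ^ ⌈1 / ε⌉₊) ^ A ≤ subSizeBound C s ε := by
  have hs' : (1 : ℝ) ≤ s := by exact_mod_cast hs
  refine (rpow_bound hε hε1 hs (by omega : 2 * A ≤ C)).trans ?_
  rw [subSizeBound]
  refine le_mul_of_one_le_right (by positivity) ?_
  exact one_le_mul_of_one_le_of_one_le (by exact_mod_cast (by omega : 1 ≤ C)) (one_le_pow₀ hs')

theorem time_le (hε : 0 < ε) (hε1 : ε < 1) (hs : 0 < s) (hC : 2 * A + 2 ^ A ≤ C) :
    ((s : ℝ) ^ ⌈1 / ε⌉₊ * 2 ^ (n / ⌈1 / ε⌉₊ + 1)) ^ A ≤ timeBound C n s ε := by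
  have hs' : (1 : ℝ) ≤ s := by exact_mod_cast hs
  have h0 : 0 < 2 ^ A := by positivity
  have h1 := rpow_bound hε hε1 hs (by omega : 2 * A ≤ C)
  have h2 : (2 : ℝ) ^ A ≤ C * s ^ C := by
    refine le_trans (by exact_mod_cast (by omega : 2 ^ A ≤ C)) (le_mul_of_one_le_right
      (by positivity) (one_le_pow₀ hs'))
  have h3 : ((2 : ℝ) ^ (ε * n)) ^ A ≤ 2 ^ ((C : ℝ) * ε * n) := by
    rw [← Real.rpow_mul_natCast (by norm_num)]
    refine Real.rpow_le_rpow_of_exponent_le (by norm_num) ?_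
    have : (A : ℝ) ≤ C := by exact_mod_cast (by omega : A ≤ C)
    calc ε * n * A = A * (ε * n) := by ring
      _ ≤ C * (ε * n) := by gcongr
      _ = _ := by ring
  rw [timeBound, mul_pow]
  calc ((s : ℝ) ^ ⌈1 / ε⌉₊) ^ A * (2 ^ (n / ⌈1 / ε⌉₊ + 1)) ^ A
      ≤ (s : ℝ) ^ ((C : ℝ) / ε) * (2 * 2 ^ (ε * n)) ^ A := by
        gcongr
        exact two_pow_div_le hε
    _ = ((2 : ℝ) ^ (ε * n)) ^ A * (s : ℝ) ^ ((C : ℝ) / ε) * 2 ^ A := by ring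
    _ ≤ _ := by gcongr

theorem eps_pos {n s : ℕ} (hs : 0 < s) (h : Real.logb 2 s / n < ε) : 0 < ε :=
  (div_nonneg (Real.logb_nonneg (by norm_num) (by exact_mod_cast hs)) n.cast_nonneg).trans_lt h

theorem two_le_ceil (hε : 0 < ε) (hε1 : ε < 1) : 2 ≤ ⌈1 / ε⌉₊ := by
  refine Nat.lt_ceil.2 ?_
  rw [lt_div_iff₀ hε]
  simpa using hε1

end Bounds

theorem ThrThr.size_pos {R : Type*} [Zero R] {n : ℕ} (c : ThrThr R n) : 0 < c.size := by
  rw [ThrThr.size]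
  omega

/-- A circuit without bottom gates is constant. -/
theorem ThrThr.eval_of_width_eq_zero {n : ℕ} {c : ThrThr ℤ n} (h : c.width = 0) (x : Fin n → Bool) :
    c.eval x = decide (c.top.threshold ≤ 0) := by
  have : IsEmpty (Fin c.width) := by
    rw [h]
    infer_instance
  simp [ThrThr.eval, ThrGate.eval]

theorem Net.exists_eq_sub {D : Net} {ω : ℕ} {m : MajMaj D.n} (hm : m ∈ D.subs ω) :
    ∃ a z γ, m = D.sub ω a z γ := by
  simp only [Net.subs, List.mem_flatMap, List.mem_map] at hm
  obtain ⟨a, -, z, -, γ, -, rfl⟩ := hm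
  exact ⟨a, z, γ, rfl⟩

theorem exists_reduction : ∃ p : Ram, ∀ k : ℕ, ∃ C : ℕ, ∀ s n : ℕ, ∀ ε : ℝ, 0 < ε → ε < 1 →
    ∀ c : ThrThr ℤ n, c.size ≤ s → c.WeightsLE (k * s ^ k) →
      p.HaltsWithin ((⌈1 / ε⌉₊ : ℤ) :: c.encode) ⌊timeBound C n s ε⌋₊ ∧
      2 / 3 ≤ p.prob ((⌈1 / ε⌉₊ : ℤ) :: c.encode) ⌊timeBound C n s ε⌋₊
        (fun out => ∃ d : DisjOrMajMaj n, out = d.encode ∧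
          d.Realizes c.eval (fanInBound C n s ε) (subSizeBound C s ε)) := by
  obtain ⟨p, ⟨A1, h1⟩, h0⟩ := exists_program
  obtain ⟨A2, h2⟩ := Inst.polyY_size
  obtain ⟨A3, h3⟩ := Inst.poly_length
  obtain ⟨A4, h4⟩ : PolyLe Inst.X Inst.k fun i => i.net.b * i.net.k :=
    (Inst.polyY_b.trans Inst.polyX_Y).mul (Inst.polyY_k.trans Inst.polyX_Y)
  -- The factor 2 comes from `⌈1/ε⌉ ≤ 2/ε`, the powers of 2 absorb the rounding of `n / e`, and 10
  -- covers the running time without bottom gates.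
  refine ⟨p, fun k => ⟨2 * (A1 k + A2 k + A3 k + A4 k) + 2 ^ A1 k + 2 ^ A4 k + 10,
    fun s n ε hε hε1 c hc hW => ?_⟩⟩
  set C := 2 * (A1 k + A2 k + A3 k + A4 k) + 2 ^ A1 k + 2 ^ A4 k + 10 with hC
  have hp1 : 0 < 2 ^ A1 k := by positivity
  have hp4 : 0 < 2 ^ A4 k := by positivity
  clear_value C
  have hs : 0 < s := c.size_pos.trans_le hc
  rcases Nat.eq_zero_or_pos c.width with hw | hw
  · have hT : 10 ≤ ⌊timeBound C n s ε⌋₊ := by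
      refine Nat.le_floor (le_trans ?_ (le_timeBound hε hs))
      exact_mod_cast (by omega : 10 ≤ C)
    have h := fun ω => (h0 ⌈1 / ε⌉₊ n c ω hw).mono hT
    refine ⟨fun ω => ⟨_, h ω⟩, ?_⟩
    rw [Ram.prob_eq_one fun ω => ⟨_, ?_, h ω⟩]
    · norm_num
    have hC1 : (1 : ℝ) ≤ C := by exact_mod_cast (by omega : 1 ≤ C)
    have hA := hC1.trans (le_fanInBound (n := n) hε hs)
    have hB := hC1.trans (le_subSizeBound hε hs)
    split_ifs with ht
    · refine ⟨⟨[], fun x => by simp⟩, rfl, fun x => ?_, ?_, by simp⟩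
      · rw [ThrThr.eval_of_width_eq_zero hw]
        simpa [DisjOrMajMaj.eval] using ht
      · simpa using zero_le_one.trans hA
    · refine ⟨⟨[⟨[], 0⟩], fun x => List.countP_le_length⟩, rfl, fun x => ?_, ?_, ?_⟩
      · rw [ThrThr.eval_of_width_eq_zero hw]
        simpa [DisjOrMajMaj.eval, MajMaj.eval] using ht
      · simpa using hA
      · simpa [MajMaj.size] using hB
  · set i : Inst := ⟨s, n, k, ⌈1 / ε⌉₊, c, two_le_ceil hε hε1, hc, hw, hW⟩ with hi
    have hX : (i.X : ℝ) = (s : ℝ) ^ ⌈1 / ε⌉₊ * 2 ^ (n / ⌈1 / ε⌉₊ + 1) := by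
      simp [Inst.X, Inst.Y, hi]
    have hY : (i.Y : ℝ) = (s : ℝ) ^ ⌈1 / ε⌉₊ := by
      simp [Inst.Y, hi]
    have hT1 : i.X ^ A1 k ≤ ⌊timeBound C n s ε⌋₊ := by
      refine Nat.le_floor ?_
      push_cast
      rw [hX]
      exact time_le hε hε1 hs (by omega)
    have hT4 : i.X ^ A4 k ≤ ⌊timeBound C n s ε⌋₊ := by
      refine Nat.le_floor ?_
      push_cast
      rw [hX]
      exact time_le hε hε1 hs (by omega)
    have h := fun ω => (h1 i ω).mono hT1
    refine ⟨fun ω => ⟨_, h ω⟩, Ram.two_thirds_le_prob (P := i.net.Good) ((h4 i).trans hT4)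
      (fun ω hω => ⟨_, ⟨i.circuit hω, rfl, i.eval_circuit hω, ?_, fun m hm => ?_⟩, h ω⟩)
      fun G hG => ?_⟩
    · refine le_trans ?_ (fanIn_le (A := A3 k) hε hs (by omega))
      exact_mod_cast h3 i _
    · refine le_trans ?_ (subSize_le (A := A2 k) hε hε1 hs (by omega))
      rw [← hY]
      obtain ⟨a, z, γ, rfl⟩ := Net.exists_eq_sub hm
      exact_mod_cast h2 i _ a z γ
    · rw [pow_mul] at hG ⊢
      exact i.net.three_mul_card_not_good_le (by have := i.two_le_e; simp only [Inst.net_e]; omega) G hG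

/-! ### Real weights -/

/-- Simultaneous Diophantine approximation. -/
theorem exists_simultaneous_approx {ι : Type*} [Fintype ι] [DecidableEq ι] (u : ι → ℝ) {N : ℕ}
    (hN : 0 < N) : ∃ q : ℕ, 0 < q ∧ q ≤ N ^ Fintype.card ι ∧ ∃ p : ι → ℤ,
      ∀ i, |q * u i - p i| < 1 / N := by
  have hN' : (0 : ℝ) < N := by exact_mod_cast hN
  have hf : ∀ q : ℕ, ∀ i, ⌊N * Int.fract (q * u i)⌋₊ < N := fun q i => by
    refine (Nat.floor_lt (mul_nonneg hN'.le (Int.fract_nonneg _))).2 ?_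
    exact mul_lt_of_lt_one_right hN' (Int.fract_lt_one _)
  -- Pigeonhole: two of the multiples have all fractional parts in the same boxes of side `1 / N`,
  -- and their difference is the denominator.
  let f : Fin (N ^ Fintype.card ι + 1) → ι → Fin N := fun q i => ⟨_, hf q i⟩
  obtain ⟨a, b, hab, h⟩ : ∃ a b, a < b ∧ f a = f b := by
    obtain ⟨a, b, hab, h⟩ := Fintype.exists_ne_map_eq_of_card_lt f (by simp)
    rcases hab.lt_or_gt with h' | h'
    · exact ⟨a, b, h', h⟩
    · exact ⟨b, a, h', h.symm⟩
  have hab' : (a : ℕ) < b := hab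
  refine ⟨b - a, by omega, by omega, fun i => ⌊(b : ℕ) * u i⌋ - ⌊(a : ℕ) * u i⌋, fun i => ?_⟩
  have h1 : ⌊N * Int.fract ((a : ℕ) * u i)⌋₊ = ⌊N * Int.fract ((b : ℕ) * u i)⌋₊ :=
    congrArg Fin.val (congrFun h i)
  have h0 : ∀ q : ℕ, 0 ≤ (N : ℝ) * Int.fract (q * u i) := fun q =>
    mul_nonneg hN'.le (Int.fract_nonneg _)
  have ha1 := Nat.floor_le (h0 a)
  have ha2 := Nat.lt_floor_add_one (N * Int.fract ((a : ℕ) * u i))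
  have hb1 := Nat.floor_le (h0 b)
  have hb2 := Nat.lt_floor_add_one (N * Int.fract ((b : ℕ) * u i))
  rw [h1] at ha1 ha2
  have h2 : ((b - a : ℕ) : ℝ) * u i - ((⌊(b : ℕ) * u i⌋ - ⌊(a : ℕ) * u i⌋ : ℤ) : ℝ) =
      Int.fract ((b : ℕ) * u i) - Int.fract ((a : ℕ) * u i) := by
    rw [Nat.cast_sub hab'.le, Int.fract, Int.fract]
    push_cast
    ring
  rw [h2, lt_div_iff₀ hN', ← abs_of_pos hN', ← abs_mul, abs_lt]
  constructor <;> linarith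

/-- Real weights can be replaced by integers without changing the signs of sums and differences. -/
theorem exists_int_weights {ι : Type*} [Fintype ι] [DecidableEq ι] {R : ℕ}
    (hR : Fintype.card ι = R) (r : ℕ) (w : ι → ℝ) (hw : {i | w i ≠ 0}.ncard ≤ r) :
    ∃ v : ι → ℤ, (∀ i, |v i| ≤ ((R + 1) * ((R + 1) ^ R + 2)) ^ r) ∧
      ∀ z : ι → ℤ, (∀ i, |z i| ≤ 1) → (0 ≤ ∑ i, v i * z i ↔ 0 ≤ ∑ i, w i * z i) := by
  set A : ℤ := (R + 1) * ((R + 1) ^ R + 2) with hA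
  have hA0 : 0 < A := by positivity
  induction r generalizing w with
  | zero =>
    rw [Nat.le_zero, Set.ncard_eq_zero (Set.toFinite _)] at hw
    have hw : ∀ i, w i = 0 := fun i => by
      by_contra h
      exact (Set.eq_empty_iff_forall_notMem.1 hw i) h
    exact ⟨0, by simp, by simp [hw]⟩
  | succ r ih =>
    by_cases hw0 : ∀ i, w i = 0
    · exact ⟨0, fun i => by simpa using by positivity, by simp [hw0]⟩
    push Not at hw0
    obtain ⟨i1, hi1⟩ := hw0
    have : Nonempty ι := ⟨i1⟩
    obtain ⟨i0, hi0⟩ := Finite.exists_max fun i => |w i|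
    have hM : 0 < |w i0| := (abs_pos.2 hi1).trans_le (hi0 i1)
    set u : ι → ℝ := fun i => w i / |w i0| with hu
    obtain ⟨q, hq, hqN, p, hp⟩ := exists_simultaneous_approx u (N := R + 1) (by omega)
    rw [hR] at hqN
    have hq' : (0 : ℝ) < q := by exact_mod_cast hq
    have hR1 : (1 : ℝ) / (R + 1 : ℕ) ≤ 1 := by
      rw [div_le_one (by positivity)]
      exact_mod_cast Nat.le_add_left 1 R
    have hint : ∀ i, (∃ a : ℤ, (q : ℝ) * u i = a) → (q : ℝ) * u i - p i = 0 := fun i ⟨a, ha⟩ => by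
      have h := (hp i).trans_le hR1
      rw [ha] at h ⊢
      have h' : |a - p i| < 1 := by exact_mod_cast h
      rw [Int.abs_lt_one_iff] at h'
      exact_mod_cast h'
    have h0 : (q : ℝ) * u i0 - p i0 = 0 := hint i0 (by
      rcases abs_choice (w i0) with h | h
      · exact ⟨q, by simp only [hu]; rw [h, div_self (by rintro h'; simp [h'] at hM)]; simp⟩
      · exact ⟨-q, by
          simp only [hu]
          rw [h, div_neg, div_self (by rintro h'; simp [h'] at hM)]
          simp⟩)
    -- The approximation is exact where the weight is zero and also at the largest weight, whose
    -- quotient is 1 or -1. The residual has smaller support and is handled by induction.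
    have hsub : {i | (q : ℝ) * u i - p i ≠ 0}.ncard ≤ r := by
      have : {i | (q : ℝ) * u i - p i ≠ 0} ⊂ {i | w i ≠ 0} := by
        refine ⟨fun i hi hi' => hi (hint i ⟨0, by simp [hu, hi']⟩), fun h => ?_⟩
        exact h (show w i0 ≠ 0 from fun h' => by simp [h'] at hM) h0
      have := Set.ncard_lt_ncard this (Set.toFinite _)
      omega
    obtain ⟨v, hv, hvz⟩ := ih _ hsub
    have hup : ∀ i, |p i| ≤ (R + 1) ^ R + 1 := fun i => by
      have h1 : |u i| ≤ 1 := by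
        simp only [hu]
        rw [abs_div, abs_abs, div_le_one hM]
        exact hi0 i
      have h2 : |(p i : ℝ)| ≤ q + 1 := by
        have h3 := (hp i).trans_le hR1
        have h4 : |(q : ℝ) * u i| ≤ q := by
          rw [abs_mul, abs_of_pos hq']
          exact mul_le_of_le_one_right hq'.le h1
        have h5 := abs_sub_abs_le_abs_sub (p i : ℝ) (q * u i)
        rw [abs_sub_comm] at h5
        linarith
      have h3 : |p i| ≤ q + 1 := by exact_mod_cast h2
      have h4 : (q : ℤ) ≤ (R + 1) ^ R := by exact_mod_cast hqN
      omega
    have hA1 : 1 ≤ A ^ r := one_le_pow₀ (by omega)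
    have hsum : ∀ z : ι → ℤ, (∀ i, |z i| ≤ 1) → |∑ i, v i * z i| ≤ R * A ^ r := fun z hz => by
      refine (Finset.abs_sum_le_sum_abs _ _).trans ((Finset.sum_le_card_nsmul _ _ (A ^ r)
        fun i _ => ?_).trans (by rw [Finset.card_univ, hR, nsmul_eq_mul]))
      rw [abs_mul]
      exact (mul_le_of_le_one_right (abs_nonneg _) (hz i)).trans (hv i)
    -- The approximating integers `p` take precedence over the integers `v` for the residual: a
    -- nonzero `p`-sum outweighs both the residual sum, which is below 1, and the `v`-sum, which is
    -- at most `R * A ^ r`. If the `p`-sum is zero, the residual decides the sign.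
    refine ⟨fun i => (R * A ^ r + 1) * p i + v i, fun i => ?_, fun z hz => ?_⟩
    · refine (abs_add_le _ _).trans ?_
      rw [abs_mul, abs_of_pos (show 0 < R * A ^ r + 1 by positivity)]
      calc (R * A ^ r + 1) * |p i| + |v i| ≤ (R * A ^ r + A ^ r) * ((R + 1) ^ R + 1) + A ^ r := by
            gcongr
            · exact hup i
            · exact hv i
        _ ≤ A ^ r * ((R + 1) * ((R + 1) ^ R + 1) + (R + 1)) := by nlinarith
        _ = A ^ (r + 1) := by rw [pow_succ, hA]; ring
    · have e1 : ∑ i, ((R * A ^ r + 1) * p i + v i) * z i =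
          (R * A ^ r + 1) * ∑ i, p i * z i + ∑ i, v i * z i := by
        rw [Finset.mul_sum, ← Finset.sum_add_distrib]
        exact Finset.sum_congr rfl fun i _ => by ring
      have e2 : (q / |w i0|) * ∑ i, w i * z i =
          ((∑ i, p i * z i : ℤ) : ℝ) + ∑ i, (q * u i - p i) * z i := by
        push_cast
        rw [Finset.mul_sum, ← Finset.sum_add_distrib]
        exact Finset.sum_congr rfl fun i _ => by simp only [hu]; ring
      have e3 : |∑ i, ((q : ℝ) * u i - p i) * z i| < 1 := by
        have hR2 : (0 : ℝ) < (R + 1 : ℕ) := by positivity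
        calc |∑ i, ((q : ℝ) * u i - p i) * z i| ≤ ∑ i, |((q : ℝ) * u i - p i) * z i| :=
              Finset.abs_sum_le_sum_abs _ _
          _ ≤ Fintype.card ι • (1 / (R + 1 : ℕ) : ℝ) := by
              refine Finset.sum_le_card_nsmul _ _ _ fun i _ => ?_
              rw [abs_mul]
              refine (mul_le_of_le_one_right (abs_nonneg _) ?_).trans (hp i).le
              exact_mod_cast hz i
          _ < 1 := by
              rw [hR, nsmul_eq_mul, mul_one_div, div_lt_one hR2]
              exact_mod_cast Nat.lt_succ_self R
      rw [e1, ← mul_nonneg_iff_of_pos_left (show 0 < q / |w i0| by positivity), e2]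
      have e4 := abs_lt.1 e3
      have e5 := abs_le.1 (hsum z hz)
      have hK : 0 ≤ R * A ^ r := by positivity
      rcases lt_trichotomy (∑ i, p i * z i) 0 with h | h | h
      · refine iff_of_false (fun h' => ?_) fun h' => ?_
        · nlinarith
        · have : ((∑ i, p i * z i : ℤ) : ℝ) ≤ -1 := by exact_mod_cast Int.le_sub_one_of_lt h
          linarith
      · rw [h, mul_zero, zero_add, Int.cast_zero, zero_add, hvz z hz]
      · refine iff_of_true ?_ ?_
        · nlinarith
        · have : (1 : ℝ) ≤ ((∑ i, p i * z i : ℤ) : ℝ) := by exact_mod_cast h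
          linarith

theorem weight_bound {R s : ℕ} (hR : R ≤ s) (hs : 0 < s) :
    ((R + 1) * ((R + 1) ^ R + 2)) ^ R ≤ 2 ^ (4 * s ^ 4) := by
  have h1 : ((R + 1) * ((R + 1) ^ R + 2)) ^ R ≤ ((s + 1) * ((s + 1) ^ s + 2)) ^ s := by
    refine (Nat.pow_le_pow_left (Nat.mul_le_mul (by omega) (Nat.add_le_add_right ?_ 2)) R).trans
      (Nat.pow_le_pow_right (by positivity) hR)
    exact (Nat.pow_le_pow_left (by omega) R).trans (Nat.pow_le_pow_right (by omega) hR)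
  have h2 : s + 1 ≤ 2 ^ s := Nat.lt_two_pow_self
  have h3 : (s + 1) ^ s + 2 ≤ 2 ^ (s * s + 2) := by
    have h4 : (s + 1) ^ s ≤ 2 ^ (s * s) := by
      rw [pow_mul]
      exact Nat.pow_le_pow_left h2 s
    have : 0 < 2 ^ (s * s) := by positivity
    rw [pow_add]
    omega
  refine h1.trans ((Nat.pow_le_pow_left (Nat.mul_le_mul h2 h3) s).trans ?_)
  rw [← pow_add, ← pow_mul]
  refine Nat.pow_le_pow_right (by norm_num) ?_
  have : s + (s * s + 2) ≤ 4 * s ^ 3 := by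
    have : 1 * s ≤ s * s := Nat.mul_le_mul_right s hs
    have : 1 * (s * s) ≤ s * (s * s) := Nat.mul_le_mul_right _ hs
    have : s ^ 3 = s * (s * s) := by ring
    omega
  calc _ ≤ 4 * s ^ 3 * s := Nat.mul_le_mul_right s this
    _ = _ := by ring

/-- A threshold gate with real weights can be given integer weights. -/
theorem ThrGate.exists_int {m s : ℕ} (g : ThrGate ℝ m) (hs : {i | g.weight i ≠ 0}.ncard < s) :
    ∃ g' : ThrGate ℤ m, (∀ x, g'.eval x = g.eval x) ∧ (∀ i, g.weight i = 0 → g'.weight i = 0) ∧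
      |g'.threshold| ≤ 2 ^ (4 * s ^ 4) ∧ ∀ i, |g'.weight i| ≤ 2 ^ (4 * s ^ 4) := by
  classical
  set R := Fintype.card (Option {i // g.weight i ≠ 0}) with hR
  have hRs : R ≤ s := by
    rw [hR, Fintype.card_option, Fintype.card_subtype]
    rw [Set.ncard_eq_toFinset_card'] at hs
    simpa [Set.toFinset_ofPred] using hs
  -- The threshold is one more weight, at `none`, multiplied by `-1`, so the gate is the sign of a
  -- single sum. Only nonzero weights are indices, so the bound depends on `s` and not on `m`.
  obtain ⟨v, hv, hvz⟩ := exists_int_weights hR.symm R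
    (fun o : Option {i // g.weight i ≠ 0} => o.elim g.threshold fun i => g.weight i)
    ((Set.ncard_le_card _).trans (by rw [Nat.card_eq_fintype_card]))
  have hb : ∀ o, |v o| ≤ 2 ^ (4 * s ^ 4) := fun o =>
    (hv o).trans (by exact_mod_cast weight_bound hRs (by omega))
  have hsum : ∀ {A : Type} [Ring A] (f : Fin m → A), (∀ i, g.weight i = 0 → f i = 0) →
      ∑ i, f i = ∑ i : {i // g.weight i ≠ 0}, f i := fun f hf => by
    rw [← Finset.sum_subtype (Finset.univ.filter fun i => g.weight i ≠ 0) (by simp) f]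
    exact (Finset.sum_filter_of_ne (p := fun i => g.weight i ≠ 0) fun i _ h h' => h (hf i h')).symm
  refine ⟨⟨fun i => if h : g.weight i ≠ 0 then v (some ⟨i, h⟩) else 0, v none⟩, fun x => ?_,
    fun i hi => by simp [hi], hb none, fun i => ?_⟩
  · have h := hvz (fun o => o.elim (-1) fun i => bitVal (x i)) (by
      rintro (_ | i)
      · simp
      · simp only [Option.elim, bitVal]
        split_ifs <;> simp)
    simp only [Fintype.sum_option, Option.elim] at h
    rw [ThrGate.eval, ThrGate.eval, decide_eq_decide, hsum (fun i => g.weight i * bitVal (x i)) (by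
      intro i hi; simp [hi]), hsum _ (by intro i hi; simp [hi])]
    have hc : ∀ i, ((bitVal (x i) : ℤ) : ℝ) = bitVal (x i) := fun i => by
      simp only [bitVal]
      split_ifs <;> simp
    simp only [hc] at h
    push_cast at h
    have hd : ∀ i : {i // g.weight i ≠ 0},
        (if h : g.weight i ≠ 0 then v (some ⟨i, h⟩) else 0) = v (some i) := fun i => dif_pos i.2
    simp only [hd]
    constructor
    · intro h'
      have := h.1 (by linarith)
      linarith
    · intro h'
      have := h.2 (by linarith)
      linarith
  · dsimp only
    split_ifs
    · exact hb _
    · simp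

/-- A circuit with real weights can be given integer weights. -/
theorem ThrThr.exists_int {n s : ℕ} (c : ThrThr ℝ n) (hs : c.size ≤ s) :
    ∃ c' : ThrThr ℤ n, (∀ x, c'.eval x = c.eval x) ∧ c'.size ≤ s ∧ c'.WeightsLE (4 * s ^ 4) := by
  rw [ThrThr.size] at hs
  have h1 : ∀ j, {i | (c.bottom j).weight i ≠ 0}.ncard < s := fun j => by
    have := Set.ncard_le_ncard (show {i | (c.bottom j).weight i ≠ 0} ⊆
      {i | ∃ j, (c.bottom j).weight i ≠ 0} from fun i hi => ⟨j, hi⟩) (Set.toFinite _)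
    omega
  have h2 : {j | c.top.weight j ≠ 0}.ncard < s := by
    have := Set.ncard_le_card {j | c.top.weight j ≠ 0}
    rw [Nat.card_eq_fintype_card, Fintype.card_fin] at this
    omega
  choose b hb hb0 hbt hbw using fun j => (c.bottom j).exists_int (h1 j)
  obtain ⟨t, ht, -, htt, htw⟩ := c.top.exists_int h2
  refine ⟨⟨c.width, b, t⟩, fun x => ?_, ?_, ⟨htt, htw⟩, fun j => ⟨hbt j, hbw j⟩⟩
  · rw [ThrThr.eval, ThrThr.eval, ht]
    simp only [hb]
  · rw [ThrThr.size]
    refine le_trans (Nat.add_le_add_left (Set.ncard_le_ncard ?_ (Set.toFinite _)) _) hs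
    rintro i ⟨j, hj⟩
    exact ⟨j, fun h => hj (hb0 j i h)⟩

theorem Ram.exists_of_prob_pos {p : Ram} {inp : List ℤ} {T : ℕ} {Q : List ℤ → Prop}
    (h : 0 < p.prob inp T Q) : ∃ out, Q out := by
  rw [Ram.prob] at h
  have h1 : Nat.card {r : Fin T → Bool // ∃ out, Q out ∧ p.Outputs inp (extendCoins r) T out} ≠ 0 :=
    fun h0 => by simp [h0] at h
  obtain ⟨⟨⟨_, out, ho, _⟩⟩, _⟩ := Nat.card_ne_zero.1 h1
  exact ⟨out, ho⟩

/-- Structure lemma for `THR ∘ THR` circuits: the equivalent `DISJOR ∘ MAJ ∘ MAJ` circuits, and the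
randomized reduction that finds them. -/
theorem mainTheorem6 :
    (∃ C : ℕ, ∀ s : ℕ → ℕ,
      (fun n => Real.logb 2 (s n)) =o[Filter.atTop] (fun n : ℕ => (n : ℝ)) →
      ∀ n : ℕ, 0 < n → ∀ ε : ℝ, Real.logb 2 (s n) / n < ε → ε < 1 →
      ∀ c : ThrThr ℝ n, c.size ≤ s n →
        ∃ d : DisjOrMajMaj n,
          d.Realizes c.eval (fanInBound C n (s n) ε) (subSizeBound C (s n) ε)) ∧
    (∃ p : Ram, ∀ k : ℕ, ∃ C : ℕ, ∀ s : ℕ → ℕ,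
      (fun n => Real.logb 2 (s n)) =o[Filter.atTop] (fun n : ℕ => (n : ℝ)) →
      ∀ n : ℕ, 0 < n → ∀ ε : ℝ, Real.logb 2 (s n) / n < ε → ε < 1 →
      ∀ c : ThrThr ℤ n, c.size ≤ s n → c.WeightsLE (k * s n ^ k) →
        p.HaltsWithin ((⌈1 / ε⌉₊ : ℤ) :: c.encode) ⌊timeBound C n (s n) ε⌋₊ ∧
        2 / 3 ≤ p.prob ((⌈1 / ε⌉₊ : ℤ) :: c.encode) ⌊timeBound C n (s n) ε⌋₊
          (fun out => ∃ d : DisjOrMajMaj n, out = d.encode ∧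
            d.Realizes c.eval (fanInBound C n (s n) ε) (subSizeBound C (s n) ε))) := by
  obtain ⟨p, hp⟩ := exists_reduction
  refine ⟨?_, p, fun k => ?_⟩
  -- The parameter 4 matches the bit length `4 * s ^ 4` from `ThrThr.exists_int`.
  · obtain ⟨C, hC⟩ := hp 4
    refine ⟨C, fun s _ n _ ε hε hε1 c hc => ?_⟩
    obtain ⟨c', he, hc', hW⟩ := c.exists_int hc
    have h := (hC (s n) n ε (eps_pos (c.size_pos.trans_le hc) hε) hε1 c' hc' hW).2
    obtain ⟨_, d, -, hd, hA, hB⟩ := Ram.exists_of_prob_pos (lt_of_lt_of_le (by norm_num) h)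
    exact ⟨d, fun x => (hd x).trans (he x), hA, hB⟩
  · obtain ⟨C, hC⟩ := hp k
    exact ⟨C, fun s _ n _ ε hε hε1 c hc hW =>
      hC (s n) n ε (eps_pos (c.size_pos.trans_le hc) hε) hε1 c hc hW⟩
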